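/- Let $r\ge 1$ and $R\ge 2^{r-1}+1$ be integers. A *random predicate matrix* of arity $r$ and rank $R$ is a random matrix $M\in\mathbb C^{2^r\times 2^r}$ that almost surely is Hermitian positive semidefinite of rank $R$ with $\|M\|_{\mathrm{op}}\le C$ for some constant $C$, and whose column space almost surely equals $\operatorname{span}(v_1,\dots,v_R)$ for random vectors $v_1,\dots,v_R\in\mathbb C^{2^r}$ whose joint law is absolutely continuous with respect to Lebesgue measure on $(\mathbb C^{2^r})^R$. Its law is fixed once and for all, independently of the number of qubits $n$. For an $r$-tuple $T$ of distinct qubits in $[n]$ let $M_T=M|_T\otimes\mathrm{Id}_{[n]\setminus T}$ act on $\mathbb C^{2^n}$. An *$M$-Hamiltonian* on $n$ qubits with $m$ terms is given by $m$ distinct such tuples $T_1,\dots,T_m$. For $\varepsilon>0$, an *$\varepsilon$-sparsifier* of it is a weight function $w:[m]\to\mathbb R_{\ge0}$ with $$(1-\varepsilon)\sum_{i=1}^m\langle\psi,M_{T_i}\psi\rangle\ \le\ \sum_{i=1}^m w(i)\,\langle\psi,M_{T_i}\psi\rangle\ \le\ (1+\varepsilon)\sum_{i=1}^m\langle\psi,M_{T_i}\psi\rangle\qquad\text{for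 all }\psi\in\mathbb C^{2^n};$$ its *size* is $|\{i: w(i)>0\}|$. **Theorem.** There is an absolute constant $c>0$ such that the following holds. For all such $r,R$, every law $D$ of a random predicate matrix of arity $r$ and rank $R$, and every $\delta>0$, there are constants $K,\ell,a,b$ and a randomized algorithm, depending only on $r,R,D,\delta$, such that: 1. on input $n$, distinct tuples $T_1,\dots,T_m\in[n]^r$ of distinct qubits, and a positive rational number $\hat\varepsilon$, the algorithm always halts within $a(n+m+1)^b$ steps (of a random access machine with unit-cost addition, subtraction, comparison, array access and fair coin flips on natural numbers, $\hat\varepsilon$ being given by numerator and denominator), and it outputs rational weights $w:[m]\to\mathbb Q_{\ge0}$; 2. with probability at least $1-\delta$ over $M\sim D$, the following holds simultaneously for all $n$, $m$, all $M$-Hamiltonians $\mathcal H=\{(T_i,M)\}_{i\in[m]}$ on $n$ qubits and all real $\varepsilon>0$: * $\mathcal H$ has an $\varepsilon$-sparsifier of size at most $K\varepsilon^{-2}n\log^{\ell}(n+2)$, that is, $\widetilde O_r(\varepsilon^{-2}n)$; * for every positive rational $\hat\varepsilon$ with $\hat\varepsilon\le\varepsilon\le2\hat\varepsilon$ (in particular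 for $\hat\varepsilon=\varepsilon$ if $\varepsilon$ is rational), the output of the algorithm on $n,T_1,\dots,T_m,\hat\varepsilon$ is, with probability at least $1-2^{-cn}$ over its coin flips, an $\varepsilon$-sparsifier of $\mathcal H$ of size at most $K\varepsilon^{-2}n\log^{\ell}(n+2)$. -/

import Mathlib

open MeasureTheory
open scoped ComplexOrder

noncomputable section

/-! ### Predicate matrices, local terms, energies, sparsifiers -/

/-- Computational basis labels of a system of `n` qubits. -/
abbrev Bits (n : ℕ) : Type := Fin n → Bool

/-- Entrywise (product) measurable structure on matrices. -/
instance matrixMeasurableSpace {m n α : Type*} [MeasurableSpace α] :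
    MeasurableSpace (Matrix m n α) :=
  inferInstanceAs (MeasurableSpace (m → n → α))

/-- The operator `M_T`: the matrix `M` acts on the qubits `T 0, …, T (r-1)`, in this order, and the
identity acts on the other qubits. -/
def localTerm {r n : ℕ} (T : Fin r ↪ Fin n) (M : Matrix (Bits r) (Bits r) ℂ) :
    Matrix (Bits n) (Bits n) ℂ :=
  Matrix.of fun x y =>
    if ∀ i : Fin n, (∀ j : Fin r, T j ≠ i) → x i = y i then
      M (fun j => x (T j)) (fun j => y (T j))
    else 0

/-- The energy `⟨ψ, M_T ψ⟩` of a (not necessarily normalised) state `ψ`. It is a real number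
whenever `M` is Hermitian. -/
def energy {r n : ℕ} (T : Fin r ↪ Fin n) (M : Matrix (Bits r) (Bits r) ℂ)
    (ψ : Bits n → ℂ) : ℝ :=
  (star ψ ⬝ᵥ (localTerm T M).mulVec ψ).re

/-- `w` is an `ε`-sparsifier of the `M`-Hamiltonian `{(T i, M)}`: the weights are nonnegative and
every state has its weighted energy within `[1 - ε, 1 + ε]` times its energy. -/
def IsSparsifier {r n m : ℕ} (T : Fin m ↪ (Fin r ↪ Fin n)) (M : Matrix (Bits r) (Bits r) ℂ)
    (ε : ℝ) (w : Fin m → ℝ) : Prop :=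
  (∀ i, 0 ≤ w i) ∧
  ∀ ψ : Bits n → ℂ,
    (1 - ε) * ∑ i, energy (T i) M ψ ≤ ∑ i, w i * energy (T i) M ψ ∧
    ∑ i, w i * energy (T i) M ψ ≤ (1 + ε) * ∑ i, energy (T i) M ψ

/-- The size of a weight function: the number of terms of positive weight. -/
def weightSize {m : ℕ} (w : Fin m → ℝ) : ℕ :=
  Nat.card {i : Fin m // 0 < w i}

/-! ### Random predicate matrices -/

/-- `D` is the law of a random predicate matrix of arity `r` and rank `R`: almost surely the
matrix is positive semidefinite of rank `R`, its operator norm is bounded by a constant, and its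
column space is the span of random vectors `v_1, …, v_R` whose joint law is absolutely continuous
with respect to Lebesgue measure on `(ℂ^(2^r))^R`. Apart from this, nothing is assumed about how
the matrix depends on the vectors; `π` is the joint law of the matrix and the vectors. -/
structure IsPredicateLaw {r : ℕ} (R : ℕ) (D : Measure (Matrix (Bits r) (Bits r) ℂ)) : Prop where
  coupling : ∃ π : Measure (Matrix (Bits r) (Bits r) ℂ × (Fin R → Bits r → ℂ)),
    IsProbabilityMeasure π ∧
    π.map Prod.fst = D ∧
    π.map Prod.snd ≪ volume ∧
    ∀ᵐ p ∂π, p.1.PosSemidef ∧ p.1.rank = R ∧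
      LinearMap.range p.1.mulVecLin = Submodule.span ℂ (Set.range p.2)
  bounded : ∃ C : ℝ, ∀ᵐ M ∂D, ‖Matrix.toEuclideanCLM (n := Bits r) (𝕜 := ℂ) M‖ ≤ C

/-! ### Randomised algorithms with a step count

Programs over integer variables and integer arrays (a structured random access machine), with
addition and truncated subtraction as the only arithmetic operations, so that `t` steps lengthen
the binary representation of the numbers in the memory by at most `t` bits, and with fair coins.
Every elementary instruction and every test costs one step. -/

/-- Programs; the arguments are names of variables and arrays, except for `c` in `const x c`. -/
inductive Prog : Type
  /-- `x := c` -/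
  | const (x c : ℕ)
  /-- `x := y + z` -/
  | add (x y z : ℕ)
  /-- `x := max (y - z) 0` -/
  | sub (x y z : ℕ)
  /-- `x := A[y]` -/
  | load (x A y : ℕ)
  /-- `A[x] := y` -/
  | store (A x y : ℕ)
  /-- `x :=` the outcome of a fresh fair coin, `0` or `1` -/
  | flip (x : ℕ)
  /-- first `p`, then `q` -/
  | seq (p q : Prog)
  /-- `p` if `x < y`, and `q` otherwise -/
  | cond (x y : ℕ) (p q : Prog)
  /-- repeat `p` as long as `x < y` -/
  | loop (x y : ℕ) (p : Prog)

/-- The memory: variables, arrays, and the number of coins used so far. -/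
structure Store where
  var : ℕ → ℕ
  arr : ℕ → ℕ → ℕ
  coins : ℕ

/-- Assign a value to a variable. -/
def Store.setVar (s : Store) (x v : ℕ) : Store :=
  { s with var := Function.update s.var x v }

/-- Assign a value to an array entry. -/
def Store.setArr (s : Store) (A k v : ℕ) : Store :=
  { s with arr := Function.update s.arr A (Function.update (s.arr A) k v) }

/-- One step of a computation. A configuration consists of the programs that remain to be executed,
in this order, and the memory; it is halted when no program remains. The coins are read off
`tape` one after the other. -/
def step (tape : ℕ → Bool) : List Prog × Store → List Prog × Store
  | ([], s) => ([], s)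
  | (.const x c :: k, s) => (k, s.setVar x c)
  | (.add x y z :: k, s) => (k, s.setVar x (s.var y + s.var z))
  | (.sub x y z :: k, s) => (k, s.setVar x (s.var y - s.var z))
  | (.load x A y :: k, s) => (k, s.setVar x (s.arr A (s.var y)))
  | (.store A x y :: k, s) => (k, s.setArr A (s.var x) (s.var y))
  | (.flip x :: k, s) =>
      (k, { s.setVar x (tape s.coins).toNat with coins := s.coins + 1 })
  | (.seq p q :: k, s) => (p :: q :: k, s)
  | (.cond x y p q :: k, s) => if s.var x < s.var y then (p :: k, s) else (q :: k, s)
  | (.loop x y p :: k, s) =>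
      if s.var x < s.var y then (p :: .loop x y p :: k, s) else (k, s)

/-- The configuration reached after `t` steps from the memory `s`. -/
def runFor (P : Prog) (tape : ℕ → Bool) (t : ℕ) (s : Store) : List Prog × Store :=
  (step tape)^[t] ([P], s)

/-- The input `(n, m, T, p / q)`: variables `0, 1, 2, 3` hold `n, m, p, q`, entry `i` of array `j`
holds the `j`-th qubit of the `i`-th term, and everything else is `0`. -/
def inputStore {r n m : ℕ} (T : Fin m ↪ (Fin r ↪ Fin n)) (p q : ℕ) : Store where
  var := fun x => if x = 0 then n else if x = 1 then m else if x = 2 then p else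
    if x = 3 then q else 0
  arr := fun j i => if h : i < m ∧ j < r then (T ⟨i, h.1⟩ ⟨j, h.2⟩ : ℕ) else 0
  coins := 0

/-- The output weights: the weight of term `i` is the fraction whose numerator and denominator are
the `i`-th entries of the arrays `r` and `r + 1` (by convention the weight is `0` if the denominator
is `0`). -/
def outputWeight (r m : ℕ) (s : Store) : Fin m → ℝ :=
  fun i => (s.arr r i : ℝ) / (s.arr (r + 1) i : ℝ)

/-- The law of an infinite sequence of independent fair coins. -/
def coinMeasure : Measure (ℕ → Bool) :=
  Measure.infinitePi fun _ => (PMF.uniformOfFintype Bool).toMeasure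

end

/-!
Fix `r`, `R` and a law `D`. The proof rests on a spectral gap: with probability at least `1 - δ`
the matrix `M` lies in a set `gapSet r C g` of matrices `0 ≤ M ≤ C`, and any `2 ^ r` terms
of such an `M` whose tuples form a sunflower (they agree at a nonempty proper set `S` of positions, and
are disjoint otherwise) have total energy at least a constant times `‖ψ‖ ^ 2`.

The gap (`exists_gapSet_of_isPredicateLaw`) needs only that the sum of the terms of one standard
sunflower is positive definite almost surely. If a state has energy `0` then all its slices are
orthogonal to the column space of `M`, so that some linear map depending linearly on the vectors
`v_1, …, v_R` is not injective. It suffices to find a single tuple of vectors for which the map is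
injective, since then it is injective for almost every tuple (`ae_overlapMatrix_injective`, where
a determinant is a nonzero polynomial on each line through the good point). For `v_c` one takes the
coefficient of `t ^ c` in a product vector whose two factors, on `S` and on its complement, have
the entries `1, t, t ^ 2, …`. There are at most `2 ^ (r - 1) + 1` such coefficients, and
orthogonality turns into the vanishing of a polynomial at too many points
(`exists_vectors_sunflower`). Compactness gives a positive gap, and as `g` tends to `0` the sets
`gapSet r C g` exhaust almost all matrices.

Call a term heavy if one of its qubits lies in at least `heavyBound r` terms. At most
`heavyBound r * n` terms are light (`card_not_heavy_le`), and these are kept with weight `1`. By the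
sunflower lemma the terms through a qubit of large degree contain many sunflowers without common terms through
this qubit, so that the `N` heavy terms have total energy at least `λ N ‖ψ‖ ^ 2` for a constant
`λ > 0` (`card_heavy_mul_le_sum_energy`). An additive error of `ε λ N ‖ψ‖ ^ 2` is thus a relative
error of `ε`, and uniform sampling is good enough: the list of terms is cut into `O(n / ε ^ 2)`
blocks of size `2 ^ J`, one uniformly random term is chosen in each block, and it is kept with weight
`2 ^ J` if it is heavy. A matrix Hoeffding inequality (`card_filter_matrix_sum_le`) shows that the
error is small except with probability `2 ^ (-n)` (`one_sub_le_coinMeasure_isSparsifier`). Its proof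
avoids the exponential of a matrix: the trace of the Taylor polynomials of `cosh` grows by at most
a constant factor on average with each summand, by the second-order expansion of `tr (A + X) ^ k`.

The algorithm (`progSparsify`) only uses additions, comparisons and coins. It works with the
integer `k = min (m + 1) (q / p)` in place of `1 / ε`, and with block sizes that are powers of `2`, so
that a uniform position in a block is a string of coins. If blocks have more than one element then
`m` is larger than `k ^ 2`, and the truncation at `m + 1` has no effect. No logarithmic
factor is lost. The existence of small sparsifiers follows from the positive probability of
success of the algorithm.
-/

/-! ### Matrix Hoeffding inequality -/

section Hoeffding
open Finset Matrix

theorem add_pow_eq_add_sum_left {R : Type*} [Ring R] (A X : R) (k : ℕ) :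
    (A + X) ^ k = A ^ k + ∑ i ∈ range k, A ^ (k - 1 - i) * X * (A + X) ^ i := by
  induction k with
  | zero => simp
  | succ k ih =>
    have h : ∀ i ∈ range k, A ^ (k + 1 - 1 - i) * X * (A + X) ^ i
        = A * (A ^ (k - 1 - i) * X * (A + X) ^ i) := by
      intro i hi
      rw [mem_range] at hi
      rw [show k + 1 - 1 - i = (k - 1 - i) + 1 by omega, pow_succ']
      noncomm_ring
    rw [sum_range_succ, sum_congr rfl h, ← mul_sum, pow_succ' (A + X), add_mul]
    nth_rewrite 1 [ih]
    simp [mul_add, pow_succ', add_assoc]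

theorem add_pow_eq_add_sum_right {R : Type*} [Ring R] (A X : R) (k : ℕ) :
    (A + X) ^ k = A ^ k + ∑ i ∈ range k, (A + X) ^ i * X * A ^ (k - 1 - i) := by
  induction k with
  | zero => simp
  | succ k ih =>
    have h : ∀ i ∈ range k, (A + X) ^ i * X * A ^ (k + 1 - 1 - i)
        = (A + X) ^ i * X * A ^ (k - 1 - i) * A := by
      intro i hi
      rw [mem_range] at hi
      rw [show k + 1 - 1 - i = (k - 1 - i) + 1 by omega, pow_succ]
      noncomm_ring
    rw [sum_range_succ, sum_congr rfl h, ← sum_mul, pow_succ (A + X), mul_add]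
    nth_rewrite 1 [ih]
    simp [add_mul, pow_succ, add_assoc]

variable {d : Type*} [Fintype d] [DecidableEq d]

/-- Second-order Taylor formula for the trace of a power, with exact remainder. -/
theorem trace_add_pow (A X : Matrix d d ℂ) (k : ℕ) :
    ((A + X) ^ k).trace = (A ^ k).trace + k * (X * A ^ (k - 1)).trace +
      ∑ i ∈ range k, ∑ l ∈ range i, (X * (A + X) ^ l * X * A ^ (k - 2 - l)).trace := by
  have h : ∀ i ∈ range k, (A ^ (k - 1 - i) * X * (A + X) ^ i).trace = (X * A ^ (k - 1)).trace +
      ∑ l ∈ range i, (X * (A + X) ^ l * X * A ^ (k - 2 - l)).trace := by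
    intro i hi
    rw [mem_range] at hi
    rw [mul_assoc, trace_mul_comm, add_pow_eq_add_sum_right, mul_add, add_mul, trace_add, mul_assoc,
      ← pow_add, show i + (k - 1 - i) = k - 1 by omega, mul_sum, sum_mul, trace_sum]
    congr 1
    refine sum_congr rfl fun l hl => ?_
    rw [mem_range] at hl
    rw [show k - 2 - l = (i - 1 - l) + (k - 1 - i) by omega, pow_add]
    simp only [mul_assoc]
  nth_rewrite 1 [add_pow_eq_add_sum_left]
  rw [trace_add, trace_sum, sum_congr rfl h, sum_add_distrib, sum_const, card_range, nsmul_eq_mul,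
    add_assoc]

theorem Matrix.IsHermitian.exists_diagonalization {A : Matrix d d ℂ} (hA : A.IsHermitian) :
    ∃ (U : Matrix d d ℂ) (a : d → ℝ), U * Uᴴ = 1 ∧ Uᴴ * U = 1 ∧
      ∀ k : ℕ, A ^ k = U * diagonal (fun i => ((a i ^ k : ℝ) : ℂ)) * Uᴴ := by
  have h1 : (hA.eigenvectorUnitary : Matrix d d ℂ) * (hA.eigenvectorUnitary : Matrix d d ℂ)ᴴ = 1 :=
    Unitary.coe_mul_star_self _
  have h2 : (hA.eigenvectorUnitary : Matrix d d ℂ)ᴴ * (hA.eigenvectorUnitary : Matrix d d ℂ) = 1 :=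
    Unitary.coe_star_mul_self _
  have h3 := hA.spectral_theorem
  rw [Unitary.conjStarAlgAut_apply, star_eq_conjTranspose] at h3
  generalize (hA.eigenvectorUnitary : Matrix d d ℂ) = U at h1 h2 h3
  generalize hA.eigenvalues = a at h3
  refine ⟨U, a, h1, h2, fun k => ?_⟩
  induction k with
  | zero => simp [h1]
  | succ k ih =>
    rw [pow_succ, ih]
    nth_rewrite 1 [h3]
    calc _ = U * diagonal (fun i => ((a i ^ k : ℝ) : ℂ)) * (Uᴴ * U) *
          diagonal (RCLike.ofReal ∘ a) * Uᴴ := by simp only [mul_assoc]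
      _ = _ := by
          rw [h2, mul_one, mul_assoc U, diagonal_mul_diagonal]
          simp [pow_succ]

/-- A matrix of norm at most `c` has rows of norm at most `c` in any pair of orthonormal bases. -/
theorem sum_norm_sq_row_le {X U V : Matrix d d ℂ} {c : ℝ} (hX : X.IsHermitian)
    (hc : (((c ^ 2 : ℝ) : ℂ) • (1 : Matrix d d ℂ) - X * X).PosSemidef)
    (hU : Uᴴ * U = 1) (hV : V * Vᴴ = 1) (i : d) :
    ∑ j, ‖(Uᴴ * X * V) i j‖ ^ 2 ≤ c ^ 2 := by
  have h := (hc.conjTranspose_mul_mul_same U).diag_nonneg (i := i)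
  have e : Uᴴ * (((c ^ 2 : ℝ) : ℂ) • (1 : Matrix d d ℂ) - X * X) * U
      = ((c ^ 2 : ℝ) : ℂ) • (1 : Matrix d d ℂ) - (Uᴴ * X * V) * (Uᴴ * X * V)ᴴ := by
    rw [conjTranspose_mul, conjTranspose_mul, conjTranspose_conjTranspose, hX.eq, mul_sub, sub_mul]
    congr 1
    · simp [hU]
    · calc _ = Uᴴ * X * (V * Vᴴ) * X * U := by rw [hV]; simp only [mul_assoc, mul_one]
        _ = _ := by simp only [mul_assoc]
  rw [e, Matrix.sub_apply, mul_apply] at h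
  have h2 := (Complex.le_def.mp h).1
  simp only [Matrix.smul_apply, one_apply_eq, smul_eq_mul, mul_one, Complex.sub_re, Complex.ofReal_re,
    Complex.re_sum, conjTranspose_apply, Complex.zero_re, sub_nonneg] at h2
  refine le_trans (le_of_eq (sum_congr rfl fun j _ => ?_)) h2
  rw [← Complex.normSq_eq_norm_sq, RCLike.star_def, Complex.mul_conj, Complex.ofReal_re]

theorem trace_pow_even_eq {A U : Matrix d d ℂ} {a : d → ℝ} (hU : Uᴴ * U = 1) {k : ℕ}
    (h : A ^ k = U * diagonal (fun i => ((a i ^ k : ℝ) : ℂ)) * Uᴴ) :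
    (A ^ k).trace.re = ∑ i, a i ^ k := by
  rw [h, mul_assoc, trace_mul_comm, mul_assoc, hU, mul_one, trace_diagonal, Complex.re_sum]
  simp only [Complex.ofReal_re]

theorem pow_mul_pow_le_add {x y : ℝ} {a l q : ℕ} (h : a + l = 2 * q) :
    x ^ a * y ^ l ≤ x ^ (2 * q) + y ^ (2 * q) := by
  have hx : |x| ^ (2 * q) = x ^ (2 * q) := by rw [pow_mul, pow_mul, sq_abs]
  have hy : |y| ^ (2 * q) = y ^ (2 * q) := by rw [pow_mul, pow_mul, sq_abs]
  have h1 : x ^ a * y ^ l ≤ |x| ^ a * |y| ^ l := by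
    rw [← abs_pow, ← abs_pow, ← abs_mul]; exact le_abs_self _
  have h0 := abs_nonneg x
  have h0' := abs_nonneg y
  rw [← hx, ← hy, ← h]
  rcases le_total |x| |y| with hxy | hxy
  · have : |x| ^ a * |y| ^ l ≤ |y| ^ a * |y| ^ l := by gcongr
    rw [← pow_add] at this
    have : 0 ≤ |x| ^ (a + l) := by positivity
    linarith
  · have : |x| ^ a * |y| ^ l ≤ |x| ^ a * |x| ^ l := by gcongr
    rw [← pow_add] at this
    have : 0 ≤ |y| ^ (a + l) := by positivity
    linarith

/-- The estimate of the remainder terms in `trace_add_pow`: in eigenbases of `A` and `B` the trace is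
an average of products `α ^ a * β ^ l` of eigenvalues, with weights `‖Y i j‖ ^ 2` whose row and column
sums are at most `c ^ 2`. -/
theorem re_trace_mul_pow_mul_pow_le {A B X : Matrix d d ℂ} (hA : A.IsHermitian)
    (hB : B.IsHermitian) (hX : X.IsHermitian) {c : ℝ}
    (hc : (((c ^ 2 : ℝ) : ℂ) • (1 : Matrix d d ℂ) - X * X).PosSemidef) {a l q : ℕ}
    (h : a + l = 2 * q) :
    (X * B ^ l * X * A ^ a).trace.re ≤
      c ^ 2 * ((A ^ (2 * q)).trace.re + (B ^ (2 * q)).trace.re) := by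
  obtain ⟨U, α, hU1, hU2, hUk⟩ := hA.exists_diagonalization
  obtain ⟨V, β, hV1, hV2, hVk⟩ := hB.exists_diagonalization
  rw [trace_pow_even_eq hU2 (hUk _), trace_pow_even_eq hV2 (hVk _)]
  set Y := Uᴴ * X * V with hY
  have e : (X * B ^ l * X * A ^ a).trace.re = ∑ i, ∑ j, ‖Y i j‖ ^ 2 * (α i ^ a * β j ^ l) := by
    have : (X * B ^ l * X * A ^ a).trace
        = (Y * diagonal (fun i => ((β i ^ l : ℝ) : ℂ)) * Yᴴ *
            diagonal (fun i => ((α i ^ a : ℝ) : ℂ))).trace := by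
      rw [hUk a, hVk l, ← mul_assoc, ← mul_assoc, trace_mul_comm, hY, conjTranspose_mul,
        conjTranspose_mul, conjTranspose_conjTranspose, hX.eq]
      simp only [mul_assoc]
    rw [this, trace, Complex.re_sum]
    refine sum_congr rfl fun i _ => ?_
    rw [diag_apply, mul_diagonal, mul_apply, sum_mul, Complex.re_sum]
    refine sum_congr rfl fun j _ => ?_
    rw [mul_diagonal, conjTranspose_apply, RCLike.star_def]
    have : Y i j * ((β j ^ l : ℝ) : ℂ) * (starRingEnd ℂ) (Y i j) * ((α i ^ a : ℝ) : ℂ) =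
        ((‖Y i j‖ ^ 2 * (α i ^ a * β j ^ l) : ℝ) : ℂ) := by
      rw [mul_right_comm (Y i j), Complex.mul_conj, Complex.normSq_eq_norm_sq]
      push_cast
      ring
    rw [this, Complex.ofReal_re]
  rw [e]
  have row : ∀ i, ∑ j, ‖Y i j‖ ^ 2 ≤ c ^ 2 := sum_norm_sq_row_le hX hc hU2 hV1
  have col : ∀ j, ∑ i, ‖Y i j‖ ^ 2 ≤ c ^ 2 := by
    intro j
    refine le_trans (le_of_eq (sum_congr rfl fun i _ => ?_)) (sum_norm_sq_row_le hX hc hV2 hU1 j)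
    have : Vᴴ * X * U = Yᴴ := by
      rw [hY, conjTranspose_mul, conjTranspose_mul, conjTranspose_conjTranspose, hX.eq, mul_assoc]
    rw [this, conjTranspose_apply, norm_star]
  have e2 : ∀ x : ℝ, 0 ≤ x ^ (2 * q) := fun x => by rw [pow_mul]; positivity
  calc _ ≤ ∑ i, ∑ j, ‖Y i j‖ ^ 2 * (α i ^ (2 * q) + β j ^ (2 * q)) := by
        gcongr with i _ j _
        exact pow_mul_pow_le_add h
    _ = ∑ i, (∑ j, ‖Y i j‖ ^ 2) * α i ^ (2 * q) + ∑ j, (∑ i, ‖Y i j‖ ^ 2) * β j ^ (2 * q) := by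
        simp only [mul_add, sum_add_distrib, sum_mul]
        congr 1
        exact sum_comm
    _ ≤ ∑ i, c ^ 2 * α i ^ (2 * q) + ∑ j, c ^ 2 * β j ^ (2 * q) := by
        gcongr with i _ j _
        · exact e2 _
        · exact row i
        · exact e2 _
        · exact col j
    _ = _ := by rw [mul_add, mul_sum, mul_sum]

theorem posSemidef_sq_sub_mul_self {X : Matrix d d ℂ} {c : ℝ} (hc : 0 < c)
    (h1 : ((c : ℂ) • (1 : Matrix d d ℂ) - X).PosSemidef)
    (h2 : ((c : ℂ) • (1 : Matrix d d ℂ) + X).PosSemidef) :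
    (((c ^ 2 : ℝ) : ℂ) • (1 : Matrix d d ℂ) - X * X).PosSemidef := by
  have h3 := (h2.conjTranspose_mul_mul_same ((c : ℂ) • (1 : Matrix d d ℂ) - X)).add
    (h1.conjTranspose_mul_mul_same ((c : ℂ) • (1 : Matrix d d ℂ) + X))
  rw [h1.isHermitian.eq, h2.isHermitian.eq] at h3
  have h4 := h3.smul (a := (((2 * c)⁻¹ : ℝ) : ℂ)) (by exact_mod_cast by positivity)
  convert h4 using 1
  have e : ((c : ℂ) • (1 : Matrix d d ℂ) - X) * ((c : ℂ) • (1 : Matrix d d ℂ) + X) *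
      ((c : ℂ) • (1 : Matrix d d ℂ) - X) + ((c : ℂ) • (1 : Matrix d d ℂ) + X) *
      ((c : ℂ) • (1 : Matrix d d ℂ) - X) * ((c : ℂ) • (1 : Matrix d d ℂ) + X)
      = ((2 * c : ℝ) : ℂ) • (((c ^ 2 : ℝ) : ℂ) • (1 : Matrix d d ℂ) - X * X) := by
    simp only [mul_add, add_mul, mul_sub, sub_mul, smul_mul_assoc, mul_smul_comm, one_mul, mul_one,
      smul_sub, smul_add, smul_smul]
    push_cast
    module
  rw [e, smul_smul, ← Complex.ofReal_mul, inv_mul_cancel₀ (by positivity), Complex.ofReal_one,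
    one_smul]

/-- The normalised even moment `tr A ^ (2 p) / (2 p)!`. -/
noncomputable def evenMoment (p : ℕ) (A : Matrix d d ℂ) : ℝ :=
  (A ^ (2 * p)).trace.re / (2 * p).factorial

/-- The trace of the Taylor polynomial of `cosh` of degree `2 P`, evaluated at a matrix. -/
noncomputable def truncCosh (P : ℕ) (A : Matrix d d ℂ) : ℝ :=
  ∑ p ∈ range (P + 1), evenMoment p A

theorem evenMoment_nonneg {A : Matrix d d ℂ} (hA : A.IsHermitian) (p : ℕ) :
    0 ≤ evenMoment p A := by
  obtain ⟨U, α, hU1, hU2, hUk⟩ := hA.exists_diagonalization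
  rw [evenMoment, trace_pow_even_eq hU2 (hUk _)]
  refine div_nonneg (sum_nonneg fun i _ => ?_) (Nat.cast_nonneg _)
  rw [pow_mul]
  positivity

/-- The change of an even moment: a term linear in `X`, which averages to zero, and a remainder bounded
by the even moments of the next lower order. -/
theorem evenMoment_add_le {A X : Matrix d d ℂ} (hA : A.IsHermitian) (hX : X.IsHermitian) {c : ℝ}
    (hc : (((c ^ 2 : ℝ) : ℂ) • (1 : Matrix d d ℂ) - X * X).PosSemidef) (p : ℕ) :
    evenMoment (p + 1) (A + X) ≤ evenMoment (p + 1) A +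
      (X * A ^ (2 * p + 1)).trace.re / (2 * p + 1).factorial +
      c ^ 2 / 2 * (evenMoment p A + evenMoment p (A + X)) := by
  set g : ℝ := c ^ 2 * ((A ^ (2 * p)).trace.re + ((A + X) ^ (2 * p)).trace.re) with hg
  have h1 : ((A + X) ^ (2 * (p + 1))).trace.re ≤ (A ^ (2 * (p + 1))).trace.re +
      (2 * p + 2) * (X * A ^ (2 * p + 1)).trace.re + (2 * p + 2) * (2 * p + 1) / 2 * g := by
    rw [trace_add_pow, Complex.add_re, Complex.add_re, ← Complex.ofReal_natCast,
      Complex.re_ofReal_mul, Complex.re_sum, show 2 * (p + 1) - 1 = 2 * p + 1 by omega]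
    refine add_le_add (le_of_eq ?_) ?_
    · push_cast; ring
    · calc _ ≤ ∑ i ∈ range (2 * (p + 1)), ∑ _l ∈ range i, g := by
            refine sum_le_sum fun i hi => ?_
            rw [Complex.re_sum]
            refine sum_le_sum fun l hl => ?_
            rw [mem_range] at hi hl
            exact re_trace_mul_pow_mul_pow_le hA (hA.add hX) hX hc (by omega)
        _ = _ := by
            simp only [sum_const, card_range, nsmul_eq_mul, ← sum_mul]
            congr 1
            have := sum_range_id_mul_two (2 * (p + 1))
            rw [show 2 * (p + 1) - 1 = 2 * p + 1 by omega] at this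
            have h2 : (∑ i ∈ range (2 * (p + 1)), (i : ℝ)) * 2 = (2 * (p + 1)) * (2 * p + 1) := by
              have := congrArg (Nat.cast (R := ℝ)) this
              push_cast at this
              exact this
            linear_combination h2 / 2
  have f2 : ((2 * (p + 1)).factorial : ℝ) = (2 * p + 2) * (2 * p + 1) * (2 * p).factorial := by
    rw [show 2 * (p + 1) = 2 * p + 1 + 1 by ring, Nat.factorial_succ, Nat.factorial_succ]
    push_cast; ring
  have f1 : ((2 * p + 1).factorial : ℝ) = (2 * p + 1) * (2 * p).factorial := by
    rw [Nat.factorial_succ]; push_cast; ring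
  have f0 : (0 : ℝ) < (2 * p).factorial := by exact_mod_cast Nat.factorial_pos _
  unfold evenMoment
  rw [f2, f1, div_le_iff₀ (by positivity)]
  refine h1.trans (le_of_eq ?_)
  rw [hg]
  field_simp

/-- Adding a centred random matrix of norm at most `c` increases the mean of `truncCosh` at most by a
factor of `exp (2 * c ^ 2)`. -/
theorem sum_truncCosh_add_le {Ω : Type*} [Fintype Ω] {A : Matrix d d ℂ} (hA : A.IsHermitian)
    {X : Ω → Matrix d d ℂ} (hX : ∀ ω, (X ω).IsHermitian) {c : ℝ} (hc1 : c ^ 2 ≤ 1)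
    (hc : ∀ ω, (((c ^ 2 : ℝ) : ℂ) • (1 : Matrix d d ℂ) - X ω * X ω).PosSemidef)
    (h0 : ∑ ω, X ω = 0) (P : ℕ) :
    ∑ ω, truncCosh P (A + X ω) ≤
      Fintype.card Ω * Real.exp (2 * c ^ 2) * truncCosh P A := by
  have hlin : ∀ k : ℕ, ∑ ω, (X ω * A ^ k).trace.re = 0 := by
    intro k
    rw [← Complex.re_sum, ← trace_sum, ← sum_mul, h0, zero_mul, trace_zero, Complex.zero_re]
  have hmono : ∀ {B : Matrix d d ℂ}, B.IsHermitian →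
      ∑ p ∈ range P, evenMoment p B ≤ truncCosh P B := by
    intro B hB
    rw [truncCosh, sum_range_succ]
    linarith [evenMoment_nonneg hB P]
  have h1 : ∑ ω, truncCosh P (A + X ω) ≤ ∑ ω, (truncCosh P A +
      ∑ p ∈ range P, (X ω * A ^ (2 * p + 1)).trace.re / (2 * p + 1).factorial +
      c ^ 2 / 2 * (truncCosh P A + truncCosh P (A + X ω))) := by
    refine sum_le_sum fun ω _ => ?_
    have h2 : truncCosh P (A + X ω) ≤ truncCosh P A +
      ∑ p ∈ range P, (X ω * A ^ (2 * p + 1)).trace.re / (2 * p + 1).factorial +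
      c ^ 2 / 2 * (∑ p ∈ range P, evenMoment p A + ∑ p ∈ range P, evenMoment p (A + X ω)) := by
      have h3 := sum_le_sum fun p (_ : p ∈ range P) => evenMoment_add_le hA (hX ω) (hc ω) p
      simp only [sum_add_distrib, ← mul_sum] at h3
      rw [truncCosh, truncCosh, sum_range_succ', sum_range_succ']
      have h4 : evenMoment 0 (A + X ω) = evenMoment 0 A := by simp [evenMoment]
      rw [h4]
      linarith
    refine h2.trans ?_
    gcongr
    · exact hmono hA
    · exact hmono (hA.add (hX ω))
  have h5 : ∑ ω, ∑ p ∈ range P, (X ω * A ^ (2 * p + 1)).trace.re / (2 * p + 1).factorial = 0 := by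
    rw [sum_comm]
    refine sum_eq_zero fun p _ => ?_
    rw [← sum_div, hlin, zero_div]
  simp only [sum_add_distrib, ← mul_sum, h5, sum_const, card_univ, nsmul_eq_mul] at h1
  set S := ∑ ω, truncCosh P (A + X ω)
  have hH : 0 ≤ truncCosh P A := sum_nonneg fun p _ => evenMoment_nonneg hA p
  set H := (Fintype.card Ω : ℝ) * truncCosh P A with hHd
  have hH' : 0 ≤ H := by positivity
  -- `(1 + x) / (1 - x) ≤ 1 + 4 x` for `x = c ^ 2 / 2 ≤ 1 / 2`
  have h6 : S ≤ (1 + 2 * c ^ 2) * H := by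
    have h7 : (1 - c ^ 2 / 2) * S ≤ (1 + c ^ 2 / 2) * H := by linarith
    have h8 : (1 + c ^ 2 / 2) * H ≤ (1 - c ^ 2 / 2) * ((1 + 2 * c ^ 2) * H) := by
      nlinarith [mul_nonneg (mul_nonneg (sq_nonneg c) (sub_nonneg.mpr hc1)) hH']
    exact le_of_mul_le_mul_left (h7.trans h8) (by linarith)
  calc S ≤ (1 + 2 * c ^ 2) * H := h6
    _ ≤ Real.exp (2 * c ^ 2) * H := by
        gcongr
        linarith [Real.add_one_le_exp (2 * c ^ 2)]
    _ = _ := by rw [hHd]; ring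

theorem sum_truncCosh_add_sum_le {Ω : Type*} [Fintype Ω] {c : ℝ} (hc1 : c ^ 2 ≤ 1) (P B : ℕ) :
    ∀ {A : Matrix d d ℂ} (_ : A.IsHermitian) {X : Fin B → Ω → Matrix d d ℂ}
      (_ : ∀ b ω, (X b ω).IsHermitian)
      (_ : ∀ b ω, (((c ^ 2 : ℝ) : ℂ) • (1 : Matrix d d ℂ) - X b ω * X b ω).PosSemidef)
      (_ : ∀ b, ∑ ω, X b ω = 0),
    ∑ ω : Fin B → Ω, truncCosh P (A + ∑ b, X b (ω b)) ≤
      (Fintype.card Ω * Real.exp (2 * c ^ 2)) ^ B * truncCosh P A := by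
  induction B with
  | zero => intro A _ X _ _ _; simp
  | succ B ih =>
    intro A hA X hX hc h0
    rw [← (Fin.consEquiv fun _ => Ω).sum_comp, Fintype.sum_prod_type]
    have h1 : ∀ ω : Ω, ∑ ω' : Fin B → Ω, truncCosh P (A + ∑ b, X b
        ((Fin.consEquiv fun _ => Ω) (ω, ω') b)) ≤
        (Fintype.card Ω * Real.exp (2 * c ^ 2)) ^ B * truncCosh P (A + X 0 ω) := by
      intro ω
      refine le_trans (le_of_eq (sum_congr rfl fun ω' _ => ?_))
        (ih (hA.add (hX 0 ω)) (X := fun b => X b.succ) (fun b => hX b.succ) (fun b => hc b.succ)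
          fun b => h0 b.succ)
      rw [Fin.sum_univ_succ, add_assoc]
      rfl
    refine (sum_le_sum fun ω _ => h1 ω).trans ?_
    rw [← mul_sum, pow_succ _ B, mul_assoc]
    gcongr
    exact sum_truncCosh_add_le hA (hX 0) hc1 (hc 0) (h0 0) P

/-- A Hermitian matrix whose quadratic form exceeds `t` somewhere on the unit sphere has an
eigenvalue of absolute value at least `t`, which shows in all its even moments. -/
theorem le_truncCosh_of_lt_abs {D : Matrix d d ℂ} (hD : D.IsHermitian) {t θ : ℝ} (ht : 0 ≤ t)
    (hθ : 0 ≤ θ) {φ : d → ℂ} (hφ : t * ∑ i, ‖φ i‖ ^ 2 < |(star φ ⬝ᵥ D *ᵥ φ).re|) (P : ℕ) :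
    ∑ p ∈ range (P + 1), (θ * t) ^ (2 * p) / (2 * p).factorial ≤
      truncCosh P (((θ : ℝ) : ℂ) • D) := by
  obtain ⟨U, a, hU1, hU2, hUk⟩ := hD.exists_diagonalization
  obtain ⟨i, hi⟩ : ∃ i, t ≤ |a i| := by
    by_contra! hcon
    set y := Uᴴ *ᵥ φ with hy
    have e1 : (star φ ⬝ᵥ D *ᵥ φ).re = ∑ i, a i * ‖y i‖ ^ 2 := by
      have h1 := hUk 1
      rw [pow_one] at h1
      have h2 : star φ ⬝ᵥ D *ᵥ φ = star y ⬝ᵥ (diagonal (fun i => ((a i ^ 1 : ℝ) : ℂ))) *ᵥ y := by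
        rw [h1, hy, star_mulVec, conjTranspose_conjTranspose, ← dotProduct_mulVec, mulVec_mulVec,
          mulVec_mulVec, mul_assoc]
      rw [h2, dotProduct, Complex.re_sum]
      refine sum_congr rfl fun i _ => ?_
      rw [mulVec_diagonal, Pi.star_apply, RCLike.star_def, mul_left_comm, ← Complex.normSq_eq_conj_mul_self,
        Complex.normSq_eq_norm_sq, ← Complex.ofReal_mul, Complex.ofReal_re, pow_one]
    have e2 : ∑ i, ‖y i‖ ^ 2 = ∑ i, ‖φ i‖ ^ 2 := by
      have h2 : star y ⬝ᵥ y = star φ ⬝ᵥ φ := by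
        rw [hy, star_mulVec, conjTranspose_conjTranspose, ← dotProduct_mulVec, mulVec_mulVec, hU1,
          one_mulVec]
      have h3 : ∀ z : d → ℂ, star z ⬝ᵥ z = ((∑ i, ‖z i‖ ^ 2 : ℝ) : ℂ) := by
        intro z
        rw [dotProduct, Complex.ofReal_sum]
        refine sum_congr rfl fun i _ => ?_
        rw [Pi.star_apply, RCLike.star_def, ← Complex.normSq_eq_conj_mul_self,
          Complex.normSq_eq_norm_sq]
      rw [h3, h3] at h2
      exact_mod_cast h2
    have h4 : |(star φ ⬝ᵥ D *ᵥ φ).re| ≤ t * ∑ i, ‖φ i‖ ^ 2 := by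
      rw [e1, ← e2, mul_sum]
      refine (abs_sum_le_sum_abs _ _).trans (sum_le_sum fun i _ => ?_)
      rw [abs_mul, abs_of_nonneg (by positivity : 0 ≤ ‖y i‖ ^ 2)]
      gcongr
      exact (hcon i).le
    linarith
  refine sum_le_sum fun p _ => ?_
  rw [evenMoment]
  gcongr
  rw [smul_pow, trace_smul, smul_eq_mul, ← Complex.ofReal_pow, Complex.re_ofReal_mul,
    trace_pow_even_eq hU2 (hUk _), mul_pow]
  gcongr
  calc t ^ (2 * p) ≤ |a i| ^ (2 * p) := by gcongr
    _ = a i ^ (2 * p) := by rw [pow_mul, pow_mul, sq_abs]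
    _ ≤ _ := single_le_sum (f := fun i => a i ^ (2 * p))
        (fun j _ => by rw [pow_mul]; positivity) (mem_univ i)

open Classical in
/-- **Matrix Hoeffding inequality**, in counting form: `X b (ω b)` are independent, each uniform
over `Ω`, of mean zero and of norm at most `c`; then the sum has norm at most `t` for all but a
small number of the outcomes `ω`. -/
theorem card_filter_matrix_sum_le {Ω : Type*} [Fintype Ω] {B : ℕ} {X : Fin B → Ω → Matrix d d ℂ}
    {c θ t : ℝ} (hc : 0 < c) (hθ : 0 < θ) (ht : 0 ≤ t) (hθc : θ * c ≤ 1)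
    (h1 : ∀ b ω, ((c : ℂ) • (1 : Matrix d d ℂ) - X b ω).PosSemidef)
    (h2 : ∀ b ω, ((c : ℂ) • (1 : Matrix d d ℂ) + X b ω).PosSemidef)
    (h0 : ∀ b, ∑ ω, X b ω = 0) :
    ((univ.filter fun ω : Fin B → Ω => ¬ ∀ φ : d → ℂ,
      |(star φ ⬝ᵥ (∑ b, X b (ω b)) *ᵥ φ).re| ≤ t * ∑ i, ‖φ i‖ ^ 2).card : ℝ) ≤
      2 * Fintype.card Ω ^ B * Fintype.card d * Real.exp (2 * B * (θ * c) ^ 2 - θ * t) := by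
  set bad := univ.filter fun ω : Fin B → Ω => ¬ ∀ φ : d → ℂ,
      |(star φ ⬝ᵥ (∑ b, X b (ω b)) *ᵥ φ).re| ≤ t * ∑ i, ‖φ i‖ ^ 2 with hbad
  have hX : ∀ b ω, (X b ω).IsHermitian := by
    intro b ω
    have h3 : ((c : ℂ) • (1 : Matrix d d ℂ)).IsHermitian := by
      rw [IsHermitian, conjTranspose_smul, conjTranspose_one, RCLike.star_def, Complex.conj_ofReal]
    have := h3.sub (h1 b ω).isHermitian
    rwa [sub_sub_cancel] at this
  -- Markov's inequality for the truncated hyperbolic cosine; then the degree tends to infinity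
  have key : ∀ P : ℕ, (bad.card : ℝ) * ∑ p ∈ range (P + 1), (θ * t) ^ (2 * p) / (2 * p).factorial ≤
      (Fintype.card Ω * Real.exp (2 * (θ * c) ^ 2)) ^ B * Fintype.card d := by
    intro P
    have h4 := sum_truncCosh_add_sum_le (d := d) (Ω := Ω) (c := θ * c)
      (by rw [sq_le_one_iff₀ (by positivity)]; exact hθc) P B isHermitian_zero
      (X := fun b ω => ((θ : ℝ) : ℂ) • X b ω)
      (fun b ω => by
        rw [IsHermitian, conjTranspose_smul, RCLike.star_def, Complex.conj_ofReal, (hX b ω).eq])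
      (fun b ω => by
        have := (posSemidef_sq_sub_mul_self hc (h1 b ω) (h2 b ω)).smul
          (a := ((θ ^ 2 : ℝ) : ℂ)) (by exact_mod_cast by positivity)
        convert this using 1
        rw [smul_sub, smul_smul, smul_mul_smul_comm]
        push_cast
        ring_nf)
      (fun b => by rw [← smul_sum, h0, smul_zero])
    have h5 : truncCosh P (0 : Matrix d d ℂ) = Fintype.card d := by
      rw [truncCosh, sum_range_succ']
      simp [evenMoment]
    rw [h5] at h4
    refine le_trans ?_ h4
    rw [← nsmul_eq_mul]
    refine (card_nsmul_le_sum bad _ _ fun ω hω => ?_).trans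
      (sum_le_sum_of_subset_of_nonneg (subset_univ _) fun ω _ _ => ?_)
    · obtain ⟨φ, hφ⟩ := not_forall.mp (mem_filter.mp hω).2
      have hD : (∑ b, X b (ω b)).IsHermitian := by
        rw [IsHermitian, conjTranspose_sum]
        exact sum_congr rfl fun b _ => (hX b _).eq
      rw [zero_add, ← smul_sum]
      exact le_truncCosh_of_lt_abs hD ht hθ.le (not_le.mp hφ) P
    · refine sum_nonneg fun p _ => evenMoment_nonneg ?_ p
      rw [zero_add, ← smul_sum, IsHermitian, conjTranspose_smul, conjTranspose_sum, RCLike.star_def,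
        Complex.conj_ofReal]
      congr 1
      exact sum_congr rfl fun b _ => (hX b _).eq
  have hlim := (Real.hasSum_cosh (θ * t)).tendsto_sum_nat.comp (Filter.tendsto_add_atTop_nat 1)
  have h6 : (bad.card : ℝ) * Real.cosh (θ * t) ≤
      (Fintype.card Ω * Real.exp (2 * (θ * c) ^ 2)) ^ B * Fintype.card d :=
    le_of_tendsto' (hlim.const_mul _) key
  have h7 : Real.exp (θ * t) / 2 ≤ Real.cosh (θ * t) := by
    rw [Real.cosh_eq]
    linarith [Real.exp_pos (-(θ * t))]
  have h8 : (bad.card : ℝ) * (Real.exp (θ * t) / 2) ≤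
      (Fintype.card Ω * Real.exp (2 * (θ * c) ^ 2)) ^ B * Fintype.card d :=
    le_trans (by gcongr) h6
  rw [Real.exp_sub]
  rw [mul_pow, ← Real.exp_nat_mul] at h8
  rw [show (2 * (B : ℝ) * (θ * c) ^ 2) = B * (2 * (θ * c) ^ 2) by ring]
  rw [mul_div_assoc', le_div_iff₀ (Real.exp_pos _)]
  linarith

end Hoeffding

/-! ### Slices of a state and local terms -/

section Slices
open Finset Matrix

variable {α ι : Type*}

/-- The restriction of a state to the qubits `T`, the other qubits being in the basis state `x`;
it does not depend on the values of `x` at the qubits `T`. -/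
noncomputable def stateSlice (T : α → ι) (ψ : (ι → Bool) → ℂ) (x : ι → Bool) : (α → Bool) → ℂ :=
  fun u => ψ (Function.extend T u x)

theorem extend_comp_self {T : α → ι} (hT : T.Injective) (x : ι → Bool) :
    Function.extend T (x ∘ T) x = x := by
  funext i
  by_cases h : ∃ a, T a = i
  · obtain ⟨a, rfl⟩ := h
    simp [hT.extend_apply]
  · simp [Function.extend_apply' _ _ _ h]

theorem extend_comp {T : α → ι} (hT : T.Injective) (u : α → Bool) (x : ι → Bool) :
    Function.extend T u x ∘ T = u := funext (hT.extend_apply _ _)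

theorem extend_extend {T : α → ι} (hT : T.Injective) (u v : α → Bool) (x : ι → Bool) :
    Function.extend T u (Function.extend T v x) = Function.extend T u x := by
  funext i
  by_cases h : ∃ a, T a = i
  · obtain ⟨a, rfl⟩ := h
    simp [hT.extend_apply]
  · simp [Function.extend_apply' _ _ _ h]

theorem extend_extend_comp {β : Type*} {e : α → ι} (he : e.Injective) {τ : β → α}
    (hτ : τ.Injective) (u : β → Bool) (k : α → Bool) (x : ι → Bool) :
    Function.extend e (Function.extend τ u k) x =
      Function.extend (e ∘ τ) u (Function.extend e k x) := by
  funext i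
  by_cases h : ∃ a, e a = i
  · obtain ⟨a, rfl⟩ := h
    rw [he.extend_apply]
    by_cases h' : ∃ b, τ b = a
    · obtain ⟨b, rfl⟩ := h'
      rw [hτ.extend_apply]
      exact ((he.comp hτ).extend_apply u _ b).symm
    · rw [Function.extend_apply' _ _ _ h', Function.extend_apply', he.extend_apply]
      rintro ⟨b, hb⟩
      exact h' ⟨b, he hb⟩
  · rw [Function.extend_apply' _ _ _ h, Function.extend_apply', Function.extend_apply' _ _ _ h]
    rintro ⟨b, hb⟩
    exact h ⟨_, hb⟩

/-- Exchanging the bits of `x` at the positions `T` with those of `u` is an involution. -/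
noncomputable def exchange {T : α → ι} (hT : T.Injective) :
    ((ι → Bool) × (α → Bool)) ≃ ((ι → Bool) × (α → Bool)) where
  toFun p := (Function.extend T p.2 p.1, p.1 ∘ T)
  invFun p := (Function.extend T p.2 p.1, p.1 ∘ T)
  left_inv p := by
    simp only [extend_extend hT, extend_comp_self hT, extend_comp hT]
  right_inv p := by
    simp only [extend_extend hT, extend_comp_self hT, extend_comp hT]

variable [Fintype α] [DecidableEq α] [Fintype ι] [DecidableEq ι]

/-- Summing over all modifications of `x` at the positions `T` counts each basis state equally
often. -/
theorem sum_sum_extend {N : Type*} [Semiring N] {T : α → ι} (hT : T.Injective)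
    (h : (ι → Bool) → N) :
    ∑ x, ∑ u : α → Bool, h (Function.extend T u x) = 2 ^ Fintype.card α * ∑ x, h x := by
  rw [← Fintype.sum_prod_type' (f := fun x (u : α → Bool) => h (Function.extend T u x))]
  have := (exchange hT).sum_comp fun p => h p.1
  refine this.trans ?_
  rw [Fintype.sum_prod_type]
  simp [mul_sum]

theorem sum_norm_stateSlice {T : α → ι} (hT : T.Injective) (ψ : (ι → Bool) → ℂ) :
    ∑ x, ∑ u, ‖stateSlice T ψ x u‖ ^ 2 = 2 ^ Fintype.card α * ∑ x, ‖ψ x‖ ^ 2 :=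
  sum_sum_extend hT fun x => ‖ψ x‖ ^ 2

/-- The quadratic form of a matrix. -/
noncomputable def quadForm {d : Type*} [Fintype d] (M : Matrix d d ℂ) (φ : d → ℂ) : ℂ :=
  star φ ⬝ᵥ M *ᵥ φ

theorem star_dotProduct_self {d : Type*} [Fintype d] (z : d → ℂ) :
    star z ⬝ᵥ z = ((∑ i, ‖z i‖ ^ 2 : ℝ) : ℂ) := by
  rw [dotProduct, Complex.ofReal_sum]
  refine sum_congr rfl fun i _ => ?_
  rw [Pi.star_apply, RCLike.star_def, ← Complex.normSq_eq_conj_mul_self,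
    Complex.normSq_eq_norm_sq]

theorem sum_stateSlice_stateSlice {β : Type*} [Fintype β] [DecidableEq β] {N : Type*} [Semiring N]
    {e : α → ι} (he : e.Injective) {τ : β → α} (hτ : τ.Injective) (q : ((β → Bool) → ℂ) → N)
    (ψ : (ι → Bool) → ℂ) :
    ∑ x, ∑ k, q (stateSlice τ (stateSlice e ψ x) k) =
      2 ^ Fintype.card α * ∑ x, q (stateSlice (e ∘ τ) ψ x) := by
  rw [← sum_sum_extend he]
  refine sum_congr rfl fun x _ => sum_congr rfl fun k _ => ?_
  congr 1
  funext u
  simp only [stateSlice]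
  rw [extend_extend_comp he hτ]

variable {r n : ℕ}

theorem localTerm_mulVec (T : Fin r ↪ Fin n) (M : Matrix (Bits r) (Bits r) ℂ) (ψ : Bits n → ℂ)
    (x : Bits n) : (localTerm T M *ᵥ ψ) x = (M *ᵥ stateSlice T ψ x) (x ∘ T) := by
  classical
  simp only [mulVec, dotProduct, localTerm, of_apply, ite_mul, zero_mul]
  rw [← sum_filter]
  refine sum_nbij' (fun y => y ∘ T) (fun u => Function.extend T u x) ?_ ?_ ?_ ?_ ?_
  · simp
  · intro u _
    simp only [mem_filter, mem_univ, true_and]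
    intro i hi
    rw [Function.extend_apply']
    rintro ⟨j, hj⟩
    exact hi j hj
  · intro y hy
    simp only [mem_filter, mem_univ, true_and] at hy
    funext i
    by_cases h : ∃ a, T a = i
    · obtain ⟨a, rfl⟩ := h
      simp [T.injective.extend_apply]
    · rw [Function.extend_apply' _ _ _ h]
      exact hy i fun j hj => h ⟨j, hj⟩
  · intro u _
    exact extend_comp T.injective u x
  · intro y hy
    simp only [mem_filter, mem_univ, true_and] at hy
    have : Function.extend T (y ∘ T) x = y := by
      funext i
      by_cases h : ∃ a, T a = i
      · obtain ⟨a, rfl⟩ := h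
        simp [T.injective.extend_apply]
      · rw [Function.extend_apply' _ _ _ h]
        exact hy i fun j hj => h ⟨j, hj⟩
    simp only [stateSlice, this]
    rfl

/-- The energy of a local term is the total energy of the slices. The factor `2 ^ r` arises because
each slice occurs for all values of `x` at the qubits `T`. -/
theorem two_pow_mul_quadForm_localTerm (T : Fin r ↪ Fin n) (M : Matrix (Bits r) (Bits r) ℂ)
    (ψ : Bits n → ℂ) :
    2 ^ r * quadForm (localTerm T M) ψ = ∑ x, quadForm M (stateSlice T ψ x) := by
  have h := sum_sum_extend T.injective fun x => star (ψ x) * (localTerm T M *ᵥ ψ) x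
  rw [Fintype.card_fin] at h
  refine h.symm.trans (sum_congr rfl fun x _ => sum_congr rfl fun u _ => ?_)
  rw [localTerm_mulVec, extend_comp T.injective]
  have : stateSlice T ψ (Function.extend T u x) = stateSlice T ψ x := by
    funext v
    simp only [stateSlice, extend_extend T.injective]
  rw [this]
  rfl

theorem two_pow_mul_energy (T : Fin r ↪ Fin n) (M : Matrix (Bits r) (Bits r) ℂ)
    (ψ : Bits n → ℂ) :
    2 ^ r * energy T M ψ = ∑ x, (quadForm M (stateSlice T ψ x)).re := by
  have h := congrArg Complex.re (two_pow_mul_quadForm_localTerm T M ψ)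
  rw [Complex.re_sum] at h
  rw [← h, show (2 : ℂ) ^ r = ((2 ^ r : ℝ) : ℂ) by push_cast; rfl, Complex.re_ofReal_mul]
  rfl

theorem localTerm_sub (T : Fin r ↪ Fin n) (M N : Matrix (Bits r) (Bits r) ℂ) :
    localTerm T (M - N) = localTerm T M - localTerm T N := by
  ext x y
  simp only [localTerm, of_apply, Matrix.sub_apply]
  split_ifs <;> simp

theorem localTerm_smul_one (T : Fin r ↪ Fin n) (c : ℂ) :
    localTerm T (c • 1) = c • (1 : Matrix (Bits n) (Bits n) ℂ) := by
  ext x y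
  simp only [localTerm, of_apply, Matrix.smul_apply, one_apply]
  by_cases hxy : x = y
  · subst hxy; simp
  · rw [if_neg hxy]
    split_ifs with h h'
    · exfalso
      refine hxy (funext fun i => ?_)
      by_cases hi : ∃ a, T a = i
      · obtain ⟨a, rfl⟩ := hi
        exact congrFun h' a
      · exact h i fun j hj => hi ⟨j, hj⟩
    · simp
    · simp

theorem posSemidef_localTerm (T : Fin r ↪ Fin n) {M : Matrix (Bits r) (Bits r) ℂ}
    (hM : M.PosSemidef) : (localTerm T M).PosSemidef := by
  refine PosSemidef.of_dotProduct_mulVec_nonneg ?_ fun ψ => ?_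
  · ext x y
    simp only [conjTranspose_apply, localTerm, of_apply]
    have : (∀ i : Fin n, (∀ j : Fin r, T j ≠ i) → y i = x i) ↔
        (∀ i : Fin n, (∀ j : Fin r, T j ≠ i) → x i = y i) :=
      forall_congr' fun i => imp_congr_right fun _ => eq_comm
    simp only [this]
    split_ifs
    · exact hM.isHermitian.apply _ _
    · simp
  · have h : 0 ≤ (2 : ℂ) ^ r * quadForm (localTerm T M) ψ := by
      rw [two_pow_mul_quadForm_localTerm]
      exact sum_nonneg fun x _ => hM.dotProduct_mulVec_nonneg _
    have h2 : (0 : ℂ) < 2 ^ r := by positivity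
    exact le_of_mul_le_mul_left (by rwa [mul_zero]) h2

theorem energy_nonneg (T : Fin r ↪ Fin n) {M : Matrix (Bits r) (Bits r) ℂ}
    (hM : M.PosSemidef) (ψ : Bits n → ℂ) : 0 ≤ energy T M ψ :=
  (Complex.le_def.mp ((posSemidef_localTerm T hM).dotProduct_mulVec_nonneg ψ)).1

theorem posSemidef_smul_one_sub_localTerm (T : Fin r ↪ Fin n) {M : Matrix (Bits r) (Bits r) ℂ}
    {C : ℝ} (hM : ((C : ℂ) • (1 : Matrix (Bits r) (Bits r) ℂ) - M).PosSemidef) :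
    ((C : ℂ) • (1 : Matrix (Bits n) (Bits n) ℂ) - localTerm T M).PosSemidef := by
  have := posSemidef_localTerm T hM
  rwa [localTerm_sub, localTerm_smul_one] at this

end Slices

/-! ### Vectors whose span detects all states of a sunflower -/

section Witness
open Finset

/-- A combination of monomials of bounded degree that vanishes at all points with distinct
coordinates has only zero coefficients: such points contain a large grid. -/
theorem eq_zero_of_sum_mul_prod_pow_eq_zero {k b : ℕ} {Y : Type*} [Fintype Y] [Nonempty Y] {β : Y → ℕ}
    (hβ : β.Injective) (hb : ∀ y, β y < b) {f : (Fin k → Y) → ℂ}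
    (h : ∀ z : Fin k → ℂ, z.Injective → ∑ y, f y * ∏ j, z j ^ β (y j) = 0) : f = 0 := by
  classical
  let E : (Fin k → Y) → (Fin k →₀ ℕ) := fun y => Finsupp.equivFunOnFinite.symm fun j => β (y j)
  have hE : E.Injective := by
    intro y y' hy
    have := Finsupp.equivFunOnFinite.symm.injective hy
    exact funext fun j => hβ (congrFun this j)
  let Q : MvPolynomial (Fin k) ℂ := ∑ y, MvPolynomial.monomial (E y) (f y)
  have hQ : Q = 0 := by
    refine MvPolynomial.eq_zero_of_eval_zero_at_prod_finset Q
      (fun j => (range b).image fun t => ((j * b + t : ℕ) : ℂ)) ?_ ?_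
    · intro j
      rw [card_image_of_injective _ (fun t t' ht => by
        have := Nat.cast_injective (R := ℂ) ht; omega), card_range]
      have hb0 : 0 < b := (Nat.zero_le _).trans_lt (hb (Classical.arbitrary Y))
      refine (MvPolynomial.degreeOf_sum_le _ _ _).trans_lt ?_
      rw [Finset.sup_lt_iff hb0]
      intro y _
      by_cases hf : f y = 0
      · simpa [hf] using hb0
      · rw [MvPolynomial.degreeOf_monomial_eq _ _ hf]
        exact hb _
    · intro z hz
      have hz' : z.Injective := by
        intro j j' hj
        obtain ⟨t, ht, htz⟩ := mem_image.mp (hz j)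
        obtain ⟨t', ht', htz'⟩ := mem_image.mp (hz j')
        rw [← htz, ← htz'] at hj
        have := Nat.cast_injective (R := ℂ) hj
        rw [mem_range] at ht ht'
        have h1 := congrArg (· / b) this
        have hb0 : 0 < b := by omega
        beta_reduce at h1
        rw [mul_comm, Nat.mul_add_div hb0, mul_comm, Nat.mul_add_div hb0, Nat.div_eq_of_lt ht,
          Nat.div_eq_of_lt ht'] at h1
        exact Fin.ext (by simpa using h1)
      rw [← h z hz', map_sum]
      refine sum_congr rfl fun y _ => ?_
      rw [MvPolynomial.eval_monomial, Finsupp.prod_fintype _ _ (fun _ => pow_zero _)]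
      rfl
  funext y
  have := congrArg (MvPolynomial.coeff (E y)) hQ
  rw [MvPolynomial.coeff_sum, sum_eq_single y] at this
  · simpa using this
  · intro y' _ hy'
    rw [MvPolynomial.coeff_monomial, if_neg fun e => hy' (hE e)]
  · simp

/-- The qubits of the standard sunflower with core positions `S` and `k` petals. -/
abbrev SunflowerQubits {r : ℕ} (S : Finset (Fin r)) (k : ℕ) : Type :=
  {p : Fin r // p ∈ S} ⊕ (Fin k × {p : Fin r // p ∉ S})

/-- The `i`-th tuple of the standard sunflower: the positions in `S` are common to all tuples, the
other ones are private. -/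
def sunflowerTuple {r : ℕ} (S : Finset (Fin r)) {k : ℕ} (i : Fin k) (p : Fin r) :
    SunflowerQubits S k :=
  if h : p ∈ S then Sum.inl ⟨p, h⟩ else Sum.inr (i, ⟨p, h⟩)

theorem sunflowerTuple_injective {r : ℕ} (S : Finset (Fin r)) {k : ℕ} (i : Fin k) :
    (sunflowerTuple S i).Injective := by
  intro p q h
  unfold sunflowerTuple at h
  split_ifs at h <;> simp_all

/-- It follows that the product of two polynomials with `2 ^ s` and `2 ^ t` coefficients has at most
`2 ^ (r - 1) + 1` coefficients. -/
theorem two_pow_add_two_pow_le {r s t : ℕ} (hs : 1 ≤ s) (ht : 1 ≤ t) (h : s + t = r) :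
    2 ^ s + 2 ^ t ≤ 2 ^ (r - 1) + 2 := by
  obtain ⟨s, rfl⟩ := Nat.exists_eq_add_of_le' hs
  obtain ⟨t, rfl⟩ := Nat.exists_eq_add_of_le' ht
  rw [← h, show s + 1 + (t + 1) - 1 = s + t + 1 by omega]
  have h1 := Nat.one_le_two_pow (n := s)
  have h2 := Nat.one_le_two_pow (n := t)
  rw [pow_succ, pow_succ, pow_succ, pow_add]
  nlinarith

/-- There are vectors `v` whose span `V` is so large that no nonzero state of the standard
sunflower is orthogonal to `V` on each of its tuples. The span of
`v` contains, for every number `z`, a product vector whose factors on `S` and on its complement have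
the powers of `z` as entries. A state orthogonal to `V` on each tuple thus gives a polynomial in
one core variable and `2 ^ r` petal variables that vanishes if the core variable equals some petal
variable; as its degree in the core variable is smaller than `2 ^ r`, it is zero. -/
theorem exists_vectors_sunflower {r R : ℕ} {S : Finset (Fin r)} (hS : S.Nonempty)
    (hS' : S ≠ univ) (hR : 2 ^ (r - 1) + 1 ≤ R) :
    ∃ v : Fin R → Bits r → ℂ, ∀ ψ : (SunflowerQubits S (2 ^ r) → Bool) → ℂ,
      (∀ i x c, star (v c) ⬝ᵥ stateSlice (sunflowerTuple S i) ψ x = 0) → ψ = 0 := by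
  classical
  have hcard : S.card + Fintype.card {p : Fin r // p ∉ S} = r := by
    have := Fintype.card_subtype_compl (fun p : Fin r => p ∈ S)
    rw [Fintype.card_fin, Fintype.card_coe] at this
    have h2 := card_le_univ S
    rw [Fintype.card_fin] at h2
    omega
  have hc1 : 1 ≤ S.card := hS.card_pos
  have hc2 : 1 ≤ Fintype.card {p : Fin r // p ∉ S} := by
    obtain ⟨p, hp⟩ := not_forall.mp fun h => hS' (eq_univ_of_forall h)
    exact Fintype.card_pos_iff.mpr ⟨⟨p, hp⟩⟩
  have hle := two_pow_add_two_pow_le hc1 hc2 hcard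
  generalize hk : 2 ^ r = k
  let eα := Fintype.equivFin ({p : Fin r // p ∈ S} → Bool)
  let eβ := Fintype.equivFin ({p : Fin r // p ∉ S} → Bool)
  let α : ({p : Fin r // p ∈ S} → Bool) → ℕ := fun w => eα w
  let β : ({p : Fin r // p ∉ S} → Bool) → ℕ := fun w => eβ w
  have hα : α.Injective := fun w w' h => eα.injective (Fin.ext h)
  have hβ : β.Injective := fun w w' h => eβ.injective (Fin.ext h)
  have hα' : ∀ w, α w < 2 ^ S.card := fun w => by
    exact (eα w).isLt.trans_eq (by rw [Fintype.card_fun, Fintype.card_bool, Fintype.card_coe])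
  have hβ' : ∀ w, β w < 2 ^ Fintype.card {p : Fin r // p ∉ S} := fun w => by
    exact (eβ w).isLt.trans_eq (by rw [Fintype.card_fun, Fintype.card_bool])
  -- `v c` is the coefficient of `z ^ c` in the product vector with the entries `z ^ deg u`
  let deg : Bits r → ℕ := fun u => α (fun p => u p) + β (fun p => u p)
  refine ⟨fun c u => if deg u = c then 1 else 0, fun ψ hψ => ?_⟩
  -- the generating function of the orthogonality relations of a slice
  have hgen : ∀ (i : Fin k) (x : SunflowerQubits S k → Bool) (z : ℂ),
      ∑ u, z ^ deg u * stateSlice (sunflowerTuple S i) ψ x u = 0 := by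
    intro i x z
    have h1 : ∀ u : Bits r, z ^ deg u = ∑ c : Fin R, if deg u = c then z ^ (c : ℕ) else 0 := by
      intro u
      have hlt : deg u < R := by
        have h1 := hα' (fun p => u p)
        have h2 := hβ' (fun p => u p)
        simp only [deg]
        omega
      rw [sum_eq_single (⟨deg u, hlt⟩ : Fin R)]
      · simp
      · intro c _ hc
        rw [if_neg fun h => hc (Fin.ext h.symm)]
      · simp
    simp only [h1, sum_mul]
    rw [sum_comm]
    refine sum_eq_zero fun c _ => ?_
    have h2 := hψ i x c
    simp only [dotProduct, Pi.star_apply, apply_ite star, star_one, star_zero] at h2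
    calc _ = z ^ (c : ℕ) * ∑ u, (if deg u = c then 1 else 0) *
          stateSlice (sunflowerTuple S i) ψ x u := by
          rw [mul_sum]
          refine sum_congr rfl fun u _ => ?_
          split_ifs <;> simp
      _ = 0 := by rw [h2, mul_zero]
  -- the polynomial attached to `ψ` vanishes where the core variable equals a petal variable
  have hvan : ∀ (z : Fin k → ℂ) (i : Fin k), ∑ x : SunflowerQubits S k → Bool,
      z i ^ α (fun p => x (Sum.inl p)) * (∏ j, z j ^ β (fun p => x (Sum.inr (j, p)))) * ψ x = 0 := by
    intro z i
    have h1 := sum_sum_extend (sunflowerTuple_injective S i) fun x : SunflowerQubits S k → Bool =>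
      z i ^ α (fun p => x (Sum.inl p)) * (∏ j, z j ^ β (fun p => x (Sum.inr (j, p)))) * ψ x
    have h2 : ∀ x : SunflowerQubits S k → Bool, ∑ u : Fin r → Bool,
        z i ^ α (fun p => Function.extend (sunflowerTuple S i) u x (Sum.inl p)) *
        (∏ j, z j ^ β (fun p => Function.extend (sunflowerTuple S i) u x (Sum.inr (j, p)))) *
        ψ (Function.extend (sunflowerTuple S i) u x) = 0 := by
      intro x
      have h3 := hgen i x (z i)
      have h4 : ∀ u : Fin r → Bool,
          z i ^ α (fun p => Function.extend (sunflowerTuple S i) u x (Sum.inl p)) *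
          (∏ j, z j ^ β (fun p => Function.extend (sunflowerTuple S i) u x (Sum.inr (j, p)))) *
          ψ (Function.extend (sunflowerTuple S i) u x) =
          (∏ j ∈ univ.erase i, z j ^ β (fun p => x (Sum.inr (j, p)))) *
          (z i ^ deg u * stateSlice (sunflowerTuple S i) ψ x u) := by
        intro u
        have e1 : (fun p : {p : Fin r // p ∈ S} =>
            Function.extend (sunflowerTuple S i) u x (Sum.inl p)) = fun p => u p.1 := by
          funext p
          have : (Sum.inl p : SunflowerQubits S k) = sunflowerTuple S i p := by
            simp [sunflowerTuple, p.2]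
          rw [this, (sunflowerTuple_injective S i).extend_apply]
        have e2 : (fun p : {p : Fin r // p ∉ S} =>
            Function.extend (sunflowerTuple S i) u x (Sum.inr (i, p))) = fun p => u p.1 := by
          funext p
          have : (Sum.inr (i, p) : SunflowerQubits S k) = sunflowerTuple S i p := by
            simp [sunflowerTuple, p.2]
          rw [this, (sunflowerTuple_injective S i).extend_apply]
        have e3 : ∀ j ∈ univ.erase i, (z j ^ β fun p : {p : Fin r // p ∉ S} =>
            Function.extend (sunflowerTuple S i) u x (Sum.inr (j, p))) =
            z j ^ β (fun p => x (Sum.inr (j, p))) := by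
          intro j hj
          congr 2
          funext p
          rw [Function.extend_apply']
          rintro ⟨q, hq⟩
          unfold sunflowerTuple at hq
          split_ifs at hq
          simp only [Sum.inr.injEq, Prod.mk.injEq] at hq
          exact (mem_erase.mp hj).1 hq.1.symm
        rw [← mul_prod_erase univ _ (mem_univ i), e1, e2, prod_congr rfl e3]
        simp only [deg, stateSlice, pow_add]
        ring
      rw [sum_congr rfl fun u _ => h4 u, ← mul_sum, h3, mul_zero]
    rw [sum_congr rfl fun x _ => h2 x, sum_const_zero] at h1
    exact (mul_eq_zero.mp h1.symm).resolve_left (by positivity)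
  let e : (SunflowerQubits S k → Bool) ≃
      ({p : Fin r // p ∈ S} → Bool) × (Fin k → {p : Fin r // p ∉ S} → Bool) :=
    (Equiv.sumArrowEquivProdArrow _ _ _).trans
      ((Equiv.refl _).prodCongr (Equiv.curry _ _ _))
  have hcore : ∀ w, (fun y => ψ (e.symm (w, y))) = 0 := by
    intro w
    refine eq_zero_of_sum_mul_prod_pow_eq_zero hβ hβ' fun z hz => ?_
    let P : Polynomial ℂ := ∑ w, Polynomial.monomial (α w)
      (∑ y : Fin k → {p : Fin r // p ∉ S} → Bool, ψ (e.symm (w, y)) * ∏ j, z j ^ β (y j))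
    have hP : P = 0 := by
      refine Polynomial.eq_zero_of_natDegree_lt_card_of_eval_eq_zero P hz ?_ ?_
      · intro i
        rw [← hvan z i, ← e.symm.sum_comp, Fintype.sum_prod_type, Polynomial.eval_finsetSum]
        refine sum_congr rfl fun w _ => ?_
        rw [Polynomial.eval_monomial, sum_mul]
        refine sum_congr rfl fun y _ => ?_
        have e1 : (fun p => e.symm (w, y) (Sum.inl p)) = w := rfl
        have e2 : ∀ j, (fun p => e.symm (w, y) (Sum.inr (j, p))) = y j := fun _ => rfl
        simp only [e1, e2]
        ring
      · rw [Fintype.card_fin, ← hk]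
        refine (Polynomial.natDegree_sum_le _ _).trans_lt ?_
        rw [Finset.fold_max_lt]
        refine ⟨by positivity, fun w _ => (Polynomial.natDegree_monomial_le _).trans_lt
          ((hα' w).trans_le (Nat.pow_le_pow_right (by norm_num) (by omega)))⟩
    have h1 := congrArg (Polynomial.coeff · (α w)) hP
    simp only [P, Polynomial.finsetSum_coeff, Polynomial.coeff_zero] at h1
    rw [sum_eq_single w] at h1
    · simpa using h1
    · intro w' _ hw'
      rw [Polynomial.coeff_monomial, if_neg fun h => hw' (hα h)]
    · simp
  funext x
  have := congrFun (hcore (e x).1) (e x).2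
  simpa using this

end Witness

/-! ### The spectral gap of a random predicate matrix -/

section Generic
open Finset Matrix

/-- A measurable set is null if some point has the property that every line through it meets the
set in a countable set. -/
theorem measure_eq_zero_of_countable_lines {E : Type*} [NormedAddCommGroup E] [NormedSpace ℝ E]
    [FiniteDimensional ℝ E] [MeasurableSpace E] [BorelSpace E] (μ : Measure E)
    [μ.IsAddHaarMeasure] {Z : Set E} (hZ : MeasurableSet Z) (v₀ : E)
    (h : ∀ u : E, {t : ℝ | v₀ + t • u ∈ Z}.Countable) : μ Z = 0 := by
  have hmeas : MeasurableSet {p : E × ℝ | v₀ + p.2 • p.1 ∉ Z} := by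
    have : Measurable fun p : E × ℝ => v₀ + p.2 • p.1 := by fun_prop
    exact this hZ.compl
  have h1 : ∀ᵐ u ∂μ, ∀ᵐ t : ℝ ∂volume, v₀ + t • u ∉ Z := by
    refine ae_of_all _ fun u => ?_
    rw [ae_iff]
    simpa using (h u).measure_zero volume
  rw [Measure.ae_ae_comm hmeas] at h1
  have h2 : ∀ᵐ t : ℝ ∂volume, t ≠ 0 := by
    simp [ae_iff]
  obtain ⟨t, ht, ht0⟩ := (h1.and h2).exists
  rw [ae_iff] at ht
  simp only [not_not] at ht
  have h3 : {u | v₀ + t • u ∈ Z} = (t • ·) ⁻¹' ((v₀ + ·) ⁻¹' Z) := rfl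
  rw [h3, Measure.addHaar_preimage_smul μ ht0, measure_preimage_add, mul_eq_zero] at ht
  refine ht.resolve_left ?_
  simp [ht0]

variable {r R k : ℕ}

/-- The matrix of the linear map that sends a state of the standard sunflower to the inner products
of its slices with the vectors `v c`. -/
noncomputable def overlapMatrix (S : Finset (Fin r)) (k : ℕ) (v : Fin R → Bits r → ℂ) :
    Matrix (Fin k × (SunflowerQubits S k → Bool) × Fin R) (SunflowerQubits S k → Bool) ℂ :=
  fun p y => ∑ u, star (v p.2.2 u) *
    (Pi.single (Function.extend (sunflowerTuple S p.1) u p.2.1) 1 : _ → ℂ) y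

theorem overlapMatrix_mulVec (S : Finset (Fin r)) (v : Fin R → Bits r → ℂ)
    (ψ : (SunflowerQubits S k → Bool) → ℂ) (i : Fin k) (x : SunflowerQubits S k → Bool)
    (c : Fin R) :
    (overlapMatrix S k v *ᵥ ψ) (i, x, c) =
      star (v c) ⬝ᵥ stateSlice (sunflowerTuple S i) ψ x := by
  simp only [mulVec, dotProduct, overlapMatrix, sum_mul, Pi.star_apply]
  rw [sum_comm]
  refine sum_congr rfl fun u _ => ?_
  simp only [mul_assoc, ← mul_sum]
  congr 1
  simp [Pi.single_apply, stateSlice]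

theorem overlapMatrix_add_smul (S : Finset (Fin r)) (v w : Fin R → Bits r → ℂ) (t : ℝ) :
    overlapMatrix S k (v + t • w) = overlapMatrix S k v + (t : ℂ) • overlapMatrix S k w := by
  ext p y
  simp only [overlapMatrix, Matrix.add_apply, Matrix.smul_apply, Pi.add_apply, Pi.smul_apply,
    star_add, add_mul, sum_add_distrib, smul_eq_mul, mul_sum]
  congr 1
  refine sum_congr rfl fun u _ => ?_
  simp [mul_assoc]

theorem continuous_overlapMatrix (S : Finset (Fin r)) :
    Continuous fun v : Fin R → Bits r → ℂ => overlapMatrix S k v := by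
  refine continuous_matrix fun p y => ?_
  unfold overlapMatrix
  fun_prop

/-- Almost every tuple of vectors has a property that amounts to the injectivity of a matrix
depending linearly on the vectors, as soon as some tuple has it. -/
theorem ae_overlapMatrix_injective {S : Finset (Fin r)} (hS : S.Nonempty)
    (hS' : S ≠ univ) (hR : 2 ^ (r - 1) + 1 ≤ R) :
    ∀ᵐ v : Fin R → Bits r → ℂ, ∀ ψ : (SunflowerQubits S (2 ^ r) → Bool) → ℂ,
      (∀ i x c, star (v c) ⬝ᵥ stateSlice (sunflowerTuple S i) ψ x = 0) → ψ = 0 := by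
  obtain ⟨v₀, hv₀⟩ := exists_vectors_sunflower hS hS' hR
  -- `Φ v` is injective if `(Φ v₀)ᴴ * Φ v` is invertible, and so it is for `v = v₀`
  let Φ := fun v : Fin R → Bits r → ℂ => overlapMatrix S (2 ^ r) v
  let F := fun v => ((Φ v₀)ᴴ * Φ v).det
  have hF0 : F v₀ ≠ 0 := by
    intro h
    obtain ⟨ψ, hψ, h⟩ := exists_mulVec_eq_zero_iff.mpr h
    rw [conjTranspose_mul_self_mulVec_eq_zero] at h
    refine hψ (hv₀ ψ fun i x c => ?_)
    rw [← overlapMatrix_mulVec]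
    exact congrFun h _
  have hcont : Continuous F :=
    (continuous_const.matrix_mul (continuous_overlapMatrix S)).matrix_det
  have : (volume : Measure (Bits r → ℂ)).IsAddHaarMeasure :=
    inferInstanceAs (Measure.pi fun _ : Bits r => (volume : Measure ℂ)).IsAddHaarMeasure
  have : (volume : Measure (Fin R → Bits r → ℂ)).IsAddHaarMeasure :=
    Measure.pi.isAddHaarMeasure (α := fun _ => Bits r → ℂ) (fun _ => volume)
  have hnull : volume {v | F v = 0} = 0 := by
    refine measure_eq_zero_of_countable_lines volume
      (isClosed_eq hcont continuous_const).measurableSet v₀ fun u => ?_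
    let P : Polynomial ℂ := det ((Polynomial.X : Polynomial ℂ) •
      ((Φ v₀)ᴴ * Φ u).map Polynomial.C + ((Φ v₀)ᴴ * Φ v₀).map Polynomial.C)
    have hP : P ≠ 0 := by
      intro h
      have := Polynomial.coeff_det_X_add_C_zero ((Φ v₀)ᴴ * Φ u) ((Φ v₀)ᴴ * Φ v₀)
      exact hF0 (this.symm.trans (by rw [show det _ = P from rfl, h, Polynomial.coeff_zero]))
    have hroots : {t : ℝ | v₀ + t • u ∈ {v | F v = 0}} ⊆
        (fun t : ℝ => (t : ℂ)) ⁻¹' {z | P.IsRoot z} := by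
      intro t ht
      simp only [Set.mem_ofPred_eq, F, Φ, overlapMatrix_add_smul] at ht
      simp only [Set.mem_preimage, Set.mem_ofPred_eq, Polynomial.IsRoot, P]
      rw [← Polynomial.coe_evalRingHom, RingHom.map_det, ← ht]
      rw [Matrix.mul_add, Matrix.mul_smul]
      change _ = ((Φ v₀)ᴴ * Φ v₀ + (t : ℂ) • ((Φ v₀)ᴴ * Φ u)).det
      generalize (Φ v₀)ᴴ * Φ v₀ = A
      generalize (Φ v₀)ᴴ * Φ u = B
      congr 1
      ext i j
      simp [add_comm, mul_comm (B i j)]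
    exact ((Polynomial.finite_setOfPred_isRoot hP).preimage
      Complex.ofReal_injective.injOn).countable.mono hroots
  rw [ae_iff]
  refine measure_mono_null (fun v hv => ?_) hnull
  simp only [Set.mem_ofPred_eq] at hv ⊢
  by_contra hF
  refine hv fun ψ hψ => ?_
  by_contra hψ0
  refine hF (exists_mulVec_eq_zero_iff.mp ⟨ψ, hψ0, ?_⟩)
  rw [← mulVec_mulVec]
  have : Φ v *ᵥ ψ = 0 := by
    funext p
    obtain ⟨i, x, c⟩ := p
    exact (overlapMatrix_mulVec S v ψ i x c).trans (hψ i x c)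
  rw [this, mulVec_zero]

/-- The matrices `M` with `0 ≤ M ≤ C` for which every state of a standard sunflower with `2 ^ r`
petals has slices of total energy at least `g` times its squared norm, whatever the core positions. -/
def gapSet (r : ℕ) (C g : ℝ) : Set (Matrix (Bits r) (Bits r) ℂ) :=
  {M | M.PosSemidef ∧ ((C : ℂ) • (1 : Matrix (Bits r) (Bits r) ℂ) - M).PosSemidef ∧
    ∀ S : Finset (Fin r), S.Nonempty → S ≠ univ →
      ∀ ψ : (SunflowerQubits S (2 ^ r) → Bool) → ℂ, g * ∑ x, ‖ψ x‖ ^ 2 ≤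
        ∑ i, ∑ x, (quadForm M (stateSlice (sunflowerTuple S i) ψ x)).re}

theorem continuous_quadForm {d : Type*} [Fintype d] (φ : d → ℂ) :
    Continuous fun M : Matrix d d ℂ => quadForm M φ := by
  unfold quadForm
  exact continuous_const.dotProduct (continuous_id.matrix_mulVec continuous_const)

theorem isClosed_posSemidef {d : Type*} [Fintype d] :
    IsClosed {M : Matrix d d ℂ | M.PosSemidef} := by
  simp only [posSemidef_iff_dotProduct_mulVec, Set.ofPred_and, Set.ofPred_forall]
  exact (isClosed_eq continuous_id.matrix_conjTranspose continuous_id).inter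
    (isClosed_iInter fun φ => isClosed_le continuous_const (continuous_quadForm φ))

theorem isClosed_gapSet (C g : ℝ) : IsClosed (gapSet r C g) := by
  simp only [gapSet, Set.ofPred_and, Set.ofPred_forall]
  refine isClosed_posSemidef.inter ((isClosed_posSemidef.preimage
    (continuous_const.sub continuous_id)).inter ?_)
  refine isClosed_iInter fun S => isClosed_iInter fun _ => isClosed_iInter fun _ =>
    isClosed_iInter fun ψ => isClosed_le continuous_const ?_
  exact continuous_finsetSum _ fun i _ => continuous_finsetSum _ fun x _ =>
    Complex.continuous_re.comp (continuous_quadForm _)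

theorem measurableSet_gapSet (C g : ℝ) : MeasurableSet (gapSet r C g) := by
  have : BorelSpace (Matrix (Bits r) (Bits r) ℂ) :=
    inferInstanceAs (BorelSpace (Bits r → Bits r → ℂ))
  exact (isClosed_gapSet C g).measurableSet

theorem gapSet_anti (C : ℝ) {g g' : ℝ} (h : g ≤ g') : gapSet r C g' ⊆ gapSet r C g := by
  rintro M ⟨h1, h2, h3⟩
  refine ⟨h1, h2, fun S hS hS' ψ => le_trans ?_ (h3 S hS hS' ψ)⟩
  gcongr

theorem posSemidef_smul_one_sub_of_norm_le {d : Type*} [Fintype d] [DecidableEq d]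
    {M : Matrix d d ℂ} (hM : M.IsHermitian) {C : ℝ}
    (h : ‖Matrix.toEuclideanCLM (n := d) (𝕜 := ℂ) M‖ ≤ C) :
    ((C : ℂ) • (1 : Matrix d d ℂ) - M).PosSemidef := by
  have hherm : ((C : ℂ) • (1 : Matrix d d ℂ) - M).IsHermitian := by
    refine IsHermitian.sub ?_ hM
    rw [IsHermitian, conjTranspose_smul, conjTranspose_one, RCLike.star_def, Complex.conj_ofReal]
  refine PosSemidef.of_dotProduct_mulVec_nonneg hherm fun φ => ?_
  have him : (star φ ⬝ᵥ ((C : ℂ) • (1 : Matrix d d ℂ) - M) *ᵥ φ).im = 0 :=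
    hherm.im_star_dotProduct_mulVec_self φ
  rw [Complex.le_def]
  refine ⟨?_, him.symm⟩
  rw [sub_mulVec, smul_mulVec, one_mulVec, dotProduct_sub, dotProduct_smul, star_dotProduct_self,
    Complex.sub_re, smul_eq_mul, Complex.re_ofReal_mul, Complex.ofReal_re, Complex.zero_re,
    sub_nonneg]
  have h1 : star φ ⬝ᵥ M *ᵥ φ = inner ℂ (WithLp.toLp 2 φ)
      (Matrix.toEuclideanCLM (n := d) (𝕜 := ℂ) M (WithLp.toLp 2 φ)) := by
    rw [EuclideanSpace.inner_eq_star_dotProduct, dotProduct_comm]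
    rfl
  have h2 : ∑ i, ‖φ i‖ ^ 2 = ‖WithLp.toLp 2 φ‖ ^ 2 := by
    rw [EuclideanSpace.norm_sq_eq]
  rw [h1, h2]
  refine (Complex.re_le_norm _).trans ((norm_inner_le_norm _ _).trans ?_)
  rw [sq, ← mul_assoc, mul_comm]
  gcongr
  exact (ContinuousLinearMap.le_opNorm _ _).trans (by gcongr)

/-- A continuous function that is positive away from zero and homogeneous of degree two is bounded
below by a multiple of the squared Euclidean norm. -/
theorem exists_pos_mul_sum_norm_sq_le {d : Type*} [Fintype d] {q : (d → ℂ) → ℝ}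
    (hq : Continuous q) (hpos : ∀ φ, φ ≠ 0 → 0 < q φ)
    (hhom : ∀ (t : ℝ) φ, q ((t : ℂ) • φ) = t ^ 2 * q φ) :
    ∃ g : ℝ, 0 < g ∧ ∀ φ, g * ∑ i, ‖φ i‖ ^ 2 ≤ q φ := by
  have hq0 : q 0 = 0 := by simpa using hhom 0 0
  rcases isEmpty_or_nonempty d with hd | hd
  · exact ⟨1, one_pos, fun φ => by simp [Subsingleton.elim φ 0, hq0]⟩
  obtain ⟨φ₀, hφ₀, hmin⟩ := (isCompact_sphere (0 : d → ℂ) 1).exists_isMinOn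
    (NormedSpace.sphere_nonempty.mpr zero_le_one) hq.continuousOn
  have hne : φ₀ ≠ 0 := by
    rintro rfl
    simp at hφ₀
  have hcard : (0 : ℝ) < Fintype.card d := by exact_mod_cast Fintype.card_pos
  refine ⟨q φ₀ / Fintype.card d, div_pos (hpos _ hne) hcard, fun φ => ?_⟩
  by_cases hφ : φ = 0
  · simp [hφ, hq0]
  have hn : 0 < ‖φ‖ := norm_pos_iff.mpr hφ
  have h1 : q φ₀ ≤ q (((‖φ‖⁻¹ : ℝ) : ℂ) • φ) := by
    refine hmin ?_
    rw [mem_sphere_zero_iff_norm, norm_smul, Complex.norm_real, norm_inv, norm_norm,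
      inv_mul_cancel₀ hn.ne']
  rw [hhom, inv_pow, ← div_eq_inv_mul, le_div_iff₀ (by positivity)] at h1
  refine le_trans ?_ h1
  rw [div_mul_eq_mul_div, div_le_iff₀ hcard, mul_assoc]
  refine mul_le_mul_of_nonneg_left ?_ (hpos _ hne).le
  calc ∑ i, ‖φ i‖ ^ 2 ≤ ∑ _i : d, ‖φ‖ ^ 2 := by
        gcongr with i
        exact norm_le_pi_norm φ i
    _ = _ := by rw [sum_const, card_univ, nsmul_eq_mul, mul_comm]

/-- If no nonzero state has all its slices orthogonal to the column space of `M`, then the total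
energy of the slices is bounded below. -/
theorem exists_gap_of_range_eq_span {M : Matrix (Bits r) (Bits r) ℂ} (hM : M.PosSemidef)
    {v : Fin R → Bits r → ℂ} (hr : LinearMap.range M.mulVecLin = Submodule.span ℂ (Set.range v))
    (S : Finset (Fin r))
    (hv : ∀ ψ : (SunflowerQubits S k → Bool) → ℂ,
      (∀ i x c, star (v c) ⬝ᵥ stateSlice (sunflowerTuple S i) ψ x = 0) → ψ = 0) :
    ∃ g : ℝ, 0 < g ∧ ∀ ψ : (SunflowerQubits S k → Bool) → ℂ, g * ∑ x, ‖ψ x‖ ^ 2 ≤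
        ∑ i, ∑ x, (quadForm M (stateSlice (sunflowerTuple S i) ψ x)).re := by
  have hnn : ∀ φ, 0 ≤ (quadForm M φ).re := fun φ =>
    (Complex.le_def.mp (hM.dotProduct_mulVec_nonneg φ)).1
  refine exists_pos_mul_sum_norm_sq_le ?_ ?_ ?_
  · refine continuous_finsetSum _ fun i _ => continuous_finsetSum _ fun x _ =>
      Complex.continuous_re.comp ?_
    unfold quadForm
    have : Continuous fun ψ : (SunflowerQubits S k → Bool) → ℂ =>
        stateSlice (sunflowerTuple S i) ψ x :=
      continuous_pi fun u => continuous_apply _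
    exact (continuous_star.comp this).dotProduct (continuous_const.matrix_mulVec this)
  · intro ψ hψ
    have h0 : 0 ≤ ∑ i, ∑ x, (quadForm M (stateSlice (sunflowerTuple S i) ψ x)).re :=
      sum_nonneg fun i _ => sum_nonneg fun x _ => hnn _
    refine lt_of_le_of_ne h0 fun h => hψ (hv ψ fun i x c => ?_)
    have h1 := (sum_eq_zero_iff_of_nonneg fun i _ => sum_nonneg fun x _ => hnn _).mp h.symm i
      (mem_univ i)
    have h2 := (sum_eq_zero_iff_of_nonneg fun x _ => hnn _).mp h1 x (mem_univ x)
    have h3 : quadForm M (stateSlice (sunflowerTuple S i) ψ x) = 0 :=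
      Complex.ext h2 (Complex.le_def.mp (hM.dotProduct_mulVec_nonneg _)).2.symm
    have h4 := (hM.dotProduct_mulVec_zero_iff _).mp h3
    obtain ⟨y, hy⟩ : v c ∈ LinearMap.range M.mulVecLin := by
      rw [hr]
      exact Submodule.subset_span ⟨c, rfl⟩
    rw [← hy, mulVecLin_apply, star_mulVec, ← dotProduct_mulVec, hM.isHermitian.eq, h4,
      dotProduct_zero]
  · intro t ψ
    simp only [mul_sum]
    refine sum_congr rfl fun i _ => sum_congr rfl fun x _ => ?_
    have : stateSlice (sunflowerTuple S i) ((t : ℂ) • ψ) x =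
        (t : ℂ) • stateSlice (sunflowerTuple S i) ψ x := rfl
    rw [this, quadForm, star_smul, mulVec_smul, smul_dotProduct, dotProduct_smul, smul_smul,
      RCLike.star_def, Complex.conj_ofReal, smul_eq_mul, ← Complex.ofReal_mul,
      Complex.re_ofReal_mul, quadForm, sq]

/-- A random predicate matrix has a spectral gap with probability arbitrarily close to `1`. -/
theorem exists_gapSet_of_isPredicateLaw (hR : 2 ^ (r - 1) + 1 ≤ R)
    {D : Measure (Matrix (Bits r) (Bits r) ℂ)} (hD : IsPredicateLaw R D) {δ : ℝ} (hδ : 0 < δ) :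
    ∃ C g : ℝ, 1 ≤ C ∧ 0 < g ∧ g ≤ 1 ∧ 1 - δ ≤ D.real (gapSet r C g) := by
  obtain ⟨π, hπ, hfst, hsnd, hae⟩ := hD.coupling
  obtain ⟨C, hC⟩ := hD.bounded
  have hDp : IsProbabilityMeasure D := by
    rw [← hfst]
    exact Measure.isProbabilityMeasure_map measurable_fst.aemeasurable
  let G : ℕ → Set (Matrix (Bits r) (Bits r) ℂ) := fun N => gapSet r (max C 1) (1 / (N + 1))
  have hGmono : Monotone G := fun N N' h => gapSet_anti _ (by gcongr)
  have hgen : ∀ᵐ v ∂(π.map Prod.snd), ∀ S : Finset (Fin r), S.Nonempty → S ≠ univ →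
      ∀ ψ : (SunflowerQubits S (2 ^ r) → Bool) → ℂ,
      (∀ i x c, star (v c) ⬝ᵥ stateSlice (sunflowerTuple S i) ψ x = 0) → ψ = 0 := by
    refine hsnd.ae_le (?_ : ∀ᵐ v ∂volume, _)
    rw [ae_all_iff]
    intro S
    by_cases hS : S.Nonempty
    · by_cases hS' : S ≠ univ
      · filter_upwards [ae_overlapMatrix_injective hS hS' hR] with v hv _ _
        exact hv
      · exact ae_of_all _ fun v _ h => absurd h hS'
    · exact ae_of_all _ fun v h => absurd h hS
  have hgen' := ae_of_ae_map measurable_snd.aemeasurable hgen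
  have hC' : ∀ᵐ p ∂π, ‖Matrix.toEuclideanCLM (n := Bits r) (𝕜 := ℂ) p.1‖ ≤ C := by
    rw [← hfst] at hC
    exact ae_of_ae_map measurable_fst.aemeasurable hC
  have hmem : ∀ᵐ p ∂π, p.1 ∈ ⋃ N, G N := by
    filter_upwards [hae, hgen', hC'] with p hp hpg hpC
    obtain ⟨hM, -, hr⟩ := hp
    have hex : ∀ S : Finset (Fin r), ∃ g : ℝ, 0 < g ∧ (S.Nonempty → S ≠ univ →
        ∀ ψ : (SunflowerQubits S (2 ^ r) → Bool) → ℂ, g * ∑ x, ‖ψ x‖ ^ 2 ≤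
        ∑ i, ∑ x, (quadForm p.1 (stateSlice (sunflowerTuple S i) ψ x)).re) := by
      intro S
      by_cases hS : S.Nonempty ∧ S ≠ univ
      · obtain ⟨g, hg, h⟩ := exists_gap_of_range_eq_span hM hr S (hpg S hS.1 hS.2)
        exact ⟨g, hg, fun _ _ => h⟩
      · exact ⟨1, one_pos, fun h1 h2 => absurd ⟨h1, h2⟩ hS⟩
    choose g hg hgap using hex
    obtain ⟨g₀, hg₀, hle⟩ : ∃ g₀ : ℝ, 0 < g₀ ∧ ∀ S, g₀ ≤ g S := by
      obtain ⟨S₀, hS₀⟩ := Finite.exists_min g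
      exact ⟨g S₀, hg S₀, hS₀⟩
    obtain ⟨N, hN⟩ := exists_nat_one_div_lt hg₀
    refine Set.mem_iUnion.mpr ⟨N, hM, posSemidef_smul_one_sub_of_norm_le hM.isHermitian
      (hpC.trans (le_max_left _ _)), fun S hS hS' ψ => le_trans ?_ (hgap S hS hS' ψ)⟩
    gcongr
    exact hN.le.trans (hle S)
  have hmeas : ∀ N, MeasurableSet (G N) := fun N => measurableSet_gapSet _ _
  have hone : D (⋃ N, G N) = 1 := by
    rw [← prob_compl_eq_zero_iff (MeasurableSet.iUnion hmeas), ← hfst,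
      Measure.map_apply measurable_fst (MeasurableSet.iUnion hmeas).compl]
    exact hmem
  have hlim := tendsto_measure_iUnion_atTop (μ := D) hGmono
  rw [hone] at hlim
  have hlim' : Filter.Tendsto (fun N => D.real (G N)) Filter.atTop (nhds 1) :=
    (ENNReal.tendsto_toReal ENNReal.one_ne_top).comp hlim
  obtain ⟨N, hN⟩ := (hlim'.eventually (lt_mem_nhds (by linarith : 1 - δ < 1))).exists
  exact ⟨max C 1, 1 / (N + 1), le_max_right _ _, Nat.one_div_pos_of_nat,
    by rw [div_le_one (by positivity)]; linarith [Nat.cast_nonneg (α := ℝ) N], hN.le⟩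

end Generic

/-! ### Sunflowers among tuples, heavy and light terms -/

section Sunflower
open Finset Matrix

/-- A symmetric relation has a clique of size `k` in `F` if fewer than `k` elements of `F` are always
related to some common element of `F`: the clique is built greedily. -/
theorem exists_pairwise_of_forall_exists {I : Type*} {F : Finset I} {rel : I → I → Prop}
    (hsymm : ∀ a b, rel a b → rel b a) (k : ℕ)
    (h : ∀ A : Finset I, A.card < k → A ⊆ F → ∃ b ∈ F, ∀ a ∈ A, rel a b) :
    ∃ c : Fin k → I, (∀ i, c i ∈ F) ∧ ∀ i j, i ≠ j → rel (c i) (c j) := by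
  classical
  suffices H : ∀ l ≤ k, ∃ c : Fin l → I, (∀ i, c i ∈ F) ∧ ∀ i j, i ≠ j → rel (c i) (c j) from
    H k le_rfl
  intro l
  induction l with
  | zero => exact fun _ => ⟨Fin.elim0, fun i => i.elim0, fun i => i.elim0⟩
  | succ l ih =>
    intro hl
    obtain ⟨c, hcF, hc⟩ := ih (by omega)
    obtain ⟨b, hb, hrel⟩ := h (univ.image c)
      (lt_of_le_of_lt card_image_le (by rw [card_univ, Fintype.card_fin]; omega))
      (by intro x hx; obtain ⟨i, -, rfl⟩ := mem_image.mp hx; exact hcF i)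
    have hrel' : ∀ i, rel (c i) b := fun i => hrel _ (mem_image_of_mem _ (mem_univ i))
    refine ⟨Fin.cons b c, fun i => ?_, fun i j hij => ?_⟩
    · refine Fin.cases ?_ (fun i => ?_) i
      · exact hb
      · exact hcF i
    · revert hij
      refine Fin.cases ?_ (fun i => ?_) i <;> refine Fin.cases ?_ (fun j => ?_) j
      · exact fun h => absurd rfl h
      · exact fun _ => hsymm _ _ (hrel' j)
      · exact fun _ => hrel' i
      · intro hij
        exact hc i j fun e => hij (by rw [e])

/-- The number of tuples that forces a sunflower with `k` petals among tuples of arity `r` that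
agree in all but `j` positions. -/
def sunflowerBound (r k : ℕ) : ℕ → ℕ
  | 0 => 2
  | j + 1 => k * (r * r * sunflowerBound r k j) + 1

/-- Sunflower lemma for tuples: many tuples that agree at the positions in `S` contain `k` tuples
that agree exactly at the positions in some larger set `S'`, and are otherwise disjoint. -/
theorem exists_sunflower {I V : Type*} {r k : ℕ} {T : I → Fin r ↪ V} (hT : T.Injective) (j : ℕ) :
    ∀ (S : Finset (Fin r)) (F : Finset I), S.card + j = r →
      (∀ a ∈ F, ∀ b ∈ F, ∀ p ∈ S, T a p = T b p) → sunflowerBound r k j ≤ F.card →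
      ∃ S' : Finset (Fin r), S ⊆ S' ∧ S' ≠ univ ∧ ∃ c : Fin k → I, (∀ i, c i ∈ F) ∧
        (∀ i i', ∀ p ∈ S', T (c i) p = T (c i') p) ∧
        ∀ i i', i ≠ i' → ∀ p ∉ S', ∀ q, T (c i) p ≠ T (c i') q := by
  classical
  induction j with
  | zero =>
    intro S F hS hF hcard
    have hS' : S = univ := by
      rw [← card_eq_iff_eq_univ, Fintype.card_fin]
      exact hS
    obtain ⟨a, ha, b, hb, hab⟩ := one_lt_card.mp (lt_of_lt_of_le one_lt_two hcard)
    exact absurd (hT (DFunLike.ext _ _ fun p => hF a ha b hb p (hS' ▸ mem_univ p))) hab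
  | succ j ih =>
    intro S F hS hF hcard
    by_cases hA : ∃ p ∉ S, ∃ u, sunflowerBound r k j ≤ (F.filter fun a => T a p = u).card
    · obtain ⟨p, hp, u, hu⟩ := hA
      obtain ⟨S', hSS', hS', c, hcF, hc1, hc2⟩ := ih (insert p S) (F.filter fun a => T a p = u)
        (by rw [card_insert_of_notMem hp]; omega)
        (by
          intro a ha b hb q hq
          rw [mem_filter] at ha hb
          rcases mem_insert.mp hq with rfl | hq
          · rw [ha.2, hb.2]
          · exact hF a ha.1 b hb.1 q hq) hu
      exact ⟨S', (subset_insert _ _).trans hSS', hS', c, fun i => (mem_filter.mp (hcF i)).1,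
        hc1, hc2⟩
    · push Not at hA
      have hSu : S ≠ univ := by
        rintro rfl
        rw [card_univ, Fintype.card_fin] at hS
        omega
      obtain ⟨c, hcF, hc⟩ := exists_pairwise_of_forall_exists (F := F)
        (rel := fun a b => ∀ p ∉ S, ∀ q ∉ S, T a p ≠ T b q)
        (fun a b h p hp q hq e => h q hq p hp e.symm) k (by
          intro A hA' hAF
          by_contra! hcon
          -- every tuple meets the petal of some tuple in `A`
          have hsub : F ⊆ A.biUnion fun a => univ.biUnion fun p : Fin r =>
              univ.biUnion fun q : Fin r => if q ∈ S then ∅ else F.filter fun b => T b q = T a p := by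
            intro b hb
            obtain ⟨a, ha, p, hp, q, hq, e⟩ := hcon b hb
            simp only [mem_biUnion, mem_univ, true_and]
            refine ⟨a, ha, p, q, ?_⟩
            rw [if_neg hq, mem_filter]
            exact ⟨hb, e.symm⟩
          have h1 : F.card ≤ A.card * (r * r * sunflowerBound r k j) := by
            refine (card_le_card hsub).trans (card_biUnion_le_card_mul _ _ _ fun a _ => ?_)
            refine (card_biUnion_le_card_mul _ _ (r * sunflowerBound r k j) fun p _ =>
              card_biUnion_le_card_mul _ _ (sunflowerBound r k j) (fun q _ => ?_) |>.trans ?_).trans ?_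
            · split_ifs with hq
              · simp
              · exact (hA q hq _).le
            · rw [card_univ, Fintype.card_fin]
            · rw [card_univ, Fintype.card_fin, mul_assoc]
          have h2 : A.card * (r * r * sunflowerBound r k j) ≤
              k * (r * r * sunflowerBound r k j) := Nat.mul_le_mul_right _ hA'.le
          simp only [sunflowerBound] at hcard
          omega)
      refine ⟨S, Subset.rfl, hSu, c, hcF, fun i i' p hp => hF _ (hcF i) _ (hcF i') p hp,
        fun i i' hii p hp q e => ?_⟩
      by_cases hq : q ∈ S
      · rw [hF _ (hcF i') _ (hcF i) q hq] at e
        exact hp ((T (c i)).injective e ▸ hq)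
      · exact hc i i' hii p hp q hq e

variable {r n : ℕ} {I : Type*}

/-- The gap of the standard sunflower carries over to every sunflower in a system of qubits. -/
theorem le_sum_energy_of_sunflower {C g : ℝ} {M : Matrix (Bits r) (Bits r) ℂ}
    (hM : M ∈ gapSet r C g) {S : Finset (Fin r)} (hS : S.Nonempty) (hS' : S ≠ univ)
    {T : Fin (2 ^ r) → Fin r ↪ Fin n} (h1 : ∀ i i', ∀ p ∈ S, T i p = T i' p)
    (h2 : ∀ i i', i ≠ i' → ∀ p ∉ S, ∀ q, T i p ≠ T i' q) (ψ : Bits n → ℂ) :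
    g / 2 ^ r * ∑ x, ‖ψ x‖ ^ 2 ≤ ∑ i, energy (T i) M ψ := by
  let i₀ : Fin (2 ^ r) := ⟨0, by positivity⟩
  let e : SunflowerQubits S (2 ^ r) → Fin n :=
    Sum.elim (fun p => T i₀ p) fun p => T p.1 p.2
  have he : e.Injective := by
    rintro (p | ⟨i, p⟩) (q | ⟨i', q⟩) h
    · simp only [e, Sum.elim_inl] at h
      rw [Subtype.ext ((T i₀).injective h)]
    · simp only [e, Sum.elim_inl, Sum.elim_inr] at h
      rw [h1 i₀ i' p p.2] at h
      exact absurd ((T i').injective h ▸ p.2) q.2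
    · simp only [e, Sum.elim_inl, Sum.elim_inr] at h
      rw [h1 i₀ i q q.2] at h
      exact absurd ((T i).injective h ▸ q.2) p.2
    · simp only [e, Sum.elim_inr] at h
      by_cases hi : i = i'
      · subst hi
        rw [Subtype.ext ((T i).injective h)]
      · exact absurd h (h2 i i' hi p p.2 q)
  have heT : ∀ i, e ∘ sunflowerTuple S i = T i := by
    intro i
    funext p
    by_cases hp : p ∈ S
    · simp only [Function.comp_apply, sunflowerTuple, hp, dif_pos, e, Sum.elim_inl]
      exact h1 i₀ i p hp
    · simp only [Function.comp_apply, sunflowerTuple, hp, dif_neg, not_false_iff, e, Sum.elim_inr]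
  set K : ℝ := 2 ^ Fintype.card (SunflowerQubits S (2 ^ r)) with hK
  have hK0 : 0 < K := by positivity
  have h3 : K * (2 ^ r * ∑ i, energy (T i) M ψ) = ∑ x, ∑ i, ∑ k, (quadForm M
      (stateSlice (sunflowerTuple S i) (stateSlice e ψ x) k)).re := by
    rw [sum_comm, mul_sum, mul_sum]
    refine sum_congr rfl fun i _ => ?_
    rw [two_pow_mul_energy, ← heT, sum_stateSlice_stateSlice he (sunflowerTuple_injective S i)
      fun φ => (quadForm M φ).re]
  have h4 : K * (g * ∑ x, ‖ψ x‖ ^ 2) ≤ K * (2 ^ r * ∑ i, energy (T i) M ψ) := by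
    rw [h3, mul_left_comm, hK, ← sum_norm_stateSlice he, mul_sum]
    exact sum_le_sum fun x _ => hM.2.2 S hS hS' _
  have h5 := le_of_mul_le_mul_left h4 hK0
  rw [div_mul_eq_mul_div, div_le_iff₀ (by positivity)]
  linarith

/-- The number of tuples through a qubit above which their energy is bounded below. -/
def heavyBound (r : ℕ) : ℕ := r * sunflowerBound r (2 ^ r) (r - 1) + 1

/-- Sufficiently many tuples through a qubit `v` contain a sunflower: some position holds `v` for many of
them, which makes the core of the sunflower nonempty. -/
theorem le_sum_energy_of_heavyBound_le {C g : ℝ} {M : Matrix (Bits r) (Bits r) ℂ}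
    (hM : M ∈ gapSet r C g) {T : I → Fin r ↪ Fin n} (hT : T.Injective) {v : Fin n}
    {F : Finset I} (hF : ∀ i ∈ F, ∃ p, T i p = v) (hcard : heavyBound r ≤ F.card)
    (ψ : Bits n → ℂ) : g / 2 ^ r * ∑ x, ‖ψ x‖ ^ 2 ≤ ∑ i ∈ F, energy (T i) M ψ := by
  classical
  obtain ⟨i₁, hi₁⟩ := card_pos.mp ((Nat.succ_pos _).trans_le hcard)
  have : Nonempty (Fin r) := ⟨(hF i₁ hi₁).choose⟩
  choose! pos hpos using hF
  obtain ⟨p, -, hp⟩ := exists_lt_card_fiber_of_mul_lt_card_of_maps_to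
    (s := F) (t := univ) (f := pos) (n := sunflowerBound r (2 ^ r) (r - 1)) (fun _ _ => mem_univ _)
    (by rw [card_univ, Fintype.card_fin]; exact hcard)
  have hr : 1 ≤ r := by have := p.isLt; omega
  obtain ⟨S, hpS, hS', c, hcF, hc1, hc2⟩ := exists_sunflower (k := 2 ^ r) hT (r - 1) {p}
    (F.filter fun i => pos i = p) (by rw [card_singleton]; omega)
    (by
      intro a ha b hb q hq
      rw [mem_singleton] at hq
      rw [mem_filter] at ha hb
      have h1 := hpos a ha.1
      have h2 := hpos b hb.1
      rw [ha.2] at h1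
      rw [hb.2] at h2
      rw [hq, h1, h2]) hp.le
  have hS : S.Nonempty := ⟨p, hpS (mem_singleton_self p)⟩
  refine (le_sum_energy_of_sunflower hM hS hS' (T := fun i => T (c i)) hc1 hc2 ψ).trans ?_
  have hcinj : c.Injective := by
    intro i i' h
    by_contra hne
    obtain ⟨q, hq⟩ := not_forall.mp fun h => hS' (eq_univ_of_forall h)
    exact hc2 i i' hne q hq q (by rw [h])
  rw [← sum_image (f := fun i => energy (T i) M ψ) (fun i _ i' _ h => hcinj h)]
  refine sum_le_sum_of_subset_of_nonneg ?_ fun i _ _ => energy_nonneg _ hM.1 _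
  intro x hx
  obtain ⟨i, -, rfl⟩ := mem_image.mp hx
  exact (mem_filter.mp (hcF i)).1

/-- The tuples through a qubit are split into groups of size `heavyBound r`, each of which contains
a sunflower. -/
theorem card_div_mul_le_sum_energy {C g : ℝ} {M : Matrix (Bits r) (Bits r) ℂ}
    (hM : M ∈ gapSet r C g) {T : I → Fin r ↪ Fin n} (hT : T.Injective) {v : Fin n}
    (ψ : Bits n → ℂ) (t : ℕ) : ∀ {F : Finset I} (_ : ∀ i ∈ F, ∃ p, T i p = v)
    (_ : t * heavyBound r ≤ F.card),
    t * (g / 2 ^ r * ∑ x, ‖ψ x‖ ^ 2) ≤ ∑ i ∈ F, energy (T i) M ψ := by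
  classical
  induction t with
  | zero =>
    intro F _ _
    simpa using sum_nonneg fun i _ => energy_nonneg _ hM.1 _
  | succ t ih =>
    intro F hF hcard
    rw [add_mul, one_mul] at hcard
    obtain ⟨A, hAF, hA⟩ := exists_subset_card_eq (le_trans (Nat.le_add_left _ _) hcard)
    have h1 := le_sum_energy_of_heavyBound_le hM hT (fun i hi => hF i (hAF hi)) hA.ge ψ
    have h2 := ih (F := F \ A) (fun i hi => hF i (mem_sdiff.mp hi).1)
      (by rw [card_sdiff_of_subset hAF]; omega)
    rw [← sum_sdiff hAF]
    push_cast
    linarith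

/-- The number of tuples through the qubit `v`. -/
def degree {m : ℕ} (T : Fin m ↪ (Fin r ↪ Fin n)) (v : Fin n) : ℕ :=
  (univ.filter fun i => ∃ p, T i p = v).card

/-- A term is heavy if one of its qubits has large degree. -/
def IsHeavy {m : ℕ} (T : Fin m ↪ (Fin r ↪ Fin n)) (i : Fin m) : Prop :=
  ∃ p, heavyBound r ≤ degree T (T i p)

open Classical in
/-- The heavy terms have total energy at least proportional to their number. -/
theorem card_heavy_mul_le_sum_energy {C g : ℝ} (hg : 0 < g)
    {M : Matrix (Bits r) (Bits r) ℂ} (hM : M ∈ gapSet r C g) {m : ℕ}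
    (T : Fin m ↪ (Fin r ↪ Fin n)) (ψ : Bits n → ℂ) :
    (univ.filter (IsHeavy T)).card * (g / (2 ^ r * (2 * heavyBound r)) * ∑ x, ‖ψ x‖ ^ 2) ≤
      r * ∑ i ∈ univ.filter (IsHeavy T), energy (T i) M ψ := by
  set N := ∑ x, ‖ψ x‖ ^ 2 with hN
  have hN0 : 0 ≤ N := sum_nonneg fun _ _ => by positivity
  set lam := g / (2 ^ r * (2 * heavyBound r)) * N with hlam
  have hK : (0 : ℝ) < heavyBound r := by unfold heavyBound; positivity
  have hlam0 : 0 ≤ lam := by positivity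
  have hE : ∀ i, 0 ≤ energy (T i) M ψ := fun i => energy_nonneg _ hM.1 _
  have hv : ∀ v, heavyBound r ≤ degree T v → degree T v * lam ≤
      ∑ i ∈ univ.filter (fun i => ∃ p, T i p = v), energy (T i) M ψ := by
    intro v hv
    have h1 := card_div_mul_le_sum_energy hM T.injective ψ (degree T v / heavyBound r)
      (F := univ.filter fun i => ∃ p, T i p = v) (fun i hi => (mem_filter.mp hi).2)
      (Nat.div_mul_le_self _ _)
    refine le_trans ?_ h1
    have hpos : 0 < heavyBound r := by unfold heavyBound; positivity
    have h2 : degree T v ≤ 2 * (degree T v / heavyBound r) * heavyBound r := by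
      have h3 := Nat.div_add_mod (degree T v) (heavyBound r)
      have h4 := Nat.mod_lt (degree T v) hpos
      have h5 : 1 ≤ degree T v / heavyBound r := (Nat.one_le_div_iff hpos).mpr hv
      nlinarith
    have h2' : (degree T v : ℝ) ≤ 2 * (degree T v / heavyBound r : ℕ) * heavyBound r := by
      exact_mod_cast h2
    calc (degree T v : ℝ) * lam ≤
          (2 * (degree T v / heavyBound r : ℕ) * heavyBound r) * lam := by gcongr
      _ = _ := by rw [hlam, ← hN]; field_simp
  -- double counting of pairs of a term and one of its qubits of large degree
  have hcount : ∀ f : Fin m → ℝ, ∑ v ∈ univ.filter (fun v => heavyBound r ≤ degree T v),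
      ∑ i ∈ univ.filter (fun i => ∃ p, T i p = v), f i =
      ∑ i ∈ univ.filter (IsHeavy T),
        ((univ.filter fun p => heavyBound r ≤ degree T (T i p)).card : ℝ) * f i := by
    intro f
    have h1 : ∀ v, ∑ i ∈ univ.filter (fun i => ∃ p, T i p = v), f i =
        ∑ i, ∑ p, if T i p = v then f i else 0 := by
      intro v
      rw [sum_filter]
      refine sum_congr rfl fun i _ => ?_
      split_ifs with h
      · obtain ⟨p, rfl⟩ := h
        rw [sum_eq_single p]
        · simp
        · intro q _ hq
          rw [if_neg fun e => hq ((T i).injective e)]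
        · simp
      · push Not at h
        simp [h]
    simp only [h1]
    rw [sum_comm, sum_filter]
    refine sum_congr rfl fun i _ => ?_
    rw [sum_comm]
    have h2 : ∀ p, ∑ v ∈ univ.filter (fun v => heavyBound r ≤ degree T v),
        (if T i p = v then f i else 0) = if heavyBound r ≤ degree T (T i p) then f i else 0 := by
      intro p
      rw [sum_ite_eq]
      simp
    rw [sum_congr rfl fun p _ => h2 p, ← sum_filter, sum_const, nsmul_eq_mul]
    split_ifs with h
    · rfl
    · have : (univ.filter fun p => heavyBound r ≤ degree T (T i p)) = ∅ := by
        rw [filter_eq_empty_iff]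
        intro p _ hp
        exact h ⟨p, hp⟩
      rw [this, card_empty, Nat.cast_zero, zero_mul]
  have hdeg : ∀ v, (degree T v : ℝ) * lam =
      ∑ i ∈ univ.filter (fun i => ∃ p, T i p = v), lam := by
    intro v
    rw [sum_const, nsmul_eq_mul]
    rfl
  calc _ = ∑ i ∈ univ.filter (IsHeavy T), 1 * lam := by
        rw [sum_const, nsmul_eq_mul, one_mul]
    _ ≤ ∑ i ∈ univ.filter (IsHeavy T),
        ((univ.filter fun p => heavyBound r ≤ degree T (T i p)).card : ℝ) * lam := by
        refine sum_le_sum fun i hi => mul_le_mul_of_nonneg_right ?_ hlam0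
        obtain ⟨p, hp⟩ := (mem_filter.mp hi).2
        exact_mod_cast card_pos.mpr ⟨p, mem_filter.mpr ⟨mem_univ _, hp⟩⟩
    _ = ∑ v ∈ univ.filter (fun v => heavyBound r ≤ degree T v), (degree T v : ℝ) * lam := by
        rw [sum_congr rfl fun v _ => hdeg v, hcount]
    _ ≤ ∑ v ∈ univ.filter (fun v => heavyBound r ≤ degree T v),
        ∑ i ∈ univ.filter (fun i => ∃ p, T i p = v), energy (T i) M ψ :=
        sum_le_sum fun v hv' => hv v (mem_filter.mp hv').2
    _ = ∑ i ∈ univ.filter (IsHeavy T),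
        ((univ.filter fun p => heavyBound r ≤ degree T (T i p)).card : ℝ) * energy (T i) M ψ :=
        hcount _
    _ ≤ ∑ i ∈ univ.filter (IsHeavy T), r * energy (T i) M ψ := by
        refine sum_le_sum fun i _ => mul_le_mul_of_nonneg_right ?_ (hE i)
        have := card_le_univ (univ.filter fun p => heavyBound r ≤ degree T (T i p))
        rw [Fintype.card_fin] at this
        exact_mod_cast this
    _ = _ := by rw [mul_sum]

open Classical in
/-- Each light term is one of the few terms through its first qubit. -/
theorem card_not_heavy_le (hr : 1 ≤ r) {m : ℕ} (T : Fin m ↪ (Fin r ↪ Fin n)) :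
    (univ.filter fun i => ¬ IsHeavy T i).card ≤ heavyBound r * n := by
  let p₀ : Fin r := ⟨0, hr⟩
  have h := card_le_mul_card_image_of_maps_to (s := univ.filter fun i => ¬ IsHeavy T i)
    (t := univ) (f := fun i => T i p₀) (fun _ _ => mem_univ _) (heavyBound r) (by
      intro v _
      by_cases hv : heavyBound r ≤ degree T v
      · refine le_of_eq_of_le ?_ (Nat.zero_le _)
        rw [card_eq_zero, filter_eq_empty_iff]
        intro i hi e
        exact (mem_filter.mp hi).2 ⟨p₀, e ▸ hv⟩
      · refine le_trans (card_le_card ?_) (not_le.mp hv).le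
        intro i hi
        exact mem_filter.mpr ⟨mem_univ _, p₀, (mem_filter.mp hi).2⟩)
  rwa [card_univ, Fintype.card_fin] at h

end Sunflower

/-! ### Execution of programs -/

section Programs

variable {tape : ℕ → Bool}

/-- The program `p` turns the memory `s` into `s'` within `B` steps, whatever remains to be executed
afterwards. -/
def Exec (tape : ℕ → Bool) (p : Prog) (s : Store) (B : ℕ) (s' : Store) : Prop :=
  ∃ t ≤ B, ∀ k, (step tape)^[t] (p :: k, s) = (k, s')

theorem Exec.mono {p : Prog} {s s' : Store} {B B' : ℕ} (h : Exec tape p s B s') (hB : B ≤ B') :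
    Exec tape p s B' s' := by
  obtain ⟨t, ht, h⟩ := h
  exact ⟨t, ht.trans hB, h⟩

theorem Exec.runFor_eq {p : Prog} {s s' : Store} {B : ℕ} (h : Exec tape p s B s') :
    runFor p tape B s = ([], s') := by
  obtain ⟨t, ht, h⟩ := h
  obtain ⟨u, rfl⟩ := Nat.exists_eq_add_of_le ht
  rw [runFor, add_comm, Function.iterate_add_apply, h]
  induction u with
  | zero => rfl
  | succ u ih =>
    rw [Function.iterate_succ_apply]
    exact ih (by omega)

theorem Exec.of_step {p : Prog} {s s' : Store}
    (h : ∀ k, step tape (p :: k, s) = (k, s')) : Exec tape p s 1 s' := ⟨1, le_rfl, h⟩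

theorem Exec.seq {p q : Prog} {s s₁ s' : Store} {B₁ B₂ : ℕ} (h₁ : Exec tape p s B₁ s₁)
    (h₂ : Exec tape q s₁ B₂ s') : Exec tape (.seq p q) s (B₁ + B₂ + 1) s' := by
  obtain ⟨t₁, ht₁, h₁⟩ := h₁
  obtain ⟨t₂, ht₂, h₂⟩ := h₂
  refine ⟨t₂ + t₁ + 1, by omega, fun k => ?_⟩
  rw [Function.iterate_succ_apply, Function.iterate_add_apply]
  change (step tape)^[t₂] ((step tape)^[t₁] (p :: q :: k, s)) = _
  rw [h₁, h₂]

theorem Exec.cond_pos {x y : ℕ} {p q : Prog} {s s' : Store} {B : ℕ} (hxy : s.var x < s.var y)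
    (h : Exec tape p s B s') : Exec tape (.cond x y p q) s (B + 1) s' := by
  obtain ⟨t, ht, h⟩ := h
  refine ⟨t + 1, by omega, fun k => ?_⟩
  rw [Function.iterate_succ_apply]
  simp only [step, if_pos hxy, h]

theorem Exec.cond_neg {x y : ℕ} {p q : Prog} {s s' : Store} {B : ℕ} (hxy : ¬ s.var x < s.var y)
    (h : Exec tape q s B s') : Exec tape (.cond x y p q) s (B + 1) s' := by
  obtain ⟨t, ht, h⟩ := h
  refine ⟨t + 1, by omega, fun k => ?_⟩
  rw [Function.iterate_succ_apply]
  simp only [step, if_neg hxy, h]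

/-- A loop runs through the memories `σ 0, …, σ N`. -/
theorem Exec.loop {x y : ℕ} {p : Prog} {B : ℕ} (σ : ℕ → Store) (N : ℕ)
    (hlt : ∀ i < N, (σ i).var x < (σ i).var y) (hN : ¬ (σ N).var x < (σ N).var y)
    (hbody : ∀ i < N, Exec tape p (σ i) B (σ (i + 1))) :
    Exec tape (.loop x y p) (σ 0) (N * (B + 1) + 1) (σ N) := by
  induction N generalizing σ with
  | zero =>
    refine ⟨1, by omega, fun k => ?_⟩
    simp only [Function.iterate_one, step, if_neg hN]
  | succ N ih =>
    obtain ⟨t₂, ht₂, h₂⟩ := ih (fun i => σ (i + 1)) (fun i hi => hlt _ (by omega)) hN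
      fun i hi => hbody _ (by omega)
    obtain ⟨t₁, ht₁, h₁⟩ := hbody 0 (by omega)
    refine ⟨t₂ + t₁ + 1, ?_, fun k => ?_⟩
    · calc t₂ + t₁ + 1 ≤ (N * (B + 1) + 1) + B + 1 := by omega
        _ = _ := by ring
    · rw [Function.iterate_succ_apply, Function.iterate_add_apply]
      simp only [step, if_pos (hlt 0 (by omega)), h₁]
      exact h₂ k

/-- A memory whose first variables hold the entries of the list `L`, the others being `0`. -/
def mem (L : List ℕ) (A : ℕ → ℕ → ℕ) (c : ℕ) : Store := ⟨fun x => L.getD x 0, A, c⟩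

variable {L : List ℕ} {A : ℕ → ℕ → ℕ} {c : ℕ}

theorem mem_setVar {x v : ℕ} (hx : Nat.blt x L.length = true) :
    (mem L A c).setVar x v = mem (L.set x v) A c := by
  have hx' : x < L.length := by simpa [Nat.blt_eq] using hx
  unfold mem Store.setVar
  congr 1
  funext y
  simp only [List.getD_eq_getElem?_getD, List.getElem?_set, Function.update_apply]
  by_cases hxy : y = x
  · subst hxy
    simp [hx']
  · rw [if_neg hxy, if_neg (Ne.symm hxy)]

theorem exec_const {x v : ℕ} (hx : Nat.blt x L.length = true) :
    Exec tape (.const x v) (mem L A c) 1 (mem (L.set x v) A c) :=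
  .of_step fun k => by rw [← mem_setVar hx]; rfl

theorem exec_add {x y z : ℕ} (hx : Nat.blt x L.length = true) :
    Exec tape (.add x y z) (mem L A c) 1 (mem (L.set x (L.getD y 0 + L.getD z 0)) A c) :=
  .of_step fun k => by rw [← mem_setVar hx]; rfl

theorem exec_load {x a y : ℕ} (hx : Nat.blt x L.length = true) :
    Exec tape (.load x a y) (mem L A c) 1 (mem (L.set x (A a (L.getD y 0))) A c) :=
  .of_step fun k => by rw [← mem_setVar hx]; rfl

theorem exec_store {a x y : ℕ} :
    Exec tape (.store a x y) (mem L A c) 1 (mem L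
      (Function.update A a (Function.update (A a) (L.getD x 0) (L.getD y 0))) c) :=
  .of_step fun _ => rfl

theorem exec_flip {x : ℕ} (hx : Nat.blt x L.length = true) :
    Exec tape (.flip x) (mem L A c) 1 (mem (L.set x (tape c).toNat) A (c + 1)) :=
  .of_step fun k => by
    have := mem_setVar (A := A) (c := c) (v := (tape c).toNat) hx
    simp only [step]
    rw [show (mem L A c).coins = c from rfl, this]
    rfl

/-- `p` executed for each argument below the bound in turn. -/
def unroll (p : ℕ → Prog) : ℕ → Prog
  | 0 => .const 9 0
  | j + 1 => .seq (unroll p j) (p j)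

theorem exec_unroll {p : ℕ → Prog} {B : ℕ} (σ : ℕ → Store) (r : ℕ)
    (h0 : Exec tape (.const 9 0) (σ 0) 1 (σ 0))
    (hbody : ∀ j < r, Exec tape (p j) (σ j) B (σ (j + 1))) :
    Exec tape (unroll p r) (σ 0) (r * (B + 1) + 1) (σ r) := by
  induction r with
  | zero => exact h0.mono (by omega)
  | succ r ih =>
    refine ((ih fun j hj => hbody j (by omega)).seq (hbody r (by omega))).mono ?_
    rw [add_mul]
    omega

end Programs

/-! ### Arithmetic and counting by programs -/

section Programs
open Finset
variable {tape : ℕ → Bool} {L : List ℕ} {A : ℕ → ℕ → ℕ} {c : ℕ}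

theorem Exec.congr {p : Prog} {s s₁ : Store} {B B' : ℕ} {L' : List ℕ} {A' : ℕ → ℕ → ℕ} {c' : ℕ}
    (h : Exec tape p s B s₁) (hs : s₁ = mem L' A' c') (hB : B ≤ B') :
    Exec tape p s B' (mem L' A' c') := hs ▸ h.mono hB

theorem mem_congr {L' : List ℕ} {A' : ℕ → ℕ → ℕ} {c' : ℕ} (hL : L = L') (hA : A = A')
    (hc : c = c') : mem L A c = mem L' A' c' := by rw [hL, hA, hc]

theorem Exec.loop_of {x y : ℕ} {p : Prog} {B B' : ℕ} {s s' : Store} (σ : ℕ → Store) (N : ℕ)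
    (h0 : s = σ 0) (h1 : σ N = s') (hB : N * (B + 1) + 1 ≤ B')
    (hlt : ∀ i < N, (σ i).var x < (σ i).var y) (hN : ¬ (σ N).var x < (σ N).var y)
    (hbody : ∀ i < N, Exec tape p (σ i) B (σ (i + 1))) :
    Exec tape (.loop x y p) s B' s' := by
  subst h0 h1
  exact (Exec.loop σ N hlt hN hbody).mono hB

/-!
The variables `0, …, 3` hold the input `n, m, p, q` throughout. Variable `4` holds the constant `1`,
variable `5` the number `k`, variable `13` the block size `2 ^ J`, variable `14` the exponent `J`, and
variable `16` the constant `0`. The other variables are auxiliary, and each part of the program resets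
to `0` those that it uses. The instruction `.const 9 0` serves as the empty program where variable `9`
is not in use.
-/

/-- Computes `min (m + 1) (q / p)` by repeated addition of `p`. -/
def progRatio : Prog :=
  .seq (.add 8 1 4) <| .seq (.add 6 2 16) <| .seq
    (.loop 7 8 (.seq (.cond 3 6 (.const 9 0) (.seq (.add 5 5 4) (.add 6 6 2))) (.add 7 7 4))) <|
    .seq (.const 7 0) <| .seq (.const 8 0) (.const 6 0)

theorem exec_progRatio (n m : ℕ) {p : ℕ} (hp : 0 < p) (q : ℕ) :
    Exec tape progRatio (mem [n, m, p, q, 1, 0, 0, 0, 0, 0, 0, 0, 0, 0, 0, 0, 0, 0, 0, 0] A c)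
      ((m + 1) * 7 + 11)
      (mem [n, m, p, q, 1, min (m + 1) (q / p), 0, 0, 0, 0, 0, 0, 0, 0, 0, 0, 0, 0, 0, 0] A c) := by
  -- variable `6` holds `(k + 1) * p` for the current value `k` of variable `5`
  let σ : ℕ → Store := fun i => mem [n, m, p, q, 1, min i (q / p), (min i (q / p) + 1) * p, i,
    m + 1, 0, 0, 0, 0, 0, 0, 0, 0, 0, 0, 0] A c
  have hloop : Exec tape (.loop 7 8 (.seq (.cond 3 6 (.const 9 0)
      (.seq (.add 5 5 4) (.add 6 6 2))) (.add 7 7 4))) (σ 0) ((m + 1) * (6 + 1) + 1) (σ (m + 1)) := by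
    refine Exec.loop σ (m + 1) (fun i hi => hi) (lt_irrefl (m + 1)) fun i hi => ?_
    by_cases hq : q < (min i (q / p) + 1) * p
    · have hle : q / p ≤ i := by
        by_contra hlt
        rw [min_eq_left (by omega)] at hq
        have := (Nat.le_div_iff_mul_le hp).mp (show i + 1 ≤ q / p by omega)
        omega
      refine ((Exec.cond_pos hq (exec_const rfl)).seq (exec_add rfl)).congr ?_ (by norm_num)
      refine mem_congr ?_ rfl rfl
      simp [min_eq_right hle, min_eq_right (hle.trans (Nat.le_succ i))]
    · have hlt : i < q / p := by
        by_contra hle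
        rw [min_eq_right (by omega)] at hq
        exact hq (by rw [mul_comm]; exact Nat.lt_mul_div_succ q hp)
      refine ((Exec.cond_neg hq ((exec_add rfl).seq (exec_add rfl))).seq (exec_add rfl)).congr ?_
        (by norm_num)
      refine mem_congr ?_ rfl rfl
      simp [min_eq_left hlt.le, min_eq_left (show i + 1 ≤ q / p from hlt)]
      ring
  refine ((exec_add rfl).seq <| (exec_add rfl).seq <| Exec.seq (s₁ := σ (m + 1)) (B₁ := (m + 1) * (6 + 1) + 1) ?_ <|
    (exec_const rfl).seq <| (exec_const rfl).seq (exec_const rfl)).congr rfl (by omega)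
  convert hloop using 1
  refine mem_congr ?_ rfl rfl
  simp

/-- Computes `K * (n * (k * k))` by repeated addition. -/
def progScale (K : ℕ) : Prog :=
  .seq (.loop 7 5 (.seq (.add 12 12 5) (.add 7 7 4))) <| .seq (.const 7 0) <|
  .seq (.loop 7 0 (.seq (.add 11 11 12) (.add 7 7 4))) <| .seq (.const 7 0) <|
  .seq (.const 12 0) <| .seq (.const 15 K) <|
  .seq (.loop 7 15 (.seq (.add 12 12 11) (.add 7 7 4))) <| .seq (.const 7 0) <|
  .seq (.const 11 0) (.const 15 0)

theorem exec_progScale (n m p q k K : ℕ) :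
    Exec tape (progScale K)
      (mem [n, m, p, q, 1, k, 0, 0, 0, 0, 0, 0, 0, 0, 0, 0, 0, 0, 0, 0] A c)
      (k * 4 + n * 4 + K * 4 + 19)
      (mem [n, m, p, q, 1, k, 0, 0, 0, 0, 0, 0, K * (n * (k * k)), 0, 0, 0, 0, 0, 0, 0] A c) := by
  have h1 : Exec tape (.loop 7 5 (.seq (.add 12 12 5) (.add 7 7 4)))
      (mem [n, m, p, q, 1, k, 0, 0, 0, 0, 0, 0, 0, 0, 0, 0, 0, 0, 0, 0] A c) (k * (3 + 1) + 1)
      (mem [n, m, p, q, 1, k, 0, k, 0, 0, 0, 0, k * k, 0, 0, 0, 0, 0, 0, 0] A c) := by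
    refine Exec.loop_of (fun i => mem [n, m, p, q, 1, k, 0, i, 0, 0, 0, 0, i * k, 0, 0, 0, 0, 0, 0,
      0] A c) k (by simp) rfl le_rfl (fun i hi => hi) (lt_irrefl k) fun i hi => ?_
    refine ((exec_add rfl).seq (exec_add rfl)).congr (mem_congr ?_ rfl rfl) le_rfl
    simp [add_mul]
  have h2 : Exec tape (.loop 7 0 (.seq (.add 11 11 12) (.add 7 7 4)))
      (mem [n, m, p, q, 1, k, 0, 0, 0, 0, 0, 0, k * k, 0, 0, 0, 0, 0, 0, 0] A c) (n * (3 + 1) + 1)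
      (mem [n, m, p, q, 1, k, 0, n, 0, 0, 0, n * (k * k), k * k, 0, 0, 0, 0, 0, 0, 0] A c) := by
    refine Exec.loop_of (fun i => mem [n, m, p, q, 1, k, 0, i, 0, 0, 0, i * (k * k), k * k, 0, 0, 0,
      0, 0, 0, 0] A c) n (by simp) rfl le_rfl (fun i hi => hi) (lt_irrefl n) fun i hi => ?_
    refine ((exec_add rfl).seq (exec_add rfl)).congr (mem_congr ?_ rfl rfl) le_rfl
    simp [add_mul]
  have h3 : Exec tape (.loop 7 15 (.seq (.add 12 12 11) (.add 7 7 4)))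
      (mem [n, m, p, q, 1, k, 0, 0, 0, 0, 0, n * (k * k), 0, 0, 0, K, 0, 0, 0, 0] A c)
      (K * (3 + 1) + 1)
      (mem [n, m, p, q, 1, k, 0, K, 0, 0, 0, n * (k * k), K * (n * (k * k)), 0, 0, K, 0, 0, 0,
        0] A c) := by
    refine Exec.loop_of (fun i => mem [n, m, p, q, 1, k, 0, i, 0, 0, 0, n * (k * k),
      i * (n * (k * k)), 0, 0, K, 0, 0, 0, 0] A c) K (by simp) rfl le_rfl (fun i hi => hi) (lt_irrefl K)
      fun i hi => ?_
    refine ((exec_add rfl).seq (exec_add rfl)).congr (mem_congr ?_ rfl rfl) le_rfl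
    simp [add_mul]
  exact (h1.seq <| (exec_const rfl).seq <| h2.seq <| (exec_const rfl).seq <| (exec_const rfl).seq <|
    (exec_const rfl).seq <| h3.seq <| (exec_const rfl).seq <|
    (exec_const rfl).seq (exec_const rfl)).congr rfl (by omega)

/-- Doubles the block size until `x` blocks contain all terms. -/
def progDouble : Prog :=
  .seq (.const 13 1) <|
  .seq (.loop 12 1 (.seq (.add 12 12 12) <| .seq (.add 13 13 13) (.add 14 14 4))) (.const 12 0)

theorem exec_progDouble (n m p q k x J : ℕ) (h1 : ∀ i < J, x * 2 ^ i < m) (h2 : m ≤ x * 2 ^ J) :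
    Exec tape progDouble
      (mem [n, m, p, q, 1, k, 0, 0, 0, 0, 0, 0, x, 0, 0, 0, 0, 0, 0, 0] A c) (J * 6 + 5)
      (mem [n, m, p, q, 1, k, 0, 0, 0, 0, 0, 0, 0, 2 ^ J, J, 0, 0, 0, 0, 0] A c) := by
  have h : Exec tape (.loop 12 1 (.seq (.add 12 12 12) <| .seq (.add 13 13 13) (.add 14 14 4)))
      (mem [n, m, p, q, 1, k, 0, 0, 0, 0, 0, 0, x, 1, 0, 0, 0, 0, 0, 0] A c) (J * (5 + 1) + 1)
      (mem [n, m, p, q, 1, k, 0, 0, 0, 0, 0, 0, x * 2 ^ J, 2 ^ J, J, 0, 0, 0, 0, 0] A c) := by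
    refine Exec.loop_of (fun i => mem [n, m, p, q, 1, k, 0, 0, 0, 0, 0, 0, x * 2 ^ i, 2 ^ i, i, 0, 0,
      0, 0, 0] A c) J (by simp) rfl le_rfl (fun i hi => h1 i hi) (not_lt.mpr h2) fun i hi => ?_
    refine ((exec_add rfl).seq ((exec_add rfl).seq (exec_add rfl))).congr
      (mem_congr ?_ rfl rfl) le_rfl
    simp [pow_succ]
    ring_nf
    simp
  exact ((exec_const rfl).seq <| h.seq (exec_const rfl)).congr rfl (by omega)

/-- The arrays with `num`, `den` and `cnt` after the `r` input arrays: the numerators and denominators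
of the weights, and the numbers of occurrences of the qubits. -/
def arrs (r : ℕ) (A : ℕ → ℕ → ℕ) (num den cnt : ℕ → ℕ) : ℕ → ℕ → ℕ := fun a =>
  if a = r then num else if a = r + 1 then den else if a = r + 2 then cnt else A a

variable {r : ℕ} {num den cnt : ℕ → ℕ}

theorem arrs_num : arrs r A num den cnt r = num := by simp [arrs]

theorem arrs_den : arrs r A num den cnt (r + 1) = den := by simp [arrs]

theorem arrs_cnt : arrs r A num den cnt (r + 2) = cnt := by simp [arrs]

theorem arrs_of_lt {a : ℕ} (ha : a < r) : arrs r A num den cnt a = A a := by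
  unfold arrs
  rw [if_neg (by omega), if_neg (by omega), if_neg (by omega)]

theorem update_arrs_num (f : ℕ → ℕ) :
    Function.update (arrs r A num den cnt) r f = arrs r A f den cnt := by
  funext a
  simp only [Function.update_apply, arrs]
  split_ifs <;> rfl

theorem update_arrs_den (f : ℕ → ℕ) :
    Function.update (arrs r A num den cnt) (r + 1) f = arrs r A num f cnt := by
  funext a
  simp only [Function.update_apply, arrs]
  split_ifs <;> first | rfl | omega

theorem update_arrs_cnt (f : ℕ → ℕ) :
    Function.update (arrs r A num den cnt) (r + 2) f = arrs r A num den f := by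
  funext a
  simp only [Function.update_apply, arrs]
  split_ifs <;> first | rfl | omega

/-- The number of occurrences of `v` in the first `i` columns and in the first `j` entries of
column `i` of the array `A`, each column having `r` entries. -/
def occurrences (r : ℕ) (A : ℕ → ℕ → ℕ) (i j v : ℕ) : ℕ :=
  (∑ i' ∈ range i, ∑ j' ∈ range r, if A j' i' = v then 1 else 0) +
    ∑ j' ∈ range j, if A j' i = v then 1 else 0

/-- Counts the occurrences of each qubit. -/
def progCount (r : ℕ) : Prog :=
  .seq (.loop 7 1 (.seq (unroll (fun j => .seq (.load 8 j 7) <| .seq (.load 9 (r + 2) 8) <|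
    .seq (.add 9 9 4) <| .seq (.store (r + 2) 8 9) <| .seq (.const 8 0) (.const 9 0)) r)
    (.add 7 7 4))) (.const 7 0)

theorem exec_progCount (n m p q k s J : ℕ) (r : ℕ) :
    Exec tape (progCount r)
      (mem [n, m, p, q, 1, k, 0, 0, 0, 0, 0, 0, 0, s, J, 0, 0, 0, 0, 0]
        (arrs r A num den fun _ => 0) c) (m * (r * 12 + 4) + 3)
      (mem [n, m, p, q, 1, k, 0, 0, 0, 0, 0, 0, 0, s, J, 0, 0, 0, 0, 0]
        (arrs r A num den (occurrences r A m 0)) c) := by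
  let σ : ℕ → ℕ → Store := fun i j =>
    mem [n, m, p, q, 1, k, 0, i, 0, 0, 0, 0, 0, s, J, 0, 0, 0, 0, 0]
      (arrs r A num den (occurrences r A i j)) c
  have hpos : ∀ i, ∀ j < r, Exec tape (.seq (.load 8 j 7) <| .seq (.load 9 (r + 2) 8) <|
      .seq (.add 9 9 4) <| .seq (.store (r + 2) 8 9) <| .seq (.const 8 0) (.const 9 0))
      (σ i j) 11 (σ i (j + 1)) := by
    intro i j hj
    refine ((exec_load rfl).seq <| (exec_load rfl).seq <| (exec_add rfl).seq <| exec_store.seq <|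
      (exec_const rfl).seq (exec_const rfl)).congr (mem_congr rfl ?_ rfl) le_rfl
    simp only [List.set_cons_succ, List.set_cons_zero, List.getD_cons_succ, List.getD_cons_zero,
      arrs_of_lt hj, arrs_cnt, update_arrs_cnt]
    congr 1
    funext v
    rw [Function.update_apply]
    unfold occurrences
    rw [sum_range_succ _ j]
    by_cases hv : A j i = v
    · subst hv
      simp [add_assoc]
    · rw [if_neg (Ne.symm hv), if_neg hv]
      rfl
  have hrow : ∀ i, σ i r = mem [n, m, p, q, 1, k, 0, i, 0, 0, 0, 0, 0, s, J, 0, 0, 0, 0, 0]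
      (arrs r A num den (occurrences r A (i + 1) 0)) c := by
    intro i
    simp only [σ]
    congr 2
    funext v
    simp [occurrences, sum_range_succ]
  refine (Exec.seq (s₁ := σ m 0) (B₁ := m * (r * 12 + 4) + 1) ?_ (exec_const rfl)).congr rfl
    (by omega)
  refine Exec.loop_of (fun i => σ i 0) m ?_ rfl le_rfl (fun i hi => hi) (lt_irrefl m) fun i hi => ?_
  · refine mem_congr rfl ?_ rfl
    congr 1
  · exact ((exec_unroll (σ i) r ((exec_const rfl).congr rfl le_rfl) (hpos i)).seq
        (hrow i ▸ exec_add rfl)).congr rfl (by omega)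

end Programs

/-! ### Classification and sampling of terms -/

section Programs
open Finset
variable {tape : ℕ → Bool} {A : ℕ → ℕ → ℕ} {c r : ℕ} {num den cnt : ℕ → ℕ}

/-- Column `i` of the array `A` has among its first `j` entries one with a value of `cnt` at least
`K`. -/
def HasLargeCount (A : ℕ → ℕ → ℕ) (cnt : ℕ → ℕ) (K i j : ℕ) : Prop :=
  ∃ j' < j, K ≤ cnt (A j' i)

/-- Gives weight `1` to the light terms, and weight `0` to the heavy ones for the time being. -/
def progClassify (r K : ℕ) : Prog :=
  .seq (.const 15 K) <| .seq
    (.loop 7 1 <| .seq (unroll (fun j => .seq (.load 8 j 7) <| .seq (.load 9 (r + 2) 8) <|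
      .seq (.cond 9 15 (.const 8 0) (.const 10 1)) <| .seq (.const 8 0) (.const 9 0)) r) <|
      .seq (.cond 16 10 (.const 9 0) (.store r 7 4)) <| .seq (.store (r + 1) 7 4) <|
      .seq (.const 10 0) (.add 7 7 4)) <|
    .seq (.const 7 0) (.const 15 0)

open Classical in
theorem exec_progClassify (n m p q k s J K : ℕ) :
    Exec tape (progClassify r K)
      (mem [n, m, p, q, 1, k, 0, 0, 0, 0, 0, 0, 0, s, J, 0, 0, 0, 0, 0]
        (arrs r A (fun _ => 0) (fun _ => 0) cnt) c) (m * (r * 11 + 11) + 7)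
      (mem [n, m, p, q, 1, k, 0, 0, 0, 0, 0, 0, 0, s, J, 0, 0, 0, 0, 0]
        (arrs r A (fun i => if i < m ∧ ¬ HasLargeCount A cnt K i r then 1 else 0)
          (fun i => if i < m then 1 else 0) cnt) c) := by
  let N : ℕ → ℕ → ℕ := fun i v => if v < i ∧ ¬ HasLargeCount A cnt K v r then 1 else 0
  let D : ℕ → ℕ → ℕ := fun i v => if v < i then 1 else 0
  let h : ℕ → ℕ → ℕ := fun i j => if HasLargeCount A cnt K i j then 1 else 0
  let σ : ℕ → ℕ → Store := fun i j =>
    mem [n, m, p, q, 1, k, 0, i, 0, 0, h i j, 0, 0, s, J, K, 0, 0, 0, 0]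
      (arrs r A (N i) (D i) cnt) c
  have hpos : ∀ i, ∀ j < r, Exec tape (.seq (.load 8 j 7) <| .seq (.load 9 (r + 2) 8) <|
      .seq (.cond 9 15 (.const 8 0) (.const 10 1)) <| .seq (.const 8 0) (.const 9 0))
      (σ i j) 10 (σ i (j + 1)) := by
    intro i j hj
    have e1 : ((arrs r A (N i) (D i) cnt) (r + 2) ((arrs r A (N i) (D i) cnt) j i)) =
        cnt (A j i) := by rw [arrs_cnt, arrs_of_lt hj]
    by_cases hK : cnt (A j i) < K
    · have e2 : h i (j + 1) = h i j := by
        have : HasLargeCount A cnt K i (j + 1) ↔ HasLargeCount A cnt K i j := by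
          constructor
          · rintro ⟨j', hj', hc⟩
            refine ⟨j', ?_, hc⟩
            rcases Nat.lt_succ_iff_lt_or_eq.mp hj' with h | rfl
            · exact h
            · omega
          · rintro ⟨j', hj', hc⟩
            exact ⟨j', by omega, hc⟩
        simp only [h, this]
      refine ((exec_load rfl).seq <| (exec_load rfl).seq <| (Exec.cond_pos ?_ (exec_const rfl)).seq <|
        (exec_const rfl).seq (exec_const rfl)).congr (mem_congr ?_ rfl rfl) (by norm_num)
      · exact e1.trans_lt hK
      · simp [e2]
    · have e2 : h i (j + 1) = 1 := if_pos ⟨j, Nat.lt_succ_self j, not_lt.mp hK⟩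
      refine ((exec_load rfl).seq <| (exec_load rfl).seq <| (Exec.cond_neg ?_ (exec_const rfl)).seq <|
        (exec_const rfl).seq (exec_const rfl)).congr (mem_congr ?_ rfl rfl) (by norm_num)
      · exact fun hlt => hK (e1.symm.trans_lt hlt)
      · simp [e2]
  have hD : ∀ i, Function.update (D i) i 1 = D (i + 1) := by
    intro i
    funext v
    simp only [Function.update_apply, D]
    split_ifs <;> first | rfl | omega
  have hrow : ∀ i, Exec tape (.seq (.cond 16 10 (.const 9 0) (.store r 7 4)) <|
      .seq (.store (r + 1) 7 4) <| .seq (.const 10 0) (.add 7 7 4)) (σ i r) 8 (σ (i + 1) 0) := by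
    intro i
    have e0 : h (i + 1) 0 = 0 := if_neg fun ⟨j', hj', _⟩ => absurd hj' (Nat.not_lt_zero _)
    by_cases hl : HasLargeCount A cnt K i r
    · have e1 : h i r = 1 := if_pos hl
      have e2 : N (i + 1) = N i := by
        funext v
        simp only [N]
        by_cases hv : v = i
        · subst hv
          simp [hl]
        · have : v < i + 1 ↔ v < i := by omega
          simp only [this]
      refine ((Exec.cond_pos ?_ (exec_const rfl)).seq <| exec_store.seq <|
        (exec_const rfl).seq (exec_add rfl)).congr (mem_congr ?_ ?_ rfl) (by norm_num)
      · exact e1.symm ▸ Nat.zero_lt_one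
      · simp [e0]
      · simp only [List.set_cons_succ, List.set_cons_zero, List.getD_cons_succ,
          List.getD_cons_zero, arrs_den, update_arrs_den, hD, e2]
    · have e1 : h i r = 0 := if_neg hl
      have e2 : Function.update (N i) i 1 = N (i + 1) := by
        funext v
        simp only [N, Function.update_apply]
        by_cases hv : v = i
        · subst hv
          simp [hl]
        · have : v < i + 1 ↔ v < i := by omega
          rw [if_neg hv]
          simp only [this]
      refine ((Exec.cond_neg ?_ exec_store).seq <| exec_store.seq <|
        (exec_const rfl).seq (exec_add rfl)).congr (mem_congr ?_ ?_ rfl) (by norm_num)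
      · exact e1.symm ▸ Nat.lt_irrefl 0
      · simp [e0]
      · simp only [List.getD_cons_succ,
          List.getD_cons_zero, arrs_num, update_arrs_num, arrs_den, update_arrs_den, hD, e2]
  have h00 : ∀ i, h i 0 = 0 := fun i => if_neg fun ⟨j', hj', _⟩ => absurd hj' (Nat.not_lt_zero _)
  have hloop : Exec tape (.loop 7 1 <| .seq (unroll (fun j => .seq (.load 8 j 7) <|
      .seq (.load 9 (r + 2) 8) <|
      .seq (.cond 9 15 (.const 8 0) (.const 10 1)) <| .seq (.const 8 0) (.const 9 0)) r) <|
      .seq (.cond 16 10 (.const 9 0) (.store r 7 4)) <| .seq (.store (r + 1) 7 4) <|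
      .seq (.const 10 0) (.add 7 7 4)) (σ 0 0) (m * (r * 11 + 11) + 1) (σ m 0) :=
    Exec.loop_of (fun i => σ i 0) m rfl rfl le_rfl (fun i hi => hi) (lt_irrefl m) fun i hi =>
      ((exec_unroll (σ i) r ((exec_const rfl).congr rfl le_rfl) (hpos i)).seq (hrow i)).mono
        (by omega)
  refine ((exec_const rfl).seq <| Exec.seq (s₁ := σ m 0) (B₁ := m * (r * 11 + 11) + 1) ?_ <|
    (exec_const rfl).seq (exec_const rfl)).congr (mem_congr ?_ rfl rfl) (by omega)
  · convert hloop using 1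
    refine mem_congr ?_ ?_ rfl
    · simp [h00]
    · congr 1
  · simp [h00]

/-- The number whose binary digits are the `j` coins from coin `c` on, first coin first. -/
def draw (tape : ℕ → Bool) (c : ℕ) : ℕ → ℕ
  | 0 => 0
  | j + 1 => 2 * draw tape c j + (tape (c + j)).toNat

theorem draw_lt (c j : ℕ) : draw tape c j < 2 ^ j := by
  induction j with
  | zero => simp [draw]
  | succ j ih =>
    have := Bool.toNat_le (tape (c + j))
    rw [draw, pow_succ]
    omega

/-- Picks a uniformly random term in each block, and gives it the block size as its weight if its
present weight is `0`. -/
def progSample (r : ℕ) : Prog :=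
  .loop 17 1 <| .seq (.loop 18 14 <| .seq (.add 8 8 8) <| .seq (.flip 19) <| .seq (.add 8 8 19) <|
    .seq (.const 19 0) (.add 18 18 4)) <| .seq (.add 8 8 17) <|
    .seq (.cond 8 1 (.seq (.load 9 r 8) (.cond 16 9 (.const 18 0) (.store r 8 13))) (.const 18 0)) <|
    .seq (.const 8 0) <| .seq (.const 9 0) <| .seq (.const 18 0) (.add 17 17 13)

/-- The weight given to term `i` when the first `b` blocks have been sampled: blocks have size
`2 ^ J`, and block `b'` uses the coins from `b' * J` on. -/
def sampledWeight (tape : ℕ → Bool) (num : ℕ → ℕ) (m J b i : ℕ) : ℕ :=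
  if i < m ∧ num i = 0 ∧ i / 2 ^ J < b ∧ i % 2 ^ J = draw tape (i / 2 ^ J * J) J then 2 ^ J
  else num i

theorem exec_progSample (n m p q k J B : ℕ) (hB : ∀ b < B, b * 2 ^ J < m) (hB' : m ≤ B * 2 ^ J) :
    Exec tape (progSample r)
      (mem [n, m, p, q, 1, k, 0, 0, 0, 0, 0, 0, 0, 2 ^ J, J, 0, 0, 0, 0, 0]
        (arrs r A num den cnt) 0) (B * (J * 10 + 18) + 1)
      (mem [n, m, p, q, 1, k, 0, 0, 0, 0, 0, 0, 0, 2 ^ J, J, 0, 0, B * 2 ^ J, 0, 0]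
        (arrs r A (sampledWeight tape num m J B) den cnt) (B * J)) := by
  refine Exec.loop_of (fun b => mem [n, m, p, q, 1, k, 0, 0, 0, 0, 0, 0, 0, 2 ^ J, J, 0, 0,
    b * 2 ^ J, 0, 0] (arrs r A (sampledWeight tape num m J b) den cnt) (b * J)) B ?_ rfl le_rfl
    (fun b hb => hB b hb) (not_lt.mpr hB') fun b hb => ?_
  · refine mem_congr (by simp) ?_ (by simp)
    congr 1
    funext i
    simp [sampledWeight]
  set d := draw tape (b * J) J with hd
  have hdlt : d < 2 ^ J := draw_lt _ _
  have hdiv : (d + b * 2 ^ J) / 2 ^ J = b := by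
    rw [Nat.add_mul_div_right _ _ (by positivity), Nat.div_eq_of_lt hdlt, zero_add]
  have hmod : (d + b * 2 ^ J) % 2 ^ J = d := by
    rw [Nat.add_mul_mod_self_right, Nat.mod_eq_of_lt hdlt]
  have hloop : Exec tape (.loop 18 14 <| .seq (.add 8 8 8) <| .seq (.flip 19) <|
      .seq (.add 8 8 19) <| .seq (.const 19 0) (.add 18 18 4))
      (mem [n, m, p, q, 1, k, 0, 0, 0, 0, 0, 0, 0, 2 ^ J, J, 0, 0, b * 2 ^ J, 0, 0]
        (arrs r A (sampledWeight tape num m J b) den cnt) (b * J)) (J * 10 + 1)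
      (mem [n, m, p, q, 1, k, 0, 0, d, 0, 0, 0, 0, 2 ^ J, J, 0, 0, b * 2 ^ J, J, 0]
        (arrs r A (sampledWeight tape num m J b) den cnt) (b * J + J)) := by
    refine Exec.loop_of (fun j => mem [n, m, p, q, 1, k, 0, 0, draw tape (b * J) j, 0, 0, 0, 0,
      2 ^ J, J, 0, 0, b * 2 ^ J, j, 0] (arrs r A (sampledWeight tape num m J b) den cnt) (b * J + j))
      J rfl rfl le_rfl (fun j hj => hj) (lt_irrefl J) fun j hj => ?_
    refine ((exec_add rfl).seq <| (exec_flip rfl).seq <| (exec_add rfl).seq <|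
      (exec_const rfl).seq (exec_add rfl)).congr (mem_congr ?_ rfl rfl) le_rfl
    simp [draw, two_mul]
  -- an entry that is not the chosen one keeps its weight
  have hkeep : ∀ i, i ≠ d + b * 2 ^ J →
      sampledWeight tape num m J (b + 1) i = sampledWeight tape num m J b i := by
    intro i hi
    unfold sampledWeight
    have : (i / 2 ^ J < b + 1 ∧ i % 2 ^ J = draw tape (i / 2 ^ J * J) J) ↔
        (i / 2 ^ J < b ∧ i % 2 ^ J = draw tape (i / 2 ^ J * J) J) := by
      constructor
      · rintro ⟨h1, h2⟩
        refine ⟨lt_of_le_of_ne (Nat.lt_succ_iff.mp h1) fun e => hi ?_, h2⟩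
        rw [e] at h2
        rw [hd, ← h2, ← e, mul_comm]
        exact (Nat.mod_add_div _ _).symm
      · rintro ⟨h1, h2⟩
        exact ⟨by omega, h2⟩
    simp only [this]
  have hbefore : sampledWeight tape num m J b (d + b * 2 ^ J) = num (d + b * 2 ^ J) := by
    unfold sampledWeight
    rw [hdiv, if_neg]
    rintro ⟨-, -, h, -⟩
    exact lt_irrefl _ h
  have hafter : sampledWeight tape num m J (b + 1) (d + b * 2 ^ J) =
      if d + b * 2 ^ J < m ∧ num (d + b * 2 ^ J) = 0 then 2 ^ J else num (d + b * 2 ^ J) := by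
    unfold sampledWeight
    rw [hdiv, hmod]
    simp [← hd]
  have hsame : sampledWeight tape num m J (b + 1) (d + b * 2 ^ J) = num (d + b * 2 ^ J) →
      sampledWeight tape num m J (b + 1) = sampledWeight tape num m J b := by
    intro h
    funext i
    by_cases hi : i = d + b * 2 ^ J
    · rw [hi, h, hbefore]
    · exact hkeep i hi
  have hcase : Exec tape (.cond 8 1 (.seq (.load 9 r 8)
      (.cond 16 9 (.const 18 0) (.store r 8 13))) (.const 18 0))
      (mem [n, m, p, q, 1, k, 0, 0, d + b * 2 ^ J, 0, 0, 0, 0, 2 ^ J, J, 0, 0, b * 2 ^ J, J, 0]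
        (arrs r A (sampledWeight tape num m J b) den cnt) (b * J + J)) 5
      (mem [n, m, p, q, 1, k, 0, 0, d + b * 2 ^ J, if d + b * 2 ^ J < m then num (d + b * 2 ^ J) else 0,
        0, 0, 0, 2 ^ J, J, 0, 0, b * 2 ^ J,
        if d + b * 2 ^ J < m ∧ num (d + b * 2 ^ J) = 0 then J else 0, 0]
        (arrs r A (sampledWeight tape num m J (b + 1)) den cnt) (b * J + J)) := by
    by_cases h1 : d + b * 2 ^ J < m
    · by_cases h2 : num (d + b * 2 ^ J) = 0
      · rw [if_pos ⟨h1, h2⟩] at hafter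
        refine (Exec.cond_pos h1 <| (exec_load rfl).seq <| Exec.cond_neg ?_ exec_store).congr
          (mem_congr ?_ ?_ rfl) le_rfl
        · change ¬ 0 < arrs r A _ den cnt r (d + b * 2 ^ J)
          rw [arrs_num, hbefore, h2]
          exact lt_irrefl 0
        · simp [arrs_num, hbefore, h1, h2]
        · simp only [List.set_cons_succ, List.set_cons_zero, List.getD_cons_succ,
            List.getD_cons_zero, arrs_num, update_arrs_num]
          congr 1
          funext i
          rw [Function.update_apply]
          split_ifs with hi
          · rw [hi, hafter]
          · exact (hkeep i hi).symm
      · rw [if_neg fun h => h2 h.2] at hafter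
        rw [hsame hafter]
        refine (Exec.cond_pos h1 <| (exec_load rfl).seq <| Exec.cond_pos ?_ (exec_const rfl)).congr
          (mem_congr ?_ rfl rfl) le_rfl
        · change 0 < arrs r A _ den cnt r (d + b * 2 ^ J)
          rw [arrs_num, hbefore]
          exact Nat.pos_of_ne_zero h2
        · simp [arrs_num, hbefore, h1, h2]
    · rw [if_neg fun h => h1 h.1] at hafter
      rw [hsame hafter]
      refine (Exec.cond_neg h1 (exec_const rfl)).congr (mem_congr ?_ rfl rfl) (by norm_num)
      simp [h1]
  refine (hloop.seq <| (exec_add rfl).seq <| hcase.seq <| (exec_const rfl).seq <|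
    (exec_const rfl).seq <| (exec_const rfl).seq (exec_add rfl)).congr (mem_congr ?_ rfl ?_) (by omega)
  · simp [add_mul]
  · ring

end Programs

/-! ### The sparsification algorithm -/

section Programs
open Finset
variable {tape : ℕ → Bool} {r n m : ℕ}

/-- The sparsification algorithm with at most `K * n * k ^ 2` blocks for `k = min (m + 1) (q / p)`, where
a term is heavy if one of its qubits lies in at least `H` terms. It does nothing if `k = 0`. -/
def progSparsify (r K H : ℕ) : Prog :=
  .seq (.const 4 1) <| .seq progRatio <| .cond 16 5
    (.seq (progScale K) <| .seq progDouble <| .seq (progCount r) <|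
      .seq (progClassify r H) (progSample r))
    (.const 9 0)

/-- The input arrays, `0` beyond the bounds. -/
def inputArr (T : Fin m ↪ (Fin r ↪ Fin n)) : ℕ → ℕ → ℕ :=
  fun j i => if h : i < m ∧ j < r then (T ⟨i, h.1⟩ ⟨j, h.2⟩ : ℕ) else 0

theorem inputArr_apply (T : Fin m ↪ (Fin r ↪ Fin n)) (i : Fin m) (j : Fin r) :
    inputArr T j i = T i j := by
  simp [inputArr]

theorem inputStore_eq_mem (T : Fin m ↪ (Fin r ↪ Fin n)) (p q : ℕ) :
    inputStore T p q = mem [n, m, p, q, 0, 0, 0, 0, 0, 0, 0, 0, 0, 0, 0, 0, 0, 0, 0, 0]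
      (arrs r (inputArr T) (fun _ => 0) (fun _ => 0) fun _ => 0) 0 := by
  unfold inputStore mem
  congr 1
  · funext x
    by_cases hx : x < 20
    · interval_cases x <;> rfl
    · rw [if_neg (by omega), if_neg (by omega), if_neg (by omega), if_neg (by omega),
        List.getD_eq_default _ _ (by simpa using hx)]
  · funext j i
    unfold arrs
    by_cases hj : j < r
    · rw [if_neg (by omega), if_neg (by omega), if_neg (by omega)]
      rfl
    · have h0 : ∀ k, inputArr T j k = 0 := fun k => dif_neg fun h => hj h.2
      refine (h0 i).trans ?_
      split_ifs <;> first | rfl | exact (h0 i).symm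

theorem occurrences_inputArr (T : Fin m ↪ (Fin r ↪ Fin n)) (v : Fin n) :
    occurrences r (inputArr T) m 0 v = degree T v := by
  classical
  unfold occurrences degree
  rw [range_zero, sum_empty, add_zero, Finset.sum_range, card_filter]
  refine sum_congr rfl fun i _ => ?_
  rw [Finset.sum_range]
  simp only [inputArr_apply, Fin.val_inj]
  by_cases h : ∃ p, T i p = v
  · obtain ⟨p, hp⟩ := h
    rw [if_pos ⟨p, hp⟩, sum_eq_single p]
    · rw [if_pos hp]
    · intro p' _ hne
      rw [if_neg fun h => hne ((T i).injective (h.trans hp.symm))]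
    · exact fun h => absurd (mem_univ p) h
  · rw [if_neg h]
    exact sum_eq_zero fun p _ => if_neg fun hp => h ⟨p, hp⟩

theorem hasLargeCount_inputArr (T : Fin m ↪ (Fin r ↪ Fin n)) (i : Fin m) :
    HasLargeCount (inputArr T) (occurrences r (inputArr T) m 0) (heavyBound r) i r ↔
      IsHeavy T i := by
  unfold HasLargeCount IsHeavy
  constructor
  · rintro ⟨j, hj, h⟩
    refine ⟨⟨j, hj⟩, ?_⟩
    rwa [inputArr_apply T i ⟨j, hj⟩, occurrences_inputArr] at h
  · rintro ⟨j, h⟩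
    exact ⟨j, j.2, by rwa [inputArr_apply, occurrences_inputArr]⟩

open Classical in
/-- The weights computed with block size `2 ^ J`: a heavy term has weight `2 ^ J` if it is chosen in
its block, and weight `0` if it is not; a light term has weight `1`. -/
noncomputable def sampleWeight (T : Fin m ↪ (Fin r ↪ Fin n)) (J : ℕ) (tape : ℕ → Bool) :
    Fin m → ℝ := fun i =>
  if IsHeavy T i then if (i : ℕ) % 2 ^ J = draw tape (i / 2 ^ J * J) J then 2 ^ J else 0 else 1

/-- For `q < p` the output arrays stay empty, and all weights are `0` by the convention on vanishing
denominators. -/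
theorem exists_exec_progSparsify_of_lt (T : Fin m ↪ (Fin r ↪ Fin n)) (K H : ℕ) {p q : ℕ}
    (hqp : q < p) (tape : ℕ → Bool) :
    ∃ s', Exec tape (progSparsify r K H) (inputStore T p q)
      ((4 * K + 23 * r + 150) * (n + m + 1) ^ 2) s' ∧ outputWeight r m s' = 0 := by
  rw [inputStore_eq_mem]
  have hk : min (m + 1) (q / p) = 0 := by rw [Nat.div_eq_of_lt hqp, min_eq_right (Nat.zero_le _)]
  refine ⟨_, ((exec_const rfl).seq <| (exec_progRatio n m (by omega) q).seq <|
    Exec.cond_neg ?_ (exec_const rfl)).mono ?_, ?_⟩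
  · rw [hk]
    exact lt_irrefl 0
  · nlinarith [Nat.zero_le (K * (n + m + 1) ^ 2), Nat.zero_le (r * (n + m + 1) ^ 2),
      Nat.zero_le (n * m), Nat.zero_le (n ^ 2), Nat.zero_le (m ^ 2)]
  · funext i
    simp [outputWeight, mem, arrs_num]

theorem exists_exec_progSparsify (T : Fin m ↪ (Fin r ↪ Fin n)) (K : ℕ) {p q k J B : ℕ}
    (hp : 0 < p) (hk : k = min (m + 1) (q / p)) (hk0 : 0 < k)
    (h1 : ∀ i < J, K * (n * (k * k)) * 2 ^ i < m) (h2 : m ≤ K * (n * (k * k)) * 2 ^ J)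
    (hJ : J ≤ m) (hB : ∀ b < B, b * 2 ^ J < m) (hB' : m ≤ B * 2 ^ J) (hBm : B ≤ m)
    (tape : ℕ → Bool) :
    ∃ s', Exec tape (progSparsify r K (heavyBound r)) (inputStore T p q)
      ((4 * K + 23 * r + 150) * (n + m + 1) ^ 2) s' ∧
      outputWeight r m s' = sampleWeight T J tape := by
  classical
  rw [inputStore_eq_mem]
  refine ⟨_, ((exec_const rfl).seq <| (exec_progRatio n m hp q).seq <|
    Exec.cond_pos (hk ▸ hk0) <| (exec_progScale n m p q _ K).seq <|
    (exec_progDouble n m p q _ _ J (hk ▸ h1) (hk ▸ h2)).seq <|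
    (exec_progCount n m p q _ _ J r).seq <|
    (exec_progClassify n m p q _ _ J (heavyBound r)).seq <|
    exec_progSample n m p q _ J B hB hB').mono ?_, ?_⟩
  · rw [← hk]
    have hkm : k ≤ m + 1 := hk ▸ min_le_left _ _
    have hBJ : B * J ≤ m * m := Nat.mul_le_mul hBm hJ
    nlinarith [Nat.zero_le (K * (n + m)), Nat.zero_le (K * (n + m) ^ 2), Nat.zero_le (r * m),
      Nat.zero_le (r * n), Nat.zero_le (r * (n + m) ^ 2),
      Nat.zero_le (n * m), Nat.zero_le (n ^ 2), Nat.zero_le (m ^ 2)]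
  · funext i
    have hdiv : (i : ℕ) / 2 ^ J < B :=
      (Nat.div_lt_iff_lt_mul (by positivity)).mpr (lt_of_lt_of_le i.2 hB')
    simp only [outputWeight, mem, arrs_num, arrs_den, sampledWeight, sampleWeight,
      hasLargeCount_inputArr, i.2, hdiv, true_and, if_true]
    by_cases hi : IsHeavy T i
    · simp [hi]
    · simp [hi]

/-- The block size `2 ^ J` and the number `B` of blocks that cover `m` terms: `J` is minimal such
that `x` blocks suffice. -/
theorem exists_blocks {x : ℕ} (m : ℕ) (hx : 0 < m → 0 < x) :
    ∃ J B : ℕ, (∀ i < J, x * 2 ^ i < m) ∧ m ≤ x * 2 ^ J ∧ J ≤ m ∧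
      (∀ b < B, b * 2 ^ J < m) ∧ m ≤ B * 2 ^ J ∧ B ≤ m ∧ B ≤ x := by
  have hex : ∃ J, m ≤ x * 2 ^ J := by
    rcases Nat.eq_zero_or_pos m with rfl | hm
    · exact ⟨0, Nat.zero_le _⟩
    · exact ⟨m, (Nat.lt_two_pow_self (n := m)).le.trans (Nat.le_mul_of_pos_left _ (hx hm))⟩
  have hexB : ∃ B, m ≤ B * 2 ^ Nat.find hex := ⟨x, Nat.find_spec hex⟩
  refine ⟨Nat.find hex, Nat.find hexB, fun i hi => not_le.mp (Nat.find_min hex hi),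
    Nat.find_spec hex, Nat.find_min' hex ?_, fun b hb => not_le.mp (Nat.find_min hexB hb),
    Nat.find_spec hexB, Nat.find_min' hexB (Nat.le_mul_of_pos_right _ (by positivity)),
    Nat.find_min' hexB (Nat.find_spec hex)⟩
  rcases Nat.eq_zero_or_pos m with rfl | hm
  · exact Nat.zero_le _
  · exact (Nat.lt_two_pow_self (n := m)).le.trans (Nat.le_mul_of_pos_left _ (hx hm))

end Programs

/-! ### Coin tosses and sampling from blocks -/

section Coins
open Finset

instance : IsProbabilityMeasure coinMeasure := by
  unfold coinMeasure
  infer_instance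

/-- The first `B * J` coins, arranged in `B` blocks of length `J`. -/
def coinBlocks (B J : ℕ) (tape : ℕ → Bool) : Fin B → Fin J → Bool := fun b j => tape (b * J + j)

theorem coinMeasure_coinBlocks_eq_le (B J : ℕ) (f : Fin B → Fin J → Bool) :
    coinMeasure {tape | coinBlocks B J tape = f} ≤ 2⁻¹ ^ (B * J) := by
  rcases Set.eq_empty_or_nonempty {tape | coinBlocks B J tape = f} with h | ⟨t₀, ht₀⟩
  · rw [h, measure_empty]
    exact zero_le
  have hsub : {tape | coinBlocks B J tape = f} ⊆
      Set.pi (range (B * J)) fun i => ({t₀ i} : Set Bool) := by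
    intro t ht i hi
    have hi' : i < B * J := by simpa using hi
    have hJ : 0 < J := Nat.pos_of_ne_zero fun h => by simp [h] at hi'
    have h : coinBlocks B J t = coinBlocks B J t₀ := ht.trans ht₀.symm
    have h2 := congrFun (congrFun h ⟨i / J, (Nat.div_lt_iff_lt_mul hJ).mpr hi'⟩)
      ⟨i % J, Nat.mod_lt _ hJ⟩
    simp only [coinBlocks, Nat.div_add_mod'] at h2
    exact h2
  refine (measure_mono hsub).trans ?_
  rw [coinMeasure, Measure.infinitePi_pi _ fun i _ => MeasurableSet.singleton _]
  refine le_of_eq ?_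
  have : ∀ x : Bool, (PMF.uniformOfFintype Bool).toMeasure {x} = 2⁻¹ := by
    intro x
    rw [PMF.toMeasure_apply_singleton _ _ (MeasurableSet.singleton x)]
    simp
  simp [this]

/-- An event that occurs unless the first `B * J` coins take one of finitely many bad values has
large probability. -/
theorem one_sub_card_div_le_coinMeasure_real {B J : ℕ} {good : Set (ℕ → Bool)}
    (bad : Finset (Fin B → Fin J → Bool)) (h : ∀ tape, coinBlocks B J tape ∉ bad → tape ∈ good) :
    1 - bad.card / (2 ^ J : ℝ) ^ B ≤ coinMeasure.real good := by
  have hcov : (Set.univ : Set (ℕ → Bool)) ⊆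
      good ∪ ⋃ f ∈ bad, {tape | coinBlocks B J tape = f} := by
    intro tape _
    by_cases ht : coinBlocks B J tape ∈ bad
    · exact Or.inr (Set.mem_biUnion ht rfl)
    · exact Or.inl (h tape ht)
  have hbad : coinMeasure.real (⋃ f ∈ bad, {tape | coinBlocks B J tape = f}) ≤
      bad.card / (2 ^ J : ℝ) ^ B := by
    refine (measureReal_biUnion_finset_le _ _).trans ?_
    have : ∀ f ∈ bad, coinMeasure.real {tape | coinBlocks B J tape = f} ≤ 1 / (2 ^ J : ℝ) ^ B := by
      intro f _
      refine (ENNReal.toReal_mono (by finiteness) (coinMeasure_coinBlocks_eq_le B J f)).trans ?_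
      rw [ENNReal.toReal_pow, ENNReal.toReal_inv, ENNReal.toReal_ofNat, inv_pow, one_div, mul_comm,
        pow_mul]
    refine (sum_le_sum this).trans_eq ?_
    rw [sum_const, nsmul_eq_mul, mul_one_div]
  have h1 := (measureReal_mono (μ := coinMeasure) hcov).trans (measureReal_union_le _ _)
  rw [probReal_univ] at h1
  linarith

variable {t t' : ℕ → Bool}

theorem draw_inj {c c' : ℕ} (J : ℕ) :
    draw t c J = draw t' c' J ↔ ∀ j < J, t (c + j) = t' (c' + j) := by
  induction J with
  | zero => simp [draw]
  | succ J ih =>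
    have h1 := Bool.toNat_le (t (c + J))
    have h2 := Bool.toNat_le (t' (c' + J))
    have h3 : (t (c + J)).toNat = (t' (c' + J)).toNat ↔ t (c + J) = t' (c' + J) := by
      cases t (c + J) <;> cases t' (c' + J) <;> decide
    have h4 : draw t c (J + 1) = draw t' c' (J + 1) ↔
        draw t c J = draw t' c' J ∧ (t (c + J)).toNat = (t' (c' + J)).toNat := by
      simp only [draw]
      omega
    rw [h4, ih, h3]
    constructor
    · rintro ⟨h, h'⟩ j hj
      rcases Nat.lt_succ_iff_lt_or_eq.mp hj with hj | rfl
      · exact h j hj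
      · exact h'
    · exact fun h => ⟨fun j hj => h j (by omega), h J (by omega)⟩

/-- The number with given binary digits. -/
def digitsValue {J : ℕ} (ω : Fin J → Bool) : ℕ :=
  draw (fun j => if h : j < J then ω ⟨j, h⟩ else false) 0 J

theorem draw_eq_digitsValue (tape : ℕ → Bool) {B J : ℕ} (b : Fin B) :
    draw tape (b * J) J = digitsValue (coinBlocks B J tape b) := by
  unfold digitsValue
  rw [draw_inj]
  intro j hj
  simp [coinBlocks, hj]

theorem sum_digitsValue {β : Type*} [AddCommMonoid β] (J : ℕ) (f : ℕ → β) :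
    ∑ ω : Fin J → Bool, f (digitsValue ω) = ∑ i ∈ range (2 ^ J), f i := by
  let F : (Fin J → Bool) → Fin (2 ^ J) := fun ω => ⟨digitsValue ω, draw_lt _ _⟩
  have hF : F.Bijective := by
    rw [Fintype.bijective_iff_injective_and_card]
    refine ⟨fun ω ω' h => ?_, by simp⟩
    funext j
    have := (draw_inj J).mp (Fin.val_eq_of_eq h) j j.2
    simpa using this
  rw [Finset.sum_range, ← hF.sum_comp fun i => f (i : ℕ)]

end Coins

section Blocks
open Finset

theorem sum_range_mul_eq {β : Type*} [AddCommMonoid β] (B N : ℕ) (f : ℕ → β) :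
    ∑ i ∈ range (B * N), f i = ∑ b : Fin B, ∑ i ∈ range N, f (b * N + i) := by
  rw [← Finset.sum_range fun b => ∑ i ∈ range N, f (b * N + i)]
  induction B with
  | zero => simp
  | succ B ih => rw [add_mul, one_mul, sum_range_add, ih, sum_range_succ]

/-- The real part of the quadratic form of a matrix, as a function of the matrix. -/
noncomputable def reQuadForm {d : Type*} [Fintype d] (ψ : d → ℂ) : Matrix d d ℂ →ₗ[ℝ] ℝ where
  toFun X := (star ψ ⬝ᵥ X.mulVec ψ).re
  map_add' X Y := by simp [Matrix.add_mulVec, dotProduct_add]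
  map_smul' a X := by simp [Matrix.smul_mulVec, dotProduct_smul]

variable {d : Type*} [Fintype d] [DecidableEq d]

open Classical in
/-- Matrix Hoeffding inequality for sampling one member of each block of size `2 ^ J` of a family
of matrices between `0` and `C`, with weight `2 ^ J`. -/
theorem card_filter_block_sample_le {B J : ℕ} {A : ℕ → Matrix d d ℂ} {C u t : ℝ} (hC : 0 < C)
    (hu : 0 < u) (hu1 : u ≤ 1) (ht : 0 ≤ t) (h0 : ∀ i, (A i).PosSemidef)
    (h1 : ∀ i, ((C : ℂ) • (1 : Matrix d d ℂ) - A i).PosSemidef) :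
    ((univ.filter fun ω : Fin B → Fin J → Bool => ¬ ∀ φ : d → ℂ,
      |∑ b, (2 ^ J * reQuadForm φ (A (b * 2 ^ J + digitsValue (ω b))) -
        ∑ i ∈ range (2 ^ J), reQuadForm φ (A (b * 2 ^ J + i)))| ≤ t * ∑ i, ‖φ i‖ ^ 2).card : ℝ) ≤
      2 * (2 ^ J) ^ B * Fintype.card d * Real.exp (2 * B * u ^ 2 - u * t / (2 ^ J * C)) := by
  let X : Fin B → (Fin J → Bool) → Matrix d d ℂ := fun b ω =>
    (2 ^ J : ℝ) • A (b * 2 ^ J + digitsValue ω) - ∑ i ∈ range (2 ^ J), A (b * 2 ^ J + i)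
  have hN : (0 : ℝ) < 2 ^ J := by positivity
  have hc : ((2 ^ J * C : ℝ) : ℂ) • (1 : Matrix d d ℂ) = (2 ^ J : ℝ) • ((C : ℂ) • (1 : Matrix d d ℂ)) := by
    rw [← smul_assoc]
    congr 1
    simp
  have hX1 : ∀ b ω, (((2 ^ J * C : ℝ) : ℂ) • (1 : Matrix d d ℂ) - X b ω).PosSemidef := by
    intro b ω
    have e : ((2 ^ J * C : ℝ) : ℂ) • (1 : Matrix d d ℂ) - X b ω =
        (2 ^ J : ℝ) • ((C : ℂ) • (1 : Matrix d d ℂ) - A (b * 2 ^ J + digitsValue ω)) +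
          ∑ i ∈ range (2 ^ J), A (b * 2 ^ J + i) := by
      rw [hc, smul_sub]
      simp only [X]
      abel
    rw [e]
    exact ((h1 _).smul hN.le).add (Matrix.posSemidef_sum _ fun i _ => h0 _)
  have hX2 : ∀ b ω, (((2 ^ J * C : ℝ) : ℂ) • (1 : Matrix d d ℂ) + X b ω).PosSemidef := by
    intro b ω
    have e : ((2 ^ J * C : ℝ) : ℂ) • (1 : Matrix d d ℂ) + X b ω =
        (2 ^ J : ℝ) • A (b * 2 ^ J + digitsValue ω) +
          ∑ i ∈ range (2 ^ J), ((C : ℂ) • (1 : Matrix d d ℂ) - A (b * 2 ^ J + i)) := by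
      rw [hc, sum_sub_distrib, sum_const, card_range, ← Nat.cast_smul_eq_nsmul ℝ]
      push_cast
      simp only [X]
      abel
    rw [e]
    exact ((h0 _).smul hN.le).add (Matrix.posSemidef_sum _ fun i _ => h1 _)
  have hX0 : ∀ b, ∑ ω, X b ω = 0 := by
    intro b
    rw [sum_sub_distrib, sum_const, card_univ, ← smul_sum,
      sum_digitsValue J fun i => A (b * 2 ^ J + i), ← Nat.cast_smul_eq_nsmul ℝ]
    simp
  have key := card_filter_matrix_sum_le (X := X) (c := 2 ^ J * C) (θ := u / (2 ^ J * C)) (t := t)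
    (by positivity) (by positivity) ht (by rwa [div_mul_cancel₀ _ (by positivity)]) hX1 hX2 hX0
  have hquad : ∀ (ω : Fin B → Fin J → Bool) (φ : d → ℂ),
      (star φ ⬝ᵥ (∑ b, X b (ω b)).mulVec φ).re =
        ∑ b, (2 ^ J * reQuadForm φ (A (b * 2 ^ J + digitsValue (ω b))) -
          ∑ i ∈ range (2 ^ J), reQuadForm φ (A (b * 2 ^ J + i))) := by
    intro ω φ
    change reQuadForm φ (∑ b, X b (ω b)) = _
    simp only [X, map_sum, map_sub, map_smul, smul_eq_mul]
  simp only [hquad] at key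
  refine key.trans_eq ?_
  rw [div_mul_cancel₀ _ (by positivity), div_mul_eq_mul_div]
  simp

end Blocks

/-! ### Sampling gives a sparsifier -/

section Sampling
open Finset
variable {r n m : ℕ}

open Classical in
/-- The operator of term `i` if that term is heavy, and `0` otherwise, in particular for `m ≤ i`. -/
noncomputable def heavyTerm (T : Fin m ↪ (Fin r ↪ Fin n)) (M : Matrix (Bits r) (Bits r) ℂ) (i : ℕ) :
    Matrix (Bits n) (Bits n) ℂ :=
  if h : ∃ hi : i < m, IsHeavy T ⟨i, hi⟩ then localTerm (T ⟨i, h.1⟩) M else 0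

variable (T : Fin m ↪ (Fin r ↪ Fin n)) {M : Matrix (Bits r) (Bits r) ℂ}

theorem posSemidef_heavyTerm (hM : M.PosSemidef) (i : ℕ) : (heavyTerm T M i).PosSemidef := by
  unfold heavyTerm
  split_ifs
  · exact posSemidef_localTerm _ hM
  · exact Matrix.PosSemidef.zero

theorem posSemidef_smul_one_sub_heavyTerm {C : ℝ} (hC : 0 ≤ C)
    (hM : ((C : ℂ) • (1 : Matrix (Bits r) (Bits r) ℂ) - M).PosSemidef) (i : ℕ) :
    ((C : ℂ) • (1 : Matrix (Bits n) (Bits n) ℂ) - heavyTerm T M i).PosSemidef := by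
  unfold heavyTerm
  split_ifs
  · exact posSemidef_smul_one_sub_localTerm _ hM
  · rw [sub_zero]
    exact Matrix.PosSemidef.one.smul (by exact_mod_cast hC)

open Classical in
theorem reQuadForm_heavyTerm (M : Matrix (Bits r) (Bits r) ℂ) (ψ : Bits n → ℂ) (i : Fin m) :
    reQuadForm ψ (heavyTerm T M i) = if IsHeavy T i then energy (T i) M ψ else 0 := by
  unfold heavyTerm
  by_cases h : IsHeavy T i
  · rw [dif_pos ⟨i.2, h⟩, if_pos h]
    rfl
  · rw [dif_neg fun h' => h h'.2, if_neg h, map_zero]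

theorem heavyTerm_of_le (M : Matrix (Bits r) (Bits r) ℂ) {i : ℕ} (hi : m ≤ i) :
    heavyTerm T M i = 0 := dif_neg fun h => absurd h.1 (not_lt.mpr hi)

/-- The error of the sampled energy is a sum of independent contributions of the blocks. -/
theorem sum_sampleWeight_mul_sub (M : Matrix (Bits r) (Bits r) ℂ) (ψ : Bits n → ℂ) {B J : ℕ}
    (hB : m ≤ B * 2 ^ J) (tape : ℕ → Bool) :
    ∑ i, sampleWeight T J tape i * energy (T i) M ψ - ∑ i, energy (T i) M ψ =
      ∑ b : Fin B, (2 ^ J * reQuadForm ψ (heavyTerm T M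
          (b * 2 ^ J + digitsValue (coinBlocks B J tape b))) -
        ∑ i ∈ range (2 ^ J), reQuadForm ψ (heavyTerm T M (b * 2 ^ J + i))) := by
  classical
  let e : ℕ → ℝ := fun i => reQuadForm ψ (heavyTerm T M i)
  let W : ℕ → ℝ := fun i => if i % 2 ^ J = draw tape (i / 2 ^ J * J) J then 2 ^ J else 0
  have hblock : ∀ b : Fin B, 2 ^ J * e (b * 2 ^ J + digitsValue (coinBlocks B J tape b)) -
      ∑ i ∈ range (2 ^ J), e (b * 2 ^ J + i) =
      ∑ i ∈ range (2 ^ J), (W (b * 2 ^ J + i) - 1) * e (b * 2 ^ J + i) := by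
    intro b
    have h : ∀ i ∈ range (2 ^ J), (W (b * 2 ^ J + i) - 1) * e (b * 2 ^ J + i) =
        (if i = digitsValue (coinBlocks B J tape b) then 2 ^ J * e (b * 2 ^ J + i) else 0) -
          e (b * 2 ^ J + i) := by
      intro i hi
      have hi' := mem_range.mp hi
      have h1 : (b * 2 ^ J + i) / 2 ^ J = (b : ℕ) := by
        rw [mul_comm, Nat.mul_add_div (by positivity), Nat.div_eq_of_lt hi', add_zero]
      have h2 : (b * 2 ^ J + i) % 2 ^ J = i := by
        rw [mul_comm, Nat.mul_add_mod, Nat.mod_eq_of_lt hi']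
      simp only [W, h1, h2, draw_eq_digitsValue]
      split_ifs <;> ring
    rw [sum_congr rfl h, sum_sub_distrib, sum_ite_eq', if_pos]
    exact mem_range.mpr (draw_lt _ _)
  change _ = ∑ b : Fin B, (2 ^ J * e (b * 2 ^ J + digitsValue (coinBlocks B J tape b)) -
      ∑ i ∈ range (2 ^ J), e (b * 2 ^ J + i))
  rw [sum_congr rfl fun b _ => hblock b,
    ← sum_range_mul_eq B (2 ^ J) fun i => (W i - 1) * e i,
    ← sum_subset (range_subset_range.mpr hB), Finset.sum_range, ← sum_sub_distrib]
  · refine sum_congr rfl fun i _ => ?_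
    simp only [e, W, reQuadForm_heavyTerm, sampleWeight]
    by_cases hi : IsHeavy T i
    · simp only [if_pos hi]
      ring
    · simp only [if_neg hi]
      ring
  · intro i _ hi
    simp only [e, heavyTerm_of_le T M (not_lt.mp fun h => hi (mem_range.mpr h)), map_zero, mul_zero]

theorem sampleWeight_nonneg (J : ℕ) (tape : ℕ → Bool) (i : Fin m) : 0 ≤ sampleWeight T J tape i := by
  unfold sampleWeight
  split_ifs <;> positivity

theorem sampleWeight_zero (tape : ℕ → Bool) : sampleWeight T 0 tape = 1 := by
  funext i
  simp [sampleWeight, draw, Nat.mod_one]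

theorem weightSize_sampleWeight_le (hr : 1 ≤ r) {B J : ℕ} (hB : m ≤ B * 2 ^ J) (tape : ℕ → Bool) :
    weightSize (sampleWeight T J tape) ≤ heavyBound r * n + B := by
  classical
  unfold weightSize
  rw [Nat.card_eq_fintype_card, Fintype.card_subtype]
  let S := univ.filter fun i : Fin m => (i : ℕ) % 2 ^ J = draw tape (i / 2 ^ J * J) J
  have hsub : (univ.filter fun i => 0 < sampleWeight T J tape i) ⊆
      (univ.filter fun i => ¬ IsHeavy T i) ∪ S := by
    intro i hi
    have hi := (mem_filter.mp hi).2
    by_cases hh : IsHeavy T i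
    · refine mem_union_right _ (mem_filter.mpr ⟨mem_univ _, ?_⟩)
      by_contra hne
      rw [sampleWeight, if_pos hh, if_neg hne] at hi
      exact lt_irrefl _ hi
    · exact mem_union_left _ (mem_filter.mpr ⟨mem_univ _, hh⟩)
  have hS : S.card ≤ B := by
    rw [← card_range B]
    refine card_le_card_of_injOn (fun i => (i : ℕ) / 2 ^ J) (fun i _ => ?_) fun i hi j hj hij => ?_
    · exact mem_coe.mpr (mem_range.mpr
        ((Nat.div_lt_iff_lt_mul (by positivity)).mpr (lt_of_lt_of_le i.2 hB)))
    · have hi := (mem_filter.mp (mem_coe.mp hi)).2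
      have hj := (mem_filter.mp (mem_coe.mp hj)).2
      have hij : (i : ℕ) / 2 ^ J = j / 2 ^ J := hij
      refine Fin.ext ?_
      rw [← Nat.div_add_mod (i : ℕ) (2 ^ J), ← Nat.div_add_mod (j : ℕ) (2 ^ J), hi, hj, hij]
  exact (card_le_card hsub).trans ((card_union_le _ _).trans
    (add_le_add (card_not_heavy_le hr T) hS))

theorem isSparsifier_of_abs_sub_le {ε : ℝ} {w : Fin m → ℝ} (hw : ∀ i, 0 ≤ w i)
    (h : ∀ ψ : Bits n → ℂ, |∑ i, w i * energy (T i) M ψ - ∑ i, energy (T i) M ψ| ≤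
      ε * ∑ i, energy (T i) M ψ) : IsSparsifier T M ε w := by
  refine ⟨hw, fun ψ => ?_⟩
  have := abs_le.mp (h ψ)
  constructor <;> linarith

/-- The energy of the heavy terms of a predicate matrix in `gapSet r C g`, per heavy term and for a
normalised state, is at least this. -/
noncomputable def heavyGap (r : ℕ) (g : ℝ) : ℝ := g / (2 ^ r * (2 * heavyBound r)) / r

theorem heavyGap_pos (hr : 1 ≤ r) {g : ℝ} (hg : 0 < g) : 0 < heavyGap r g := by
  have : 0 < heavyBound r := Nat.succ_pos _
  unfold heavyGap
  positivity

theorem heavyGap_le_one (hr : 1 ≤ r) {g : ℝ} (hg : g ≤ 1) : heavyGap r g ≤ 1 := by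
  have h1 : (1 : ℝ) ≤ heavyBound r := by exact_mod_cast Nat.succ_pos _
  have h2 : (1 : ℝ) ≤ 2 ^ r := one_le_pow₀ one_le_two
  have h3 : (1 : ℝ) ≤ r := by exact_mod_cast hr
  unfold heavyGap
  rw [div_le_one (by positivity), div_le_iff₀ (by positivity)]
  nlinarith [mul_le_mul h2 h1 zero_le_one (by positivity)]

open Classical in
theorem heavyGap_mul_le_sum_energy (hr : 1 ≤ r) {C g : ℝ} (hg : 0 < g) (hM : M ∈ gapSet r C g)
    (ψ : Bits n → ℂ) :
    heavyGap r g * (univ.filter (IsHeavy T)).card * ∑ x, ‖ψ x‖ ^ 2 ≤ ∑ i, energy (T i) M ψ := by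
  have h := card_heavy_mul_le_sum_energy hg hM T ψ
  have h2 : ∑ i ∈ univ.filter (IsHeavy T), energy (T i) M ψ ≤ ∑ i, energy (T i) M ψ :=
    sum_le_sum_of_subset_of_nonneg (filter_subset _ _) fun i _ _ => energy_nonneg (T i) hM.1 ψ
  have hr' : (0 : ℝ) < r := by exact_mod_cast hr
  refine le_trans ?_ h2
  unfold heavyGap
  rw [div_mul_eq_mul_div, div_mul_eq_mul_div, div_le_iff₀ hr']
  linarith

/-- The choice of the constants in the tail bound: `N` is the block size, `B` the number of blocks,
`Nh` the number of heavy terms. -/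
theorem exponent_le {n m k B N Nh C l K ε : ℝ} (hn : 0 ≤ n) (hk : 0 < k) (hN : 0 < N) (hC : 0 < C)
    (hl : 0 < l) (hm : K * (n * (k * k)) * N ≤ 2 * m) (hm0 : 0 ≤ m) (hB : B * N ≤ 2 * m)
    (hNh : m ≤ 2 * Nh) (hε : 1 / (2 * k) ≤ ε) (hK : 1536 * C ^ 2 ≤ K * l ^ 2) :
    2 * B * (l / (32 * k * C)) ^ 2 - l / (32 * k * C) * (ε * (l * Nh)) / (N * C) ≤ -(3 * n) := by
  set z := l ^ 2 * (m / N) / (256 * k ^ 2 * C ^ 2) with hz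
  have h1 : 2 * B * (l / (32 * k * C)) ^ 2 ≤ z := by
    calc 2 * B * (l / (32 * k * C)) ^ 2 ≤ 2 * (2 * (m / N)) * (l / (32 * k * C)) ^ 2 := by
          gcongr
          rwa [← mul_div_assoc, le_div_iff₀ hN]
      _ = z := by
          rw [hz]
          field_simp
          ring
  have h2 : 2 * z ≤ l / (32 * k * C) * (ε * (l * Nh)) / (N * C) := by
    calc 2 * z = l / (32 * k * C) * (1 / (2 * k) * (l * (m / 2))) / (N * C) := by
          rw [hz]
          field_simp
          ring
      _ ≤ _ := by
          have : m / 2 ≤ Nh := by linarith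
          have : 0 ≤ ε := le_trans (by positivity) hε
          gcongr
  have h3 : 3 * n ≤ z := by
    rw [hz, le_div_iff₀ (by positivity)]
    have h4 : K * (n * (k * k)) / 2 ≤ m / N := by
      rw [le_div_iff₀ hN]
      linarith
    calc 3 * n * (256 * k ^ 2 * C ^ 2) = 1536 * C ^ 2 * (n * (k * k) / 2) := by ring
      _ ≤ K * l ^ 2 * (n * (k * k) / 2) := by gcongr
      _ = l ^ 2 * (K * (n * (k * k)) / 2) := by ring
      _ ≤ l ^ 2 * (m / N) := by gcongr
  linarith

open Classical in
/-- Sampling one term of each block of size `2 ^ J ≥ 2` gives a sparsifier with high probability. -/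
theorem one_sub_le_coinMeasure_isSparsifier (hr : 1 ≤ r) {C g ε : ℝ} (hC : 1 ≤ C) (hg : 0 < g)
    (hg1 : g ≤ 1) (hM : M ∈ gapSet r C g) {K k B J : ℕ} (hn : 0 < n) (hk : 0 < k)
    (hε : 1 / (2 * k : ℝ) ≤ ε) (hK : 2 * heavyBound r ≤ K)
    (hK' : 1536 * C ^ 2 ≤ K * heavyGap r g ^ 2) (hm : K * (n * (k * k)) * 2 ^ J < m)
    (hB : ∀ b < B, b * 2 ^ (J + 1) < m) (hB' : m ≤ B * 2 ^ (J + 1)) :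
    1 - (2 : ℝ)⁻¹ ^ n ≤
      coinMeasure.real {tape | IsSparsifier T M ε (sampleWeight T (J + 1) tape)} := by
  have hl := heavyGap_pos hr hg
  set l := heavyGap r g
  set Nh := (univ.filter (IsHeavy T)).card with hNh
  have hk' : (1 : ℝ) ≤ k := by exact_mod_cast hk
  have hkk : 1 ≤ k * k := Nat.mul_pos hk hk
  have hε0 : 0 < ε := lt_of_lt_of_le (by positivity) hε
  have hb0 : 1 ≤ heavyBound r := Nat.succ_pos _
  set u := l / (32 * k * C)
  have hu : 0 < u := by positivity
  have hu1 : u ≤ 1 := by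
    have := heavyGap_le_one hr hg1
    rw [div_le_one (by positivity)]
    nlinarith [mul_le_mul hk' hC zero_le_one (by positivity)]
  -- at most half of the terms are light
  have hNm : m ≤ 2 * Nh := by
    have h1 : Nh + (univ.filter fun i => ¬ IsHeavy T i).card = m := by
      rw [hNh, card_filter_add_card_filter_not, card_univ, Fintype.card_fin]
    have h2 := card_not_heavy_le hr T
    have h3 : 2 * (heavyBound r * n) ≤ K * (n * (k * k)) * 2 ^ J := by
      calc 2 * (heavyBound r * n) = 2 * heavyBound r * (n * 1) * 1 := by ring
        _ ≤ K * (n * (k * k)) * 2 ^ J := by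
          gcongr
          exact Nat.one_le_two_pow
    omega
  -- the last block may be incomplete, but there are at least two blocks
  have hBm : B * 2 ^ (J + 1) ≤ 2 * m := by
    have h1 : 2 * 2 ^ J ≤ K * (n * (k * k)) * 2 ^ J := by
      have : 2 * (1 * 1) ≤ K * (n * (k * k)) := by
        gcongr
        · omega
        · exact hn
      exact Nat.mul_le_mul_right _ (by omega)
    rcases Nat.eq_zero_or_pos B with rfl | hBpos
    · simp
    · have h2 := hB (B - 1) (by omega)
      have h3 : B * 2 ^ (J + 1) = (B - 1) * 2 ^ (J + 1) + 2 * 2 ^ J := by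
        obtain ⟨B, rfl⟩ := Nat.exists_eq_add_of_lt hBpos
        simp
        ring
      omega
  set t := ε * (l * Nh) with ht
  have hbad := card_filter_block_sample_le (B := B) (J := J + 1) (t := t) (by linarith) hu hu1
    (by positivity) (posSemidef_heavyTerm T hM.1)
    (posSemidef_smul_one_sub_heavyTerm T (by linarith : 0 ≤ C) hM.2.1)
  set bad := univ.filter fun ω : Fin B → Fin (J + 1) → Bool => ¬ ∀ φ : Bits n → ℂ,
      |∑ b, (2 ^ (J + 1) * reQuadForm φ (heavyTerm T M (b * 2 ^ (J + 1) + digitsValue (ω b))) -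
        ∑ i ∈ range (2 ^ (J + 1)), reQuadForm φ (heavyTerm T M (b * 2 ^ (J + 1) + i)))| ≤
        t * ∑ i, ‖φ i‖ ^ 2
  have hexp : 2 * B * u ^ 2 - u * t / (2 ^ (J + 1) * C) ≤ -(3 * n : ℝ) := by
    refine exponent_le (m := m) (K := K) (by positivity) (by positivity) (by positivity)
      (by positivity) hl ?_ (by positivity) (by exact_mod_cast hBm) (by exact_mod_cast hNm) hε hK'
    have : (K * (n * (k * k)) * 2 ^ J : ℝ) ≤ m := by exact_mod_cast hm.le
    rw [pow_succ]
    linarith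
  have hcard : bad.card / (2 ^ (J + 1) : ℝ) ^ B ≤ (2 : ℝ)⁻¹ ^ n := by
    rw [div_le_iff₀ (by positivity)]
    refine hbad.trans ?_
    have he : Real.exp (2 * B * u ^ 2 - u * t / (2 ^ (J + 1) * C)) ≤ (2 : ℝ)⁻¹ ^ (3 * n) := by
      calc _ ≤ Real.exp (-(3 * n : ℝ)) := Real.exp_le_exp.mpr hexp
        _ = (Real.exp 1)⁻¹ ^ (3 * n) := by
          rw [← Real.exp_neg, ← Real.exp_nat_mul]
          push_cast
          ring_nf
        _ ≤ (2 : ℝ)⁻¹ ^ (3 * n) := by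
          have := Real.add_one_le_exp 1
          gcongr
          linarith
    have hcard : (Fintype.card (Bits n) : ℝ) = 2 ^ n := by simp
    rw [hcard]
    have h2n : 2 * (2 : ℝ)⁻¹ ^ n ≤ 1 := by
      obtain ⟨n, rfl⟩ := Nat.exists_eq_add_of_lt hn
      rw [zero_add, pow_succ]
      have : (2 : ℝ)⁻¹ ^ n ≤ 1 := pow_le_one₀ (by norm_num) (by norm_num)
      linarith
    have h2n' : (2 : ℝ) ^ n * (2 : ℝ)⁻¹ ^ n = 1 := by rw [← mul_pow]; norm_num
    calc _ ≤ 2 * (2 ^ (J + 1)) ^ B * 2 ^ n * (2 : ℝ)⁻¹ ^ (3 * n) := by gcongr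
      _ = (2 * (2 : ℝ)⁻¹ ^ n) * (2 ^ n * (2 : ℝ)⁻¹ ^ n) * ((2 : ℝ)⁻¹ ^ n * (2 ^ (J + 1)) ^ B) := by
        ring
      _ ≤ 1 * 1 * ((2 : ℝ)⁻¹ ^ n * (2 ^ (J + 1)) ^ B) := by
        rw [h2n']
        gcongr
      _ = _ := by ring
  refine le_trans (by linarith) (one_sub_card_div_le_coinMeasure_real bad fun tape htape => ?_)
  have hgood : ∀ φ : Bits n → ℂ, _ := not_not.mp fun h => htape (mem_filter.mpr ⟨mem_univ _, h⟩)
  refine isSparsifier_of_abs_sub_le T (sampleWeight_nonneg T _ tape) fun ψ => ?_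
  rw [sum_sampleWeight_mul_sub T M ψ hB' tape]
  refine (hgood ψ).trans ?_
  rw [ht, mul_assoc]
  exact mul_le_mul_of_nonneg_left (heavyGap_mul_le_sum_energy T hr hg hM ψ) hε0.le

end Sampling

/-! ### Running time, error probability and size -/

section Main
open Finset
variable {r n m : ℕ}

/-- The algorithm always halts in quadratic time; it outputs the zero weights if `q < p`, and
samples one term from each of a small number of blocks otherwise. -/
theorem exists_exec_progSparsify_total (hr : 1 ≤ r) {K p : ℕ} (hp : 0 < p) (hK : 0 < K) (q : ℕ)
    (T : Fin m ↪ (Fin r ↪ Fin n)) :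
    (q < p ∧ ∀ tape, ∃ s', Exec tape (progSparsify r K (heavyBound r)) (inputStore T p q)
      ((4 * K + 23 * r + 150) * (n + m + 1) ^ 2) s' ∧ outputWeight r m s' = 0) ∨
    ∃ k J B, 0 < k ∧ k = min (m + 1) (q / p) ∧
      (∀ i < J, K * (n * (k * k)) * 2 ^ i < m) ∧ (∀ b < B, b * 2 ^ J < m) ∧ m ≤ B * 2 ^ J ∧
      B ≤ K * (n * (k * k)) ∧
      ∀ tape, ∃ s', Exec tape (progSparsify r K (heavyBound r)) (inputStore T p q)
        ((4 * K + 23 * r + 150) * (n + m + 1) ^ 2) s' ∧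
        outputWeight r m s' = sampleWeight T J tape := by
  by_cases hqp : q < p
  · exact Or.inl ⟨hqp, exists_exec_progSparsify_of_lt T K _ hqp⟩
  right
  obtain ⟨k, hk⟩ : ∃ k, k = min (m + 1) (q / p) := ⟨_, rfl⟩
  have hk0 : 0 < k := hk ▸ lt_min (Nat.succ_pos m) (Nat.div_pos (not_lt.mp hqp) hp)
  have hx : 0 < m → 0 < K * (n * (k * k)) := by
    intro hm
    have hn : 0 < n := Fin.pos (T ⟨0, hm⟩ ⟨0, hr⟩)
    positivity
  obtain ⟨J, B, h1, h2, h3, h4, h5, h6, h7⟩ := exists_blocks m hx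
  exact ⟨k, J, B, hk0, hk, h1, h4, h5, h7,
    exists_exec_progSparsify T K hp hk hk0 h1 h2 h3 h4 h5 h6⟩

/-- The algorithm outputs a small sparsifier with high probability. The number `k` satisfies
`k ≤ q / p ≤ 2 / ε`, which bounds the size, and `1 / (2 * k) ≤ ε` where the sampling needs it. -/
theorem one_sub_le_coinMeasure_progSparsify (hr : 1 ≤ r) {C g ε : ℝ} (hC : 1 ≤ C) (hg : 0 < g)
    (hg1 : g ≤ 1) {M : Matrix (Bits r) (Bits r) ℂ} (hM : M ∈ gapSet r C g) {K : ℕ}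
    (hK : 2 * heavyBound r ≤ K) (hK' : 1536 * C ^ 2 ≤ K * heavyGap r g ^ 2)
    (T : Fin m ↪ (Fin r ↪ Fin n)) {p q : ℕ} (hp : 0 < p) (hq : 0 < q) (hε : (p / q : ℝ) ≤ ε)
    (hε' : ε ≤ 2 * (p / q : ℝ)) :
    1 - (2 : ℝ)⁻¹ ^ n ≤ coinMeasure.real {tape | ∃ s', Exec tape (progSparsify r K (heavyBound r))
      (inputStore T p q) ((4 * K + 23 * r + 150) * (n + m + 1) ^ 2) s' ∧
      IsSparsifier T M ε (outputWeight r m s') ∧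
      (weightSize (outputWeight r m s') : ℝ) ≤ (4 * (heavyBound r + K) : ℕ) * ε⁻¹ ^ 2 * n} := by
  have hp' : (0 : ℝ) < p := by exact_mod_cast hp
  have hq' : (0 : ℝ) < q := by exact_mod_cast hq
  have hε0 : 0 < ε := lt_of_lt_of_le (by positivity) hε
  have hK0 : 0 < K := lt_of_lt_of_le (Nat.mul_pos two_pos (Nat.succ_pos _)) hK
  have hle1 : 1 - (2 : ℝ)⁻¹ ^ n ≤ 1 := by
    have : (0 : ℝ) ≤ 2⁻¹ ^ n := by positivity
    linarith
  rcases exists_exec_progSparsify_total hr hp hK0 q T with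
    ⟨hqp, h⟩ | ⟨k, J, B, hk0, hk, h1, hB, hB', hBx, h⟩
  · -- here `1 < ε`
    refine hle1.trans (le_of_eq ?_)
    rw [← probReal_univ (μ := coinMeasure)]
    congr 1
    refine (Set.eq_univ_of_forall fun tape => ?_).symm
    obtain ⟨s', hs', hw⟩ := h tape
    have hε1 : 1 < ε := lt_of_lt_of_le
      ((one_lt_div hq').mpr (by exact_mod_cast hqp)) hε
    refine ⟨s', hs', ?_, ?_⟩ <;> rw [hw]
    · refine ⟨fun i => le_rfl, fun ψ => ?_⟩
      have : 0 ≤ ∑ i, energy (T i) M ψ := sum_nonneg fun i _ => energy_nonneg (T i) hM.1 ψ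
      simp only [Pi.zero_apply, zero_mul, sum_const_zero]
      constructor <;> nlinarith
    · simp only [weightSize, Pi.zero_apply, lt_irrefl, Nat.card_of_isEmpty, Nat.cast_zero]
      positivity
  have hkq : k * p ≤ q := by
    have : k ≤ q / p := hk ▸ min_le_right _ _
    exact (Nat.le_div_iff_mul_le hp).mp this
  have hkε : k * ε ≤ 2 := by
    have : (k * p : ℝ) ≤ q := by exact_mod_cast hkq
    calc k * ε ≤ k * (2 * (p / q)) := by gcongr
      _ = 2 * (k * p / q) := by ring
      _ ≤ 2 * 1 := by
        gcongr
        exact (div_le_one hq').mpr this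
      _ = 2 := mul_one 2
  have hsize : ∀ tape, (weightSize (sampleWeight T J tape) : ℝ) ≤
      (4 * (heavyBound r + K) : ℕ) * ε⁻¹ ^ 2 * n := by
    intro tape
    have hkk : 1 ≤ k * k := Nat.mul_pos hk0 hk0
    have h2 : weightSize (sampleWeight T J tape) ≤ (heavyBound r + K) * n * (k * k) := by
      refine (weightSize_sampleWeight_le T hr hB' tape).trans ?_
      have := Nat.le_mul_of_pos_right (heavyBound r * n) hkk
      calc _ ≤ heavyBound r * n * (k * k) + K * (n * (k * k)) := add_le_add this hBx
        _ = _ := by ring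
    have h3 : (k : ℝ) ≤ 2 * ε⁻¹ := by
      rw [← div_eq_mul_inv, le_div_iff₀ hε0]
      exact hkε
    have h4 : (k * k : ℝ) ≤ 4 * ε⁻¹ ^ 2 := by
      calc (k * k : ℝ) ≤ (2 * ε⁻¹) * (2 * ε⁻¹) := by gcongr
        _ = _ := by ring
    calc (weightSize (sampleWeight T J tape) : ℝ) ≤ ((heavyBound r + K) * n * (k * k) : ℕ) := by
          exact_mod_cast h2
      _ = (heavyBound r + K) * n * (k * k) := by push_cast; ring
      _ ≤ (heavyBound r + K) * n * (4 * ε⁻¹ ^ 2) := by gcongr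
      _ = _ := by push_cast; ring
  suffices hs : 1 - (2 : ℝ)⁻¹ ^ n ≤
      coinMeasure.real {tape | IsSparsifier T M ε (sampleWeight T J tape)} by
    refine hs.trans (measureReal_mono fun tape htape => ?_)
    obtain ⟨s', hs', hw⟩ := h tape
    exact ⟨s', hs', hw.symm ▸ htape, hw.symm ▸ hsize tape⟩
  rcases J with _ | J
  · -- blocks of size `1`: nothing is left out
    refine hle1.trans (le_of_eq ?_)
    rw [← probReal_univ (μ := coinMeasure)]
    congr 1
    refine (Set.eq_univ_of_forall fun tape => ?_).symm
    refine isSparsifier_of_abs_sub_le T (sampleWeight_nonneg T 0 tape) fun ψ => ?_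
    have : 0 ≤ ∑ i, energy (T i) M ψ := sum_nonneg fun i _ => energy_nonneg (T i) hM.1 ψ
    simp only [sampleWeight_zero, Pi.one_apply, one_mul, sub_self, abs_zero]
    positivity
  rcases Nat.eq_zero_or_pos n with rfl | hn
  · simp
  have hm := h1 J (Nat.lt_succ_self J)
  refine one_sub_le_coinMeasure_isSparsifier T hr hC hg hg1 hM hn hk0 ?_ hK hK' hm hB hB'
  -- as `k < m + 1`, the ratio `q / p` has not been truncated
  have hkm : k < m + 1 := by
    have : 1 * (1 * (1 * k)) * 1 ≤ K * (n * (k * k)) * 2 ^ J := by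
      gcongr
      · exact hK0
      · exact hn
      · exact hk0
      · exact Nat.one_le_two_pow
    omega
  have hqk : q < 2 * k * p := by
    have h2 : q / p < k + 1 := by
      rcases min_choice (m + 1) (q / p) with h | h <;> omega
    have h3 := (Nat.div_lt_iff_lt_mul hp).mp h2
    have : (k + 1) * p ≤ 2 * k * p := Nat.mul_le_mul_right _ (by omega)
    omega
  refine le_trans ?_ hε
  rw [div_le_div_iff₀ (by positivity) hq', one_mul]
  have : (q : ℝ) ≤ 2 * k * p := by exact_mod_cast hqk.le
  linarith

end Main

theorem mainTheorem2 :
    ∃ c : ℝ, 0 < c ∧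
    ∀ (r R : ℕ), 1 ≤ r → 2 ^ (r - 1) + 1 ≤ R →
    ∀ D : Measure (Matrix (Bits r) (Bits r) ℂ), IsPredicateLaw R D →
    ∀ δ : ℝ, 0 < δ →
    ∃ (K : ℝ) (l a b : ℕ) (P : Prog),
      -- the running time is polynomial in `n` and `m`, for all inputs and all coin tosses
      (∀ (n m : ℕ) (T : Fin m ↪ (Fin r ↪ Fin n)) (p q : ℕ), 0 < p → 0 < q →
        ∀ tape : ℕ → Bool,
          (runFor P tape (a * (n + m + 1) ^ b) (inputStore T p q)).1 = []) ∧
      -- with probability at least `1 - δ` over the predicate matrix `M`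
      ∃ G : Set (Matrix (Bits r) (Bits r) ℂ), MeasurableSet G ∧ 1 - δ ≤ D.real G ∧
        ∀ M ∈ G, ∀ (n m : ℕ) (T : Fin m ↪ (Fin r ↪ Fin n)) (ε : ℝ), 0 < ε →
          -- a small sparsifier exists
          (∃ w : Fin m → ℝ, IsSparsifier T M ε w ∧
            (weightSize w : ℝ) ≤ K * ε⁻¹ ^ 2 * n * Real.log (n + 2) ^ l) ∧
          -- and the algorithm, given `ε` up to a factor of two, finds one
          (∀ p q : ℕ, 0 < p → 0 < q → (p / q : ℝ) ≤ ε → ε ≤ 2 * (p / q : ℝ) →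
            1 - (2 : ℝ) ^ (-(c * n)) ≤
              coinMeasure.real {tape : ℕ → Bool |
                let w := outputWeight r m
                  (runFor P tape (a * (n + m + 1) ^ b) (inputStore T p q)).2
                IsSparsifier T M ε w ∧
                (weightSize w : ℝ) ≤ K * ε⁻¹ ^ 2 * n * Real.log (n + 2) ^ l}) := by
  refine ⟨1, one_pos, fun r R hr hR D hD δ hδ => ?_⟩
  obtain ⟨C, g, hC, hg, hg1, hG⟩ := exists_gapSet_of_isPredicateLaw hR hD hδ
  have hl := heavyGap_pos hr hg
  obtain ⟨K', hK'⟩ := exists_nat_ge (1536 * C ^ 2 / heavyGap r g ^ 2)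
  rw [div_le_iff₀ (by positivity)] at hK'
  set K := max K' (2 * heavyBound r) with hKdef
  have hK1 : 2 * heavyBound r ≤ K := le_max_right _ _
  have hK2 : 1536 * C ^ 2 ≤ K * heavyGap r g ^ 2 := by
    refine hK'.trans ?_
    gcongr
    exact le_max_left _ _
  have hmain : ∀ M ∈ gapSet r C g, ∀ (n m : ℕ) (T : Fin m ↪ (Fin r ↪ Fin n)) (ε : ℝ),
      ∀ p q : ℕ, 0 < p → 0 < q → (p / q : ℝ) ≤ ε → ε ≤ 2 * (p / q : ℝ) →
      1 - (2 : ℝ)⁻¹ ^ n ≤ coinMeasure.real {tape : ℕ → Bool |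
        let w := outputWeight r m (runFor (progSparsify r K (heavyBound r)) tape
          ((4 * K + 23 * r + 150) * (n + m + 1) ^ 2) (inputStore T p q)).2
        IsSparsifier T M ε w ∧
        (weightSize w : ℝ) ≤ (4 * (heavyBound r + K) : ℕ) * ε⁻¹ ^ 2 * n * Real.log (n + 2) ^ 0} := by
    intro M hM n m T ε p q hp hq hε hε'
    refine (one_sub_le_coinMeasure_progSparsify hr hC hg hg1 hM hK1 hK2 T hp hq hε hε').trans
      (measureReal_mono fun tape htape => ?_)
    obtain ⟨s', hs', h⟩ := htape
    simp only [Set.mem_ofPred_eq, hs'.runFor_eq, pow_zero, mul_one]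
    exact h
  refine ⟨(4 * (heavyBound r + K) : ℕ), 0, 4 * K + 23 * r + 150, 2,
    progSparsify r K (heavyBound r), fun n m T p q hp hq tape => ?_,
    gapSet r C g, measurableSet_gapSet C g, hG, fun M hM n m T ε hε => ⟨?_, fun p q hp hq h h' => ?_⟩⟩
  · have hK0 : 0 < K := lt_of_lt_of_le (Nat.mul_pos two_pos (Nat.succ_pos _)) hK1
    rcases exists_exec_progSparsify_total hr hp hK0 q T with ⟨-, h⟩ | ⟨k, J, B, -, -, -, -, -, -, h⟩ <;>
    · obtain ⟨s', hs', -⟩ := h tape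
      rw [hs'.runFor_eq]
  · rcases Nat.eq_zero_or_pos n with rfl | hn
    · have : IsEmpty (Fin m) := ⟨fun i => (T i ⟨0, hr⟩).elim0⟩
      exact ⟨0, ⟨fun i => le_rfl, fun ψ => by simp⟩, by simp [weightSize]⟩
    -- a rational number between `ε / 2` and `ε`, to which the algorithm is applied
    obtain ⟨x, hx1, hx2⟩ := exists_rat_btwn (show ε / 2 < ε by linarith)
    have hx0 : 0 < x := by exact_mod_cast (by linarith : (0 : ℝ) < x)
    have hx : ((x.num.toNat : ℕ) / (x.den : ℕ) : ℝ) = x := by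
      have h1 : ((x.num.toNat : ℕ) : ℤ) = x.num := Int.toNat_of_nonneg (Rat.num_pos.mpr hx0).le
      have h2 : ((x.num.toNat : ℕ) : ℝ) = (x.num : ℝ) := by exact_mod_cast h1
      rw [h2]
      exact_mod_cast Rat.num_div_den x
    have h := hmain M hM n m T ε x.num.toNat x.den (by simpa using hx0) x.den_pos
      (by rw [hx]; exact hx2.le) (by rw [hx]; linarith)
    have hpos : (0 : ℝ) < 1 - (2 : ℝ)⁻¹ ^ n :=
      sub_pos.mpr (pow_lt_one₀ (by norm_num) (by norm_num) hn.ne')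
    obtain ⟨tape, htape⟩ := nonempty_of_measureReal_ne_zero (hpos.trans_le h).ne'
    exact ⟨_, htape⟩
  · refine le_of_eq_of_le ?_ (hmain M hM n m T ε p q hp hq h h')
    rw [one_mul, Real.rpow_neg (by norm_num), Real.rpow_natCast, inv_pow]
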